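/- Work over an algebraically closed field $K$. Consider a smooth conic $C\subset\mathbb P^3$, given by a parametrization $[s:t]\mapsto A(s^2,st,t^2)$ with $A$ an injective $4\times 3$ matrix, and five points $p_1,\dots,p_5\in\mathbb P^3$, given by coordinate vectors $v_1,\dots,v_5\in K^4$. Say that $(A,v)$ is in general position if no four of the $p_i$ are coplanar, no $p_i$ lies in the plane of $C$, and no line joining two of the $p_i$ meets $C$. Say that $C$ and the $p_i$ lie on a quadric surface $Q$ if $Q$ is the zero locus of a nonzero quadratic form that vanishes on $C$ and at all $p_i$. Configurations in general position that lie on a quadric surface exist, and there is a polynomial $F$ in the coordinates of $(A,v)$ such that $F\ne 0$ on a Zariski dense subset of the set of these configurations and such that the following holds for every configuration in general position with $F\neq0$ (in this sense: for a general conic and five general points). (1) $C$ and $p_1,\dots,p_5$ lie on a quadric surface if and only if there is a twisted cubic passing through $p_1,\dots,p_5$ and meeting $C$ in exactly three (distinct) points. (2) If $C$ and $p_1,\dots,p_5$ lie on a quadric surface $Q$, then $Q$ is smooth, and for every isomorphism $Q\cong\mathbb P^1\times\mathbb P^1$ obtained from the Segre embedding by a projective linear change of coordinates of $\mathbb P^3$,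 the conic $C$ has bidegree $(1,1)$, and there are exactly two twisted cubics as in (1): one of bidegree $(1,2)$ and a second, different one of bidegree $(2,1)$ on $Q$. -/

import Mathlib

open scoped LinearAlgebra.Projectivization

/-- The points of `ℙ³` over `K`. -/
abbrev P3 (K : Type*) [Field K] : Type _ := ℙ K (Fin 4 → K)

/-- The vector `w` is nonzero and is a vector of homogeneous coordinates of the point `P`. -/
def Represents {K : Type*} [Field K] (w : Fin 4 → K) (P : P3 K) : Prop :=
  ∃ h : w ≠ 0, Projectivization.mk K w h = P

/-- The points with homogeneous coordinates `v 0, …, v 4` all belong to `X`. -/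
def PassesThrough {K : Type*} [Field K] (X : Set (P3 K)) (v : Fin 5 → Fin 4 → K) : Prop :=
  ∀ i, ∃ P ∈ X, Represents (v i) P

/-- The zero locus in `ℙ³` of a polynomial (used for quadratic forms). -/
def quadricLocus {K : Type*} [Field K] (Q : MvPolynomial (Fin 4) K) : Set (P3 K) :=
  {P | ∀ w ∈ P.submodule, MvPolynomial.eval w Q = 0}

/-- The curve in `ℙ³` parametrized by `[s : t] ↦ A (s², st, t²)`. As `A` ranges over the injective
`4 × 3` matrices, these are exactly the smooth conics of `ℙ³`. -/
def conic {K : Type*} [Field K] (A : Matrix (Fin 4) (Fin 3) K) : Set (P3 K) :=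
  {P | ∃ s t : K, (s ≠ 0 ∨ t ≠ 0) ∧ Represents (A.mulVec ![s ^ 2, s * t, t ^ 2]) P}

/-- Twisted cubics: the images of the standard rational normal curve
`[s : t] ↦ [s³ : s²t : st² : t³]` under the projective linear automorphisms of `ℙ³`. -/
def IsTwistedCubic {K : Type*} [Field K] (T : Set (P3 K)) : Prop :=
  ∃ M : Matrix (Fin 4) (Fin 4) K, M.det ≠ 0 ∧
    T = {P | ∃ s t : K, (s ≠ 0 ∨ t ≠ 0) ∧
      Represents (M.mulVec ![s ^ 3, s ^ 2 * t, s * t ^ 2, t ^ 3]) P}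

/-- The map `ℙ¹ × ℙ¹ → ℙ³` obtained from the Segre embedding by the linear map `g`, in homogeneous
coordinates. For invertible `g` it is an isomorphism onto a smooth quadric, and over an
algebraically closed field every smooth quadric arises in this way. -/
def segreMap {K : Type*} [Field K] (g : Matrix (Fin 4) (Fin 4) K) (x y : Fin 2 → K) : Fin 4 → K :=
  g.mulVec ![x 0 * y 0, x 0 * y 1, x 1 * y 0, x 1 * y 1]

/-- The image of `ℙ¹ × ℙ¹` under `segreMap g`. -/
def segreQuadric {K : Type*} [Field K] (g : Matrix (Fin 4) (Fin 4) K) : Set (P3 K) :=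
  {P | ∃ x y : Fin 2 → K, x ≠ 0 ∧ y ≠ 0 ∧ Represents (segreMap g x y) P}

/-- `X` is an irreducible curve of bidegree `(a, b)` on the quadric `segreQuadric g ≅ ℙ¹ × ℙ¹`:
it is the zero locus of an irreducible form of degree `a` in the coordinates of the first factor
and of degree `b` in the coordinates of the second factor. -/
def HasBidegree {K : Type*} [Field K] (g : Matrix (Fin 4) (Fin 4) K) (X : Set (P3 K))
    (a b : ℕ) : Prop :=
  ∃ G : MvPolynomial (Fin 2 ⊕ Fin 2) K,
    Irreducible G ∧
    MvPolynomial.IsWeightedHomogeneous (Sum.elim (fun _ => 1) (fun _ => 0) : Fin 2 ⊕ Fin 2 → ℕ) G a ∧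
    MvPolynomial.IsWeightedHomogeneous (Sum.elim (fun _ => 0) (fun _ => 1) : Fin 2 ⊕ Fin 2 → ℕ) G b ∧
    X = {P | ∃ x y : Fin 2 → K, x ≠ 0 ∧ y ≠ 0 ∧ MvPolynomial.eval (Sum.elim x y) G = 0 ∧
      Represents (segreMap g x y) P}

/-- The conic is smooth (with spanning plane `H`, the image of `A`), no four of the five points are
coplanar, none of them lies in `H`, and no line joining two of them meets the conic. -/
def InGeneralPosition {K : Type*} [Field K] (A : Matrix (Fin 4) (Fin 3) K)
    (v : Fin 5 → Fin 4 → K) : Prop :=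
  Function.Injective A.mulVec ∧
  (∀ k : Fin 5, LinearIndependent K (fun j : Fin 4 => v (k.succAbove j))) ∧
  (∀ i, ∀ u : Fin 3 → K, A.mulVec u ≠ v i) ∧
  (∀ i j, i ≠ j → ∀ P ∈ conic A, ¬ P.submodule ≤ Submodule.span K {v i, v j})

/-- The quadric surface `Q = 0` contains the conic and the five points. -/
def IsQuadricThrough {K : Type*} [Field K] (Q : MvPolynomial (Fin 4) K)
    (A : Matrix (Fin 4) (Fin 3) K) (v : Fin 5 → Fin 4 → K) : Prop :=
  Q ≠ 0 ∧ Q.IsHomogeneous 2 ∧ conic A ⊆ quadricLocus Q ∧ PassesThrough (quadricLocus Q) v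

/-- `T` is a twisted cubic through the five points that meets the conic in three (distinct)
points. -/
def IsTrisecantCubic {K : Type*} [Field K] (T : Set (P3 K))
    (A : Matrix (Fin 4) (Fin 3) K) (v : Fin 5 → Fin 4 → K) : Prop :=
  IsTwistedCubic T ∧ PassesThrough T v ∧ (T ∩ conic A).ncard = 3

/-- The value of a polynomial in the `12 + 20` coordinates of a conic and five points. -/
noncomputable def evalConfig {K : Type*} [Field K]
    (F : MvPolynomial ((Fin 4 × Fin 3) ⊕ (Fin 5 × Fin 4)) K)
    (A : Matrix (Fin 4) (Fin 3) K) (v : Fin 5 → Fin 4 → K) : K :=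
  MvPolynomial.eval (Sum.elim (fun e => A e.1 e.2) (fun e => v e.1 e.2)) F

/-- The configurations in general position that lie on a quadric. -/
def QuadricConfig {K : Type*} [Field K] (A : Matrix (Fin 4) (Fin 3) K)
    (v : Fin 5 → Fin 4 → K) : Prop :=
  InGeneralPosition A v ∧ ∃ Q, IsQuadricThrough Q A v

/-- The Zariski open condition `F ≠ 0` is a genericity condition which is meaningful for
configurations that lie on a quadric: there are such configurations, and `F ≠ 0` holds on a
Zariski dense subset of them (every basic open set `G ≠ 0` that contains one of them contains one
with `F ≠ 0`). Since lying on a quadric is a condition of codimension one, `F ≠ 0` alone, for some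
nonzero polynomial `F`, would allow one to discard all the configurations on a quadric. -/
def IsGenericityCondition {K : Type*} [Field K]
    (F : MvPolynomial ((Fin 4 × Fin 3) ⊕ (Fin 5 × Fin 4)) K) : Prop :=
  (∃ A v, QuadricConfig (K := K) A v) ∧
  ∀ A v, QuadricConfig (K := K) A v →
    ∀ G : MvPolynomial ((Fin 4 × Fin 3) ⊕ (Fin 5 × Fin 4)) K, evalConfig G A v ≠ 0 →
      ∃ A' v', QuadricConfig A' v' ∧ evalConfig G A' v' ≠ 0 ∧ evalConfig F A' v' ≠ 0

/-! ### Homogeneous coordinates of points -/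

section Projective

variable {K : Type*} [Field K]

/-! Let `q` be the form of a quadric Q through the configuration. On the plane of C it is κ(u₀u₂ -
u₁²), and κ ≠ 0: if `q` vanished on the plane, its value where the line pᵢpⱼ meets the plane would
force every polar value of `q` at pᵢ, pⱼ to vanish, and then `q` = 0 (`quadraticForm_eq_zero`).
Hence Q is unique. The same computation (`secantForm_mul`) shows that no two pᵢ lie on a common line
of Q, since the line pᵢpⱼ misses C.

The twisted cubics come from a Cremona transformation. Take p₁, …, p₄ as coordinate vertices and p₅
as (1:1:1:1). The map X_l ↦ 1/X_l turns twisted cubics through the five points into lines through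
(1:1:1:1), and Q into another quadric Q' through the vertices and that point. The lines of Q'
through (1:1:1:1) are cut out by the tangent plane there, which pulls back to a cubic surface S. So
a point of C on S lies on a twisted cubic that passes through the five points and is contained in Q
(`exists_twistedCubic_through`). Restricting S to C gives the binary sextic `conicSextic`; its
coefficients are polynomials in (A, v) because `secantForm` replaces the polar values. If it has six
distinct roots, there are six points of C, each on such a cubic.

On Q ≅ ℙ¹ × ℙ¹ a twisted cubic is the graph of a quadratic map between the factors, in one of the
two directions (`IsTwistedCubic.isQuadraticGraph`), and five points on distinct rulings lie on at
most one graph of each kind (`IsQuadraticGraph.unique`). So there are at most two cubics. Each meets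
the plane of C in at most three points, and together they contain six points of C; so there are
exactly two, with three points each (`exists_trisecant_pair`). Conversely, the quadrics containing a
twisted cubic form a net. If the cubic meets C in three points, some member of the net contains two
further points of C, hence contains C (`IsTrisecantCubic.exists_quadric`). By uniqueness this member
is Q, so there are no other trisecant cubics.

The polynomial F is `genericity`: a Gram determinant that detects smoothness of Q, the leading
coefficient of the sextic, and its resultant with its derivative. For density, the configurations on
quadrics are the image of an open subset of an affine space, so any two are joined by a line of
parameters (`QuadricConfig.exists_evalConfig_ne_zero`). It then suffices to have one configuration
with F ≠ 0; `ExampleParameters` supplies it in every characteristic. -/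

theorem exists_represents (P : P3 K) : ∃ w, Represents w P :=
  ⟨P.rep, P.rep_nonzero, P.mk_rep⟩

theorem Represents.ne_zero {w : Fin 4 → K} {P : P3 K} (h : Represents w P) : w ≠ 0 := h.1

theorem represents_mk {w : Fin 4 → K} (h : w ≠ 0) : Represents w (Projectivization.mk K w h) :=
  ⟨h, rfl⟩

theorem Represents.mem_submodule_iff {w x : Fin 4 → K} {P : P3 K} (h : Represents w P) :
    x ∈ P.submodule ↔ ∃ a : K, x = a • w := by
  obtain ⟨h0, rfl⟩ := h
  rw [Projectivization.submodule_mk, Submodule.mem_span_singleton]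
  simp [eq_comm]

theorem Represents.iff_smul {w x : Fin 4 → K} {P : P3 K} (h : Represents w P) :
    Represents x P ↔ ∃ a : K, a ≠ 0 ∧ x = a • w := by
  obtain ⟨h0, rfl⟩ := h
  constructor
  · rintro ⟨hx, he⟩
    rw [Projectivization.mk_eq_mk_iff'] at he
    obtain ⟨a, rfl⟩ := he
    refine ⟨a, ?_, rfl⟩
    rintro rfl
    simp at hx
  · rintro ⟨a, ha, rfl⟩
    refine ⟨smul_ne_zero ha h0, ?_⟩
    rw [Projectivization.mk_eq_mk_iff']
    exact ⟨a, rfl⟩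

theorem Represents.smul {w : Fin 4 → K} {P : P3 K} (h : Represents w P) {a : K} (ha : a ≠ 0) :
    Represents (a • w) P := h.iff_smul.2 ⟨a, ha, rfl⟩

theorem Represents.unique {w : Fin 4 → K} {P P' : P3 K} (h : Represents w P)
    (h' : Represents w P') : P = P' := by
  obtain ⟨_, rfl⟩ := h
  obtain ⟨_, rfl⟩ := h'
  rfl

theorem exists_smul_ne_zero_of_represents {w x : Fin 4 → K} {P : P3 K} (h : Represents w P)
    (h' : Represents x P) : ∃ a : K, a ≠ 0 ∧ x = a • w := h.iff_smul.1 h'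

end Projective

/-! ### Binary forms with too many zeros -/

section BinaryForm

variable {K : Type*} [Field K]

/-- A binary form of degree `n` with `n + 1` zeros on the projective line is zero. -/
theorem binaryForm_coeff_eq_zero {n : ℕ} (c s t : Fin (n + 1) → K)
    (hst : ∀ i j, i ≠ j → s i * t j ≠ s j * t i)
    (h : ∀ i, ∑ k : Fin (n + 1), (s i ^ (k : ℕ) * t i ^ (k.rev : ℕ)) * c k = 0) : c = 0 := by
  refine Matrix.eq_zero_of_mulVec_eq_zero (M := Matrix.projVandermonde s t) ?_ ?_
  · rw [Matrix.det_projVandermonde]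
    refine Finset.prod_ne_zero_iff.2 fun i _ => Finset.prod_ne_zero_iff.2 fun j hj => ?_
    have := hst j i (Finset.mem_Ioi.1 hj).ne'
    rwa [sub_ne_zero]
  · funext i
    exact h i

theorem quartic_eq_zero (c0 c1 c2 c3 c4 : K) (s t : Fin 5 → K)
    (hst : ∀ i j, i ≠ j → s i * t j ≠ s j * t i)
    (h : ∀ i, c0 * s i ^ 4 + c1 * s i ^ 3 * t i + c2 * s i ^ 2 * t i ^ 2 + c3 * s i * t i ^ 3 +
      c4 * t i ^ 4 = 0) : c0 = 0 ∧ c1 = 0 ∧ c2 = 0 ∧ c3 = 0 ∧ c4 = 0 := by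
  have := binaryForm_coeff_eq_zero ![c4, c3, c2, c1, c0] s t hst (fun i => by
    rw [← h i, Fin.sum_univ_five]
    simp [Fin.rev]
    ring)
  have e := fun i => congrFun this i
  exact ⟨e 4, e 3, e 2, e 1, e 0⟩

theorem cubic_eq_zero (c0 c1 c2 c3 : K) (s t : Fin 4 → K)
    (hst : ∀ i j, i ≠ j → s i * t j ≠ s j * t i)
    (h : ∀ i, c0 * s i ^ 3 + c1 * s i ^ 2 * t i + c2 * s i * t i ^ 2 + c3 * t i ^ 3 = 0) :
    c0 = 0 ∧ c1 = 0 ∧ c2 = 0 ∧ c3 = 0 := by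
  have := binaryForm_coeff_eq_zero ![c3, c2, c1, c0] s t hst (fun i => by
    rw [← h i, Fin.sum_univ_four]
    simp [Fin.rev]
    ring)
  have e := fun i => congrFun this i
  exact ⟨e 3, e 2, e 1, e 0⟩

end BinaryForm

/-! ### Homogeneous polynomials of degree two as quadratic forms -/

section QuadraticForms

variable {K : Type*} [Field K]

theorem exists_linearMap_eval {m : MvPolynomial (Fin 4) K} (hm : m.IsHomogeneous 1) :
    ∃ l : (Fin 4 → K) →ₗ[K] K, ∀ w, l w = MvPolynomial.eval w m := by
  rw [← MvPolynomial.mem_homogeneousSubmodule, MvPolynomial.homogeneousSubmodule_one_eq_span_X]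
    at hm
  induction hm using Submodule.span_induction with
  | mem x hx =>
    obtain ⟨i, rfl⟩ := hx
    exact ⟨LinearMap.proj i, fun w => by simp⟩
  | zero => exact ⟨0, fun w => by simp⟩
  | add x y _ _ hx hy =>
    obtain ⟨l, hl⟩ := hx
    obtain ⟨l', hl'⟩ := hy
    exact ⟨l + l', fun w => by simp [hl, hl']⟩
  | smul a x _ hx =>
    obtain ⟨l, hl⟩ := hx
    exact ⟨a • l, fun w => by simp [hl]⟩

/-- Gives access to the polar form, which carries all later computations and is meaningful in
characteristic 2. -/
theorem exists_quadraticForm_eval {Q : MvPolynomial (Fin 4) K} (hQ : Q.IsHomogeneous 2) :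
    ∃ q : QuadraticForm K (Fin 4 → K), ∀ w, q w = MvPolynomial.eval w Q := by
  rw [← MvPolynomial.mem_homogeneousSubmodule, ← MvPolynomial.homogeneousSubmodule_one_pow,
    pow_two] at hQ
  induction hQ using Submodule.mul_induction_on' with
  | mem_mul_mem m hm n hn =>
    obtain ⟨l, hl⟩ := exists_linearMap_eval ((MvPolynomial.mem_homogeneousSubmodule _ _).1 hm)
    obtain ⟨l', hl'⟩ := exists_linearMap_eval ((MvPolynomial.mem_homogeneousSubmodule _ _).1 hn)
    exact ⟨QuadraticMap.linMulLin l l', fun w => by simp [hl, hl']⟩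
  | add x _ y _ hx hy =>
    obtain ⟨l, hl⟩ := hx
    obtain ⟨l', hl'⟩ := hy
    exact ⟨l + l', fun w => by simp [hl, hl']⟩

theorem mem_quadricLocus_iff {Q : MvPolynomial (Fin 4) K} (hQ : Q.IsHomogeneous 2) {P : P3 K}
    {w : Fin 4 → K} (h : Represents w P) :
    P ∈ quadricLocus Q ↔ MvPolynomial.eval w Q = 0 := by
  obtain ⟨q, hq⟩ := exists_quadraticForm_eval hQ
  constructor
  · intro hP
    exact hP w (h.mem_submodule_iff.2 ⟨1, by simp⟩)
  · intro h0 x hx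
    obtain ⟨a, rfl⟩ := h.mem_submodule_iff.1 hx
    rw [← hq, QuadraticMap.map_smul, hq, h0, smul_zero]

/-- Composition of a form with the linear map given by a matrix. -/
noncomputable def linearSubst (N : Matrix (Fin 4) (Fin 4) K) (Q : MvPolynomial (Fin 4) K) :
    MvPolynomial (Fin 4) K :=
  MvPolynomial.aeval (fun i => ∑ j, MvPolynomial.C (N i j) * MvPolynomial.X j) Q

theorem linearSubst_isHomogeneous (N : Matrix (Fin 4) (Fin 4) K) {Q : MvPolynomial (Fin 4) K}
    {n : ℕ} (hQ : Q.IsHomogeneous n) : (linearSubst N Q).IsHomogeneous n := by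
  have := hQ.aeval (fun i => ∑ j, MvPolynomial.C (N i j) * MvPolynomial.X j) (n := 1)
    (fun i => MvPolynomial.IsHomogeneous.sum _ _ _
      (fun j _ => MvPolynomial.isHomogeneous_C_mul_X _ _))
  simpa [linearSubst] using this

theorem eval_linearSubst (N : Matrix (Fin 4) (Fin 4) K) (Q : MvPolynomial (Fin 4) K)
    (w : Fin 4 → K) :
    MvPolynomial.eval w (linearSubst N Q) = MvPolynomial.eval (N.mulVec w) Q := by
  rw [linearSubst, MvPolynomial.aeval_def, ← MvPolynomial.eval₂_id (p := Q), MvPolynomial.eval]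
  rw [MvPolynomial.hom_eval₂, MvPolynomial.eval₂_id]
  simp only [MvPolynomial.eval₂Hom]
  congr 1
  · ext; simp
  · funext i
    simp [Matrix.mulVec, dotProduct]

end QuadraticForms

/-! ### The plane of the conic and its intersection with secant lines -/

section Determinants

variable {R : Type*} [CommRing R]

/-- The square matrix obtained from the matrix of a conic by appending a column. -/
def augment (A : Matrix (Fin 4) (Fin 3) R) (y : Fin 4 → R) : Matrix (Fin 4) (Fin 4) R :=
  Matrix.of fun i => ![A i 0, A i 1, A i 2, y i]

/-- The linear form that vanishes on the image of `A`. -/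
def planeForm (A : Matrix (Fin 4) (Fin 3) R) (y : Fin 4 → R) : R := (augment A y).det

/-- The equation `u₀ u₂ - u₁²` of the standard conic, as a function of four variables. -/
def conicForm (u : Fin 4 → R) : R := u 0 * u 2 - u 1 ^ 2

/-- The value of the equation of the conic at the point where the line joining `x` and `y` meets
the plane of the conic. -/
def secantForm (A : Matrix (Fin 4) (Fin 3) R) (x y : Fin 4 → R) : R :=
  conicForm ((augment A y).cramer x)

theorem augment_mulVec (A : Matrix (Fin 4) (Fin 3) R) (y u : Fin 4 → R) :
    (augment A y).mulVec u = A.mulVec ![u 0, u 1, u 2] + u 3 • y := by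
  funext i
  simp [augment, Matrix.mulVec, dotProduct, Fin.sum_univ_four, Fin.sum_univ_three, mul_comm]

theorem augment_updateCol {S : Type*} (A : Matrix (Fin 4) (Fin 3) S) (x y : Fin 4 → S) :
    (augment A y).updateCol 3 x = augment A x := by
  ext i j
  fin_cases j <;> simp [augment]

theorem cramer_augment_three (A : Matrix (Fin 4) (Fin 3) R) (x y : Fin 4 → R) :
    (augment A y).cramer x 3 = planeForm A x := by
  rw [Matrix.cramer_apply, augment_updateCol, planeForm]

theorem planeForm_add (A : Matrix (Fin 4) (Fin 3) R) (x y : Fin 4 → R) :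
    planeForm A (x + y) = planeForm A x + planeForm A y := by
  simp [← cramer_augment_three A _ 0]

theorem planeForm_smul (A : Matrix (Fin 4) (Fin 3) R) (a : R) (y : Fin 4 → R) :
    planeForm A (a • y) = a * planeForm A y := by
  simp [← cramer_augment_three A _ 0]

/-- Cramer's rule for writing `x` in terms of the columns of `A` and `y`, with denominators cleared.
The right side lies on the line `xy` and in the plane, so it represents their intersection whenever
it is nonzero. -/
theorem mulVec_cramer_augment (A : Matrix (Fin 4) (Fin 3) R) (x y : Fin 4 → R) :
    A.mulVec ![(augment A y).cramer x 0, (augment A y).cramer x 1, (augment A y).cramer x 2] =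
      planeForm A y • x - planeForm A x • y := by
  have := Matrix.mulVec_cramer (augment A y) x
  rw [augment_mulVec, cramer_augment_three] at this
  rw [eq_sub_iff_add_eq, this, planeForm]

end Determinants

/-! ### General position as the nonvanishing of polynomials -/

section GeneralPosition

variable {K : Type*} [Field K]

theorem planeForm_ne_zero_iff (A : Matrix (Fin 4) (Fin 3) K) (y : Fin 4 → K) :
    planeForm A y ≠ 0 ↔ Function.Injective A.mulVec ∧ ∀ u, A.mulVec u ≠ y := by
  rw [planeForm, Ne, ← Matrix.exists_mulVec_eq_zero_iff]
  constructor
  · intro h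
    push Not at h
    constructor
    · intro u u' huu'
      by_contra hne
      refine h ![u 0 - u' 0, u 1 - u' 1, u 2 - u' 2, 0] ?_ ?_
      · intro h0
        apply hne
        funext i
        rw [← sub_eq_zero]
        fin_cases i
        exacts [congrFun h0 0, congrFun h0 1, congrFun h0 2]
      · rw [augment_mulVec]
        have : (![u 0 - u' 0, u 1 - u' 1, u 2 - u' 2] : Fin 3 → K) = u - u' := by
          funext i; fin_cases i <;> rfl
        simp [this, Matrix.mulVec_sub, huu']
    · intro u hu
      refine h ![u 0, u 1, u 2, -1] (fun h0 => ?_) ?_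
      · simpa using congrFun h0 3
      · rw [augment_mulVec]
        have : (![u 0, u 1, u 2] : Fin 3 → K) = u := by
          funext i; fin_cases i <;> rfl
        simp [this, hu]
  · rintro ⟨hA, hy⟩ ⟨z, hz, hz0⟩
    rw [augment_mulVec] at hz0
    by_cases h3 : z 3 = 0
    · rw [h3, zero_smul, add_zero] at hz0
      have := hA (hz0.trans (A.mulVec_zero).symm)
      apply hz
      funext i
      fin_cases i
      exacts [congrFun this 0, congrFun this 1, congrFun this 2, h3]
    · refine hy (-(z 3)⁻¹ • ![z 0, z 1, z 2]) ?_
      rw [Matrix.mulVec_smul, eq_neg_of_add_eq_zero_left hz0]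
      simp [smul_smul, h3]

theorem planeForm_mulVec (A : Matrix (Fin 4) (Fin 3) K) (u : Fin 3 → K) :
    planeForm A (A.mulVec u) = 0 := by
  by_contra h
  exact ((planeForm_ne_zero_iff A _).1 h).2 u rfl

theorem exists_conic_parameter {u : Fin 3 → K} (h : u 0 * u 2 - u 1 ^ 2 = 0) (hu : u ≠ 0) :
    ∃ s t a : K, (s ≠ 0 ∨ t ≠ 0) ∧ a ≠ 0 ∧ ![s ^ 2, s * t, t ^ 2] = a • u := by
  by_cases h0 : u 0 = 0
  · have h1 : u 1 = 0 := by
      rw [h0] at h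
      simpa using h
    have h2 : u 2 ≠ 0 := by
      intro h2
      apply hu
      funext i
      fin_cases i
      exacts [h0, h1, h2]
    refine ⟨0, u 2, u 2, Or.inr h2, h2, ?_⟩
    funext i
    fin_cases i <;> simp [h0, h1, pow_two]
  · refine ⟨u 0, u 1, u 0, Or.inl h0, h0, ?_⟩
    funext i
    fin_cases i
    · simp [pow_two]
    · simp
    · simp only [Fin.reduceFinMk, Matrix.cons_val, Pi.smul_apply, smul_eq_mul]
      linear_combination -h

theorem mem_conic_of_represents {A : Matrix (Fin 4) (Fin 3) K} {u : Fin 3 → K}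
    (h : u 0 * u 2 - u 1 ^ 2 = 0) {P : P3 K} (hP : Represents (A.mulVec u) P) : P ∈ conic A := by
  have hu : u ≠ 0 := by
    rintro rfl
    exact hP.ne_zero (by simp)
  obtain ⟨s, t, a, hst, ha, e⟩ := exists_conic_parameter h hu
  refine ⟨s, t, hst, ?_⟩
  rw [e, Matrix.mulVec_smul]
  exact hP.smul ha

theorem smul_sub_smul_ne_zero {v : Fin 5 → Fin 4 → K}
    (hv : ∀ k : Fin 5, LinearIndependent K (fun j : Fin 4 => v (k.succAbove j)))
    {i j : Fin 5} (hij : i ≠ j) {a b : K} (h : a • v i - b • v j = 0) : a = 0 ∧ b = 0 := by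
  obtain ⟨k, hki, hkj⟩ : ∃ k : Fin 5, i ≠ k ∧ j ≠ k := by
    clear h
    revert i j
    decide
  obtain ⟨i, rfl⟩ := Fin.exists_succAbove_eq hki
  obtain ⟨j, rfl⟩ := Fin.exists_succAbove_eq hkj
  have hinj : Function.Injective ![i, j] := by
    intro x y hxy
    fin_cases x <;> fin_cases y <;> simp_all
  have := (hv k).comp ![i, j] hinj
  have h2 := (Fintype.linearIndependent_iff.1 this) ![a, -b] (by
    simpa [Fin.sum_univ_two, sub_eq_add_neg] using h)
  exact ⟨by simpa using h2 0, by simpa using h2 1⟩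

/-- This form exhibits general position as an open condition. Injectivity of `A` is absorbed by the
second clause. -/
theorem inGeneralPosition_iff (A : Matrix (Fin 4) (Fin 3) K) (v : Fin 5 → Fin 4 → K) :
    InGeneralPosition A v ↔
      (∀ k : Fin 5, (Matrix.of fun j : Fin 4 => v (k.succAbove j)).det ≠ 0) ∧
      (∀ i, planeForm A (v i) ≠ 0) ∧
      ∀ i j, i ≠ j → secantForm A (v i) (v j) ≠ 0 := by
  have hli : ∀ k : Fin 5, LinearIndependent K (fun j : Fin 4 => v (k.succAbove j)) ↔
      (Matrix.of fun j : Fin 4 => v (k.succAbove j)).det ≠ 0 := fun k => by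
    rw [← isUnit_iff_ne_zero, ← Matrix.isUnit_iff_isUnit_det,
      ← Matrix.linearIndependent_rows_iff_isUnit]
    rfl
  constructor
  · rintro ⟨hA, hv, hp, hl⟩
    have hplane : ∀ i, planeForm A (v i) ≠ 0 := fun i =>
      (planeForm_ne_zero_iff A _).2 ⟨hA, hp i⟩
    refine ⟨fun k => (hli k).1 (hv k), hplane, fun i j hij hs => ?_⟩
    have e := mulVec_cramer_augment A (v i) (v j)
    have hw : planeForm A (v j) • v i - planeForm A (v i) • v j ≠ 0 := fun h0 =>
      hplane j (smul_sub_smul_ne_zero hv hij h0).1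
    obtain ⟨P, hrep⟩ : ∃ P, Represents (planeForm A (v j) • v i - planeForm A (v i) • v j) P :=
      ⟨_, represents_mk hw⟩
    refine hl i j hij P (mem_conic_of_represents (A := A) hs (by rw [e]; exact hrep)) ?_
    intro x hx
    obtain ⟨a, rfl⟩ := hrep.mem_submodule_iff.1 hx
    exact Submodule.smul_mem _ _ (Submodule.sub_mem _
      (Submodule.smul_mem _ _ (Submodule.subset_span (by simp)))
      (Submodule.smul_mem _ _ (Submodule.subset_span (by simp))))
  · rintro ⟨hv, hplane, hs⟩
    have hA := ((planeForm_ne_zero_iff A _).1 (hplane 0)).1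
    refine ⟨hA, fun k => (hli k).2 (hv k),
      fun i => ((planeForm_ne_zero_iff A _).1 (hplane i)).2, fun i j hij P hP hle => ?_⟩
    obtain ⟨s, t, hst, hrep⟩ := hP
    have hmem := hle (hrep.mem_submodule_iff.2 ⟨1, (one_smul _ _).symm⟩)
    rw [Submodule.mem_span_pair] at hmem
    obtain ⟨a, b, hab⟩ := hmem
    -- The conic point `a • v i + b • v j` lies in the plane, so (a, b) is proportional to the
    -- coefficients of the Cramer point. The equation of the conic then gives `a ^ 2 * secantForm =
    -- 0`.
    have h0 : a * planeForm A (v i) + b * planeForm A (v j) = 0 := by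
      rw [← planeForm_smul, ← planeForm_smul, ← planeForm_add, hab, planeForm_mulVec]
    have e := mulVec_cramer_augment A (v i) (v j)
    have key : A.mulVec (planeForm A (v j) • ![s ^ 2, s * t, t ^ 2]) =
        A.mulVec (a • ![(augment A (v j)).cramer (v i) 0, (augment A (v j)).cramer (v i) 1,
          (augment A (v j)).cramer (v i) 2]) := by
      rw [Matrix.mulVec_smul, Matrix.mulVec_smul, e, ← hab]
      funext k
      simp only [Pi.smul_apply, Pi.add_apply, Pi.sub_apply, smul_eq_mul]
      linear_combination v j k * h0
    have key2 := hA key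
    have k0 := congrFun key2 0
    have k1 := congrFun key2 1
    have k2 := congrFun key2 2
    simp only [Pi.smul_apply, smul_eq_mul, Matrix.cons_val_zero, Matrix.cons_val_one,
      Matrix.cons_val] at k0 k1 k2
    have hz : a ^ 2 * secantForm A (v i) (v j) = 0 := by
      rw [secantForm, conicForm]
      calc _ = (a * (augment A (v j)).cramer (v i) 0) * (a * (augment A (v j)).cramer (v i) 2)
            - (a * (augment A (v j)).cramer (v i) 1) ^ 2 := by ring
        _ = 0 := by rw [← k0, ← k1, ← k2]; ring
    have ha : a = 0 := by
      simpa [hs i j hij] using hz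
    rw [ha] at k0 k2
    have h3 := hplane j
    simp only [zero_mul, mul_eq_zero, h3, false_or, ne_eq, OfNat.ofNat_ne_zero,
      not_false_eq_true, pow_eq_zero_iff] at k0 k2
    exact hst.elim (fun h => h k0) (fun h => h k2)

end GeneralPosition

/-! ### Quadrics through a configuration: restriction to the plane, uniqueness -/

section QuadricsThroughConfigurations

variable {K : Type*} [Field K]

/-- The matrix whose columns are the first four points. -/
def pointMatrix {R : Type*} (v : Fin 5 → Fin 4 → R) : Matrix (Fin 4) (Fin 4) R :=
  Matrix.of fun i j => v j.castSucc i

theorem pointMatrix_mulVec {R : Type*} [CommRing R] (v : Fin 5 → Fin 4 → R) (x : Fin 4 → R) :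
    (pointMatrix v).mulVec x = x 0 • v 0 + x 1 • v 1 + x 2 • v 2 + x 3 • v 3 := by
  funext i
  simp [pointMatrix, Matrix.mulVec, dotProduct, Fin.sum_univ_four]
  ring

theorem det_pointMatrix_ne_zero {A : Matrix (Fin 4) (Fin 3) K} {v : Fin 5 → Fin 4 → K}
    (h : InGeneralPosition A v) : (pointMatrix v).det ≠ 0 := by
  have := ((inGeneralPosition_iff A v).1 h).1 (Fin.last 4)
  rw [← Matrix.det_transpose] at this
  convert this using 2
  ext i j
  exact congrArg (fun k => v k i) (Fin.succAbove_last_apply j).symm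

theorem exists_pointMatrix_mulVec {v : Fin 5 → Fin 4 → K} (h : (pointMatrix v).det ≠ 0)
    (w : Fin 4 → K) : ∃ x, (pointMatrix v).mulVec x = w :=
  ⟨(pointMatrix v)⁻¹.mulVec w, by
    rw [Matrix.mulVec_mulVec, Matrix.mul_nonsing_inv _ h.isUnit, Matrix.one_mulVec]⟩

theorem quadraticForm_three {V : Type*} [AddCommGroup V] [Module K V] (q : QuadraticForm K V)
    (x y z : K) (a b c : V) :
    q (x • a + y • b + z • c) = x ^ 2 * q a + y ^ 2 * q b + z ^ 2 * q c +
      x * y * QuadraticMap.polar q a b + x * z * QuadraticMap.polar q a c +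
      y * z * QuadraticMap.polar q b c := by
  simp only [QuadraticMap.map_add q, QuadraticMap.map_smul, QuadraticMap.polar_add_left,
    QuadraticMap.polar_smul_left, QuadraticMap.polar_smul_right, smul_eq_mul]
  ring

theorem quadraticForm_four {V : Type*} [AddCommGroup V] [Module K V] (q : QuadraticForm K V)
    (x y z t : K) {a b c d : V} (ha : q a = 0) (hb : q b = 0) (hc : q c = 0) (hd : q d = 0) :
    q (x • a + y • b + z • c + t • d) =
      x * y * QuadraticMap.polar q a b + x * z * QuadraticMap.polar q a c +
      x * t * QuadraticMap.polar q a d + y * z * QuadraticMap.polar q b c +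
      y * t * QuadraticMap.polar q b d + z * t * QuadraticMap.polar q c d := by
  simp only [QuadraticMap.map_add q, QuadraticMap.map_smul, QuadraticMap.polar_add_left,
    QuadraticMap.polar_smul_left, QuadraticMap.polar_smul_right, smul_eq_mul, ha, hb, hc, hd]
  ring

theorem mulVec_eq_three (A : Matrix (Fin 4) (Fin 3) K) (u : Fin 3 → K) :
    A.mulVec u = u 0 • A.col 0 + u 1 • A.col 1 + u 2 • A.col 2 := by
  funext i
  simp [Matrix.mulVec, dotProduct, Fin.sum_univ_three, mul_comm]

/-- Pulled back to the conic, `q` is a binary quartic. Five zeros kill its coefficients, and the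
only ternary quadratic forms whose pullback is zero are the multiples of u₀u₂ - u₁². -/
theorem quadraticForm_mulVec_of_five {A : Matrix (Fin 4) (Fin 3) K}
    {q : QuadraticForm K (Fin 4 → K)} (s t : Fin 5 → K)
    (hst : ∀ i j, i ≠ j → s i * t j ≠ s j * t i)
    (h : ∀ i, q (A.mulVec ![s i ^ 2, s i * t i, t i ^ 2]) = 0) :
    ∃ κ, ∀ u : Fin 3 → K, q (A.mulVec u) = κ * (u 0 * u 2 - u 1 ^ 2) := by
  obtain ⟨h0, h1, h2, h3, h4⟩ := quartic_eq_zero (q (A.col 0))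
    (QuadraticMap.polar q (A.col 0) (A.col 1))
    (q (A.col 1) + QuadraticMap.polar q (A.col 0) (A.col 2))
    (QuadraticMap.polar q (A.col 1) (A.col 2)) (q (A.col 2)) s t hst (fun i => by
      rw [← h i, mulVec_eq_three, quadraticForm_three]
      simp only [Matrix.cons_val_zero, Matrix.cons_val_one, Matrix.cons_val]
      ring)
  refine ⟨QuadraticMap.polar q (A.col 0) (A.col 2), fun u => ?_⟩
  rw [mulVec_eq_three, quadraticForm_three, h0, h1, h3, h4]
  linear_combination u 1 ^ 2 * h2

theorem quadraticForm_mulVec_of_conic [Infinite K] {A : Matrix (Fin 4) (Fin 3) K}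
    {q : QuadraticForm K (Fin 4 → K)}
    (h : ∀ s t : K, (s ≠ 0 ∨ t ≠ 0) → q (A.mulVec ![s ^ 2, s * t, t ^ 2]) = 0) :
    ∃ κ, ∀ u : Fin 3 → K, q (A.mulVec u) = κ * (u 0 * u 2 - u 1 ^ 2) := by
  have e := Infinite.natEmbedding K
  refine quadraticForm_mulVec_of_five (fun _ => 1) (fun i => e i) (fun i j hij he => hij ?_)
    (fun i => h _ _ (Or.inl one_ne_zero))
  rw [one_mul, one_mul] at he
  exact Fin.ext (e.injective he).symm

/-- Evaluate `q` in two ways at the point where the line `xy` meets the plane: by the equation of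
the conic, and by expanding along the line, where only the mixed term survives. This expresses polar
values by polynomials in (A, v). -/
theorem secantForm_mul {A : Matrix (Fin 4) (Fin 3) K} {q : QuadraticForm K (Fin 4 → K)} {κ : K}
    (hκ : ∀ u : Fin 3 → K, q (A.mulVec u) = κ * (u 0 * u 2 - u 1 ^ 2)) {x y : Fin 4 → K}
    (hx : q x = 0) (hy : q y = 0) :
    κ * secantForm A x y = -(planeForm A x * planeForm A y * QuadraticMap.polar q x y) := by
  have e := hκ ![(augment A y).cramer x 0, (augment A y).cramer x 1, (augment A y).cramer x 2]
  rw [mulVec_cramer_augment, sub_eq_add_neg, ← neg_smul, QuadraticMap.map_add q,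
    QuadraticMap.map_smul, QuadraticMap.map_smul, hx, hy, QuadraticMap.polar_smul_left,
    QuadraticMap.polar_smul_right] at e
  simp only [smul_eq_mul, Matrix.cons_val_zero, Matrix.cons_val_one, Matrix.cons_val] at e
  rw [secantForm, conicForm, ← e]
  ring

/-- A quadratic form that vanishes on the plane of the conic and at the five points is zero. -/
theorem quadraticForm_eq_zero {A : Matrix (Fin 4) (Fin 3) K} {v : Fin 5 → Fin 4 → K}
    (hgp : InGeneralPosition A v) {q : QuadraticForm K (Fin 4 → K)}
    (hA : ∀ u, q (A.mulVec u) = 0) (hv : ∀ i, q (v i) = 0) (w : Fin 4 → K) : q w = 0 := by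
  have h := (inGeneralPosition_iff A v).1 hgp
  have hp : ∀ i j, QuadraticMap.polar q (v i) (v j) = 0 := fun i j => by
    have e := secantForm_mul (A := A) (κ := 0) (by simpa using hA) (hv i) (hv j)
    simpa [h.2.1 i, h.2.1 j] using e
  obtain ⟨x, rfl⟩ := exists_pointMatrix_mulVec (det_pointMatrix_ne_zero hgp) w
  rw [pointMatrix_mulVec, quadraticForm_four q _ _ _ _ (hv 0) (hv 1) (hv 2) (hv 3)]
  simp [hp]

/-- The quadratic form of a quadric through a configuration, restricted to the plane of the conic,
is a nonzero multiple of the equation of the conic. -/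
theorem IsQuadricThrough.exists_quadraticForm [Infinite K] {Q : MvPolynomial (Fin 4) K}
    {A : Matrix (Fin 4) (Fin 3) K} {v : Fin 5 → Fin 4 → K} (hgp : InGeneralPosition A v)
    (hQ : IsQuadricThrough Q A v) :
    ∃ (q : QuadraticForm K (Fin 4 → K)) (κ : K), (∀ w, q w = MvPolynomial.eval w Q) ∧ κ ≠ 0 ∧
      (∀ u : Fin 3 → K, q (A.mulVec u) = κ * (u 0 * u 2 - u 1 ^ 2)) ∧ ∀ i, q (v i) = 0 := by
  obtain ⟨hQ0, hQ2, hC, hv⟩ := hQ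
  obtain ⟨q, hq⟩ := exists_quadraticForm_eval hQ2
  have hconic : ∀ s t : K, (s ≠ 0 ∨ t ≠ 0) → q (A.mulVec ![s ^ 2, s * t, t ^ 2]) = 0 := by
    intro s t hst
    have hne : A.mulVec ![s ^ 2, s * t, t ^ 2] ≠ 0 := by
      intro h0
      have := hgp.1 (h0.trans A.mulVec_zero.symm)
      have h1 := congrFun this 0
      have h2 := congrFun this 2
      simp at h1 h2
      exact hst.elim (fun h => h h1) (fun h => h h2)
    have hP := hC ⟨s, t, hst, represents_mk hne⟩
    rw [hq]
    exact (mem_quadricLocus_iff hQ2 (represents_mk hne)).1 hP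
  have hqv : ∀ i, q (v i) = 0 := fun i => by
    obtain ⟨P, hP, hrep⟩ := hv i
    rw [hq]
    exact (mem_quadricLocus_iff hQ2 hrep).1 hP
  obtain ⟨κ, hκ⟩ := quadraticForm_mulVec_of_conic hconic
  refine ⟨q, κ, hq, ?_, hκ, hqv⟩
  rintro rfl
  apply hQ0
  apply MvPolynomial.funext
  intro w
  rw [← hq, quadraticForm_eq_zero hgp (by simpa using hκ) hqv, map_zero]

/-- The combination `κ' • q - κ • q'` vanishes on the plane and at the five points, hence
identically. -/
theorem IsQuadricThrough.quadricLocus_eq [Infinite K] {Q Q' : MvPolynomial (Fin 4) K}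
    {A : Matrix (Fin 4) (Fin 3) K} {v : Fin 5 → Fin 4 → K} (hgp : InGeneralPosition A v)
    (hQ : IsQuadricThrough Q A v) (hQ' : IsQuadricThrough Q' A v) :
    quadricLocus Q = quadricLocus Q' := by
  obtain ⟨q, κ, hq, hκ0, hκ, hv⟩ := hQ.exists_quadraticForm hgp
  obtain ⟨q', κ', hq', hκ0', hκ', hv'⟩ := hQ'.exists_quadraticForm hgp
  have key : ∀ w, κ' * q w = κ * q' w := fun w => by
    have := quadraticForm_eq_zero hgp (q := κ' • q - κ • q') (fun u => by
      simp only [sub_apply, smul_apply, smul_eq_mul, hκ, hκ']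
      ring) (fun i => by simp [hv, hv']) w
    simpa [sub_eq_zero] using this
  ext P
  obtain ⟨w, hw⟩ := exists_represents P
  rw [mem_quadricLocus_iff hQ.2.1 hw, mem_quadricLocus_iff hQ'.2.1 hw, ← hq, ← hq']
  have := key w
  constructor
  · intro h0
    simpa [h0, hκ0, eq_comm] using this
  · intro h0
    simpa [h0, hκ0', eq_comm] using this

theorem polar_ne_zero_of_inGeneralPosition {A : Matrix (Fin 4) (Fin 3) K}
    {v : Fin 5 → Fin 4 → K} (hgp : InGeneralPosition A v) {q : QuadraticForm K (Fin 4 → K)} {κ : K}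
    (hκ0 : κ ≠ 0) (hκ : ∀ u : Fin 3 → K, q (A.mulVec u) = κ * (u 0 * u 2 - u 1 ^ 2))
    (hv : ∀ i, q (v i) = 0) {i j : Fin 5} (hij : i ≠ j) :
    QuadraticMap.polar q (v i) (v j) ≠ 0 := by
  intro h0
  have h := (inGeneralPosition_iff A v).1 hgp
  have := secantForm_mul hκ (hv i) (hv j)
  rw [h0, mul_zero, neg_zero] at this
  exact mul_ne_zero hκ0 (h.2.2 i j hij) this

end QuadricsThroughConfigurations

/-! ### Smooth quadrics and Segre coordinates -/

section Segre

variable {K : Type*} [Field K]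

theorem exists_tensor {X : Fin 4 → K} (hX : X ≠ 0) (h : X 0 * X 3 - X 1 * X 2 = 0) :
    ∃ x y : Fin 2 → K, x ≠ 0 ∧ y ≠ 0 ∧
      X = ![x 0 * y 0, x 0 * y 1, x 1 * y 0, x 1 * y 1] := by
  by_cases h0 : X 0 = 0
  · by_cases h1 : X 1 = 0
    · refine ⟨![0, 1], ![X 2, X 3], fun e => one_ne_zero (congrFun e 1), fun e => hX ?_, ?_⟩
      · funext i
        fin_cases i
        exacts [h0, h1, congrFun e 0, congrFun e 1]
      · funext i
        fin_cases i <;> simp [h0, h1]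
    · have h2 : X 2 = 0 := by simpa [h0, h1] using h
      refine ⟨![1, X 3 / X 1], ![X 0, X 1], fun e => one_ne_zero (congrFun e 0),
        fun e => h1 (congrFun e 1), ?_⟩
      funext i
      fin_cases i <;> simp [h0, h1, h2]
  · refine ⟨![1, X 2 / X 0], ![X 0, X 1], fun e => one_ne_zero (congrFun e 0),
      fun e => h0 (congrFun e 0), ?_⟩
    funext i
    fin_cases i
    · simp
    · simp
    · simp [h0]
    · simp only [Fin.reduceFinMk, Matrix.cons_val, Matrix.cons_val_one, Matrix.cons_val_zero]
      field_simp
      linear_combination h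

theorem mulVec_ne_zero {g : Matrix (Fin 4) (Fin 4) K} (hg : g.det ≠ 0) {X : Fin 4 → K}
    (hX : X ≠ 0) : g.mulVec X ≠ 0 := fun h => hX (Matrix.eq_zero_of_mulVec_eq_zero hg h)

theorem mulVec_injective_of_det {g : Matrix (Fin 4) (Fin 4) K} (hg : g.det ≠ 0) :
    Function.Injective g.mulVec :=
  Matrix.mulVec_injective_of_isUnit ((Matrix.isUnit_iff_isUnit_det _).2 hg.isUnit)

theorem represents_mulVec_mem_segreQuadric_iff {g : Matrix (Fin 4) (Fin 4) K} (hg : g.det ≠ 0)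
    {X : Fin 4 → K} {P : P3 K} (h : Represents (g.mulVec X) P) :
    P ∈ segreQuadric g ↔ X 0 * X 3 - X 1 * X 2 = 0 := by
  constructor
  · rintro ⟨x, y, hx, hy, hr⟩
    obtain ⟨a, ha, e⟩ := hr.iff_smul.1 h
    rw [segreMap, ← Matrix.mulVec_smul] at e
    rw [mulVec_injective_of_det hg e]
    simp
    ring
  · intro h0
    have hX : X ≠ 0 := by
      rintro rfl
      exact h.ne_zero (by simp)
    obtain ⟨x, y, hx, hy, rfl⟩ := exists_tensor hX h0
    exact ⟨x, y, hx, hy, h⟩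

theorem exists_mulVec_eq {g : Matrix (Fin 4) (Fin 4) K} (hg : g.det ≠ 0) (w : Fin 4 → K) :
    ∃ X, g.mulVec X = w :=
  ⟨g⁻¹.mulVec w, by
    rw [Matrix.mulVec_mulVec, Matrix.mul_nonsing_inv _ hg.isUnit, Matrix.one_mulVec]⟩

/-- Factorization of the equation of a smooth quadric that contains a smooth conic. -/
theorem exists_segre_coordinates [IsAlgClosed K] {A : Matrix (Fin 4) (Fin 3) K} {y : Fin 4 → K}
    (hy : planeForm A y ≠ 0) {q : QuadraticForm K (Fin 4 → K)} {κ : K} (hκ0 : κ ≠ 0)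
    (hκ : ∀ u : Fin 3 → K, q (A.mulVec u) = κ * (u 0 * u 2 - u 1 ^ 2))
    (hq : ∀ n, n ≠ 0 → ∃ z, QuadraticMap.polar q n z ≠ 0) :
    ∃ g : Matrix (Fin 4) (Fin 4) K, g.det ≠ 0 ∧
      ∀ X, q (g.mulVec X) = κ * (X 0 * X 3 - X 1 * X 2) := by
  set B := augment A y with hB
  obtain ⟨α, hα⟩ : ∃ α, QuadraticMap.polar q (A.col 0) y = κ * α :=
    ⟨_, (mul_div_cancel₀ _ hκ0).symm⟩
  obtain ⟨β, hβ⟩ : ∃ β, QuadraticMap.polar q (A.col 1) y = κ * β :=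
    ⟨_, (mul_div_cancel₀ _ hκ0).symm⟩
  obtain ⟨γ, hγ⟩ : ∃ γ, QuadraticMap.polar q (A.col 2) y = κ * γ :=
    ⟨_, (mul_div_cancel₀ _ hκ0).symm⟩
  obtain ⟨δ, hδ⟩ : ∃ δ, q y = κ * δ := ⟨_, (mul_div_cancel₀ _ hκ0).symm⟩
  have hform : ∀ u : Fin 4 → K, q (B.mulVec u) = κ * (u 0 * u 2 - u 1 ^ 2 +
      u 3 * (α * u 0 + β * u 1 + γ * u 2) + δ * u 3 ^ 2) := fun u => by
    rw [hB, augment_mulVec, QuadraticMap.map_add q, hκ, mulVec_eq_three, QuadraticMap.map_smul, hδ]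
    simp only [QuadraticMap.polar_add_left, QuadraticMap.polar_smul_left,
      QuadraticMap.polar_smul_right, smul_eq_mul, hα, hβ, hγ, Matrix.cons_val_zero,
      Matrix.cons_val_one, Matrix.cons_val]
    ring
  -- The roots `r`, `r'` have sum β and product αγ - δ, which is what makes the form split as a
  -- difference of two products of linear forms. Completing squares is avoided, so characteristic 2
  -- is included.
  obtain ⟨r, hr⟩ : ∃ r, r ^ 2 - β * r + (α * γ - δ) = 0 := by
    have hdeg : (Polynomial.X ^ 2 - Polynomial.C β * Polynomial.X + Polynomial.C (α * γ - δ) :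
        Polynomial K).degree = 2 := by compute_degree!
    obtain ⟨r, hr⟩ := IsAlgClosed.exists_root _ (by rw [hdeg]; decide)
    exact ⟨r, by simpa [Polynomial.IsRoot] using hr⟩
  obtain ⟨r', rfl⟩ : ∃ r', β = r + r' := ⟨β - r, by ring⟩
  obtain rfl : δ = α * γ - r * r' := by linear_combination -hr
  have hfac : ∀ u : Fin 4 → K, q (B.mulVec u) =
      κ * ((u 0 + γ * u 3) * (u 2 + α * u 3) - (u 1 - r * u 3) * (u 1 - r' * u 3)) := fun u => by
    rw [hform]
    ring
  -- With a double root the four linear forms have the common zero (-γ, r', -α, 1), which would be a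
  -- singular point of the quadric.
  have hd : r' - r ≠ 0 := by
    intro h0
    obtain rfl : r' = r := sub_eq_zero.1 h0
    obtain ⟨z, hz⟩ := hq (B.mulVec ![-γ, r', -α, 1])
      (mulVec_ne_zero hy (fun h => one_ne_zero (congrFun h 3)))
    obtain ⟨u, rfl⟩ := exists_mulVec_eq (g := B) hy z
    apply hz
    rw [QuadraticMap.polar, ← Matrix.mulVec_add, hfac, hfac, hfac]
    simp
    ring
  set d := r' - r with hd'
  -- The inverse of the substitution X₀ = u₀ + γu₃, X₁ = u₁ - ru₃, X₂ = u₁ - r'u₃, X₃ = u₂ + αu₃.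
  set N : Matrix (Fin 4) (Fin 4) K := !![1, -γ / d, γ / d, 0; 0, 1 + r / d, -r / d, 0;
    0, -α / d, α / d, 1; 0, 1 / d, -1 / d, 0] with hN
  refine ⟨B * N, ?_, fun X => ?_⟩
  · rw [Matrix.det_mul]
    refine mul_ne_zero hy ?_
    have : N.det = 1 / d := by
      rw [hN]
      simp [Matrix.det_succ_row_zero, Fin.sum_univ_succ, Fin.succAbove]
      field_simp
      ring
    rw [this]
    exact one_div_ne_zero hd
  · rw [← Matrix.mulVec_mulVec, hfac, hN]
    congr 1
    simp [Matrix.mulVec, dotProduct, Fin.sum_univ_four]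
    field_simp
    rw [hd']
    ring

end Segre

/-! ### A determinant that detects smoothness of the quadric -/

section Nondegeneracy

/-- The matrix of the values `secantForm A (v i) (v j)` for the first four points. For points on a
quadric it is the Gram matrix of the polar form, up to scaling. -/
def secantMatrix {R : Type*} [CommRing R] (A : Matrix (Fin 4) (Fin 3) R) (v : Fin 5 → Fin 4 → R) :
    Matrix (Fin 4) (Fin 4) R :=
  Matrix.of fun i j => secantForm A (v i.castSucc) (v j.castSucc)

variable {K : Type*} [Field K]

theorem polar_pointMatrix_mulVec (q : QuadraticForm K (Fin 4 → K)) (v : Fin 5 → Fin 4 → K)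
    (z x : Fin 4 → K) : QuadraticMap.polar q z ((pointMatrix v).mulVec x) =
      ∑ j : Fin 4, x j * QuadraticMap.polar q z (v j.castSucc) := by
  rw [pointMatrix_mulVec, Fin.sum_univ_four]
  simp only [QuadraticMap.polar_add_right, QuadraticMap.polar_smul_right, smul_eq_mul]
  rfl

/-- By `secantForm_mul`, κ times the secant matrix is -DGD, where G is the Gram matrix of the polar
form in the basis of the first four points and D is the invertible diagonal matrix of the values of
`planeForm`. -/
theorem det_secantMatrix_ne_zero_iff {A : Matrix (Fin 4) (Fin 3) K} {v : Fin 5 → Fin 4 → K}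
    (hgp : InGeneralPosition A v) {q : QuadraticForm K (Fin 4 → K)} {κ : K} (hκ0 : κ ≠ 0)
    (hκ : ∀ u : Fin 3 → K, q (A.mulVec u) = κ * (u 0 * u 2 - u 1 ^ 2)) (hv : ∀ i, q (v i) = 0) :
    (secantMatrix A v).det ≠ 0 ↔ ∀ n, n ≠ 0 → ∃ z, QuadraticMap.polar q n z ≠ 0 := by
  have hp := ((inGeneralPosition_iff A v).1 hgp).2.1
  have hV := det_pointMatrix_ne_zero hgp
  have hsec : ∀ (y : Fin 4 → K) (i : Fin 4), κ * (secantMatrix A v).mulVec y i =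
      -(planeForm A (v i.castSucc) * QuadraticMap.polar q (v i.castSucc)
        ((pointMatrix v).mulVec fun j => planeForm A (v j.castSucc) * y j)) := fun y i => by
    rw [polar_pointMatrix_mulVec, Matrix.mulVec, dotProduct, Finset.mul_sum, Finset.mul_sum,
      ← Finset.sum_neg_distrib]
    refine Finset.sum_congr rfl fun j _ => ?_
    have := secantForm_mul hκ (hv i.castSucc) (hv j.castSucc)
    simp only [secantMatrix, Matrix.of_apply]
    linear_combination y j * this
  constructor
  · intro hdet n hn
    by_contra h0
    push Not at h0
    obtain ⟨c, rfl⟩ := exists_pointMatrix_mulVec hV n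
    have hy : (secantMatrix A v).mulVec (fun j => c j / planeForm A (v j.castSucc)) = 0 := by
      funext i
      have := hsec (fun j => c j / planeForm A (v j.castSucc)) i
      simp only [mul_div_cancel₀ _ (hp _)] at this
      rw [QuadraticMap.polar_comm, h0, mul_zero, neg_zero] at this
      simpa [hκ0] using this
    have h1 := Matrix.eq_zero_of_mulVec_eq_zero hdet hy
    apply hn
    have : c = 0 := by
      funext j
      simpa [hp] using congrFun h1 j
    rw [this, Matrix.mulVec_zero]
  · intro hnd hdet
    obtain ⟨y, hy, hy0⟩ := Matrix.exists_mulVec_eq_zero_iff.2 hdet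
    obtain ⟨z, hz⟩ := hnd ((pointMatrix v).mulVec fun j => planeForm A (v j.castSucc) * y j)
      (mulVec_ne_zero hV fun h => hy (by
        funext j
        simpa [hp] using congrFun h j))
    obtain ⟨x, rfl⟩ := exists_pointMatrix_mulVec hV z
    apply hz
    rw [polar_pointMatrix_mulVec]
    refine Finset.sum_eq_zero fun i _ => ?_
    have := hsec y i
    rw [hy0] at this
    rw [QuadraticMap.polar_comm]
    have h2 : QuadraticMap.polar q (v i.castSucc)
        ((pointMatrix v).mulVec fun j => planeForm A (v j.castSucc) * y j) = 0 := by
      simpa [hp] using this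
    rw [h2, mul_zero]

end Nondegeneracy

/-! ### Twisted cubics and planes -/

section CubicCurves

variable {K : Type*} [Field K]

theorem exists_smul_of_mul_eq {s t s' t' : K} (h : s ≠ 0 ∨ t ≠ 0) (h' : s' ≠ 0 ∨ t' ≠ 0)
    (e : s * t' = s' * t) : ∃ a : K, a ≠ 0 ∧ s' = a * s ∧ t' = a * t := by
  by_cases hs : s = 0
  · have ht : t ≠ 0 := h.resolve_left (not_not.2 hs)
    have hs' : s' = 0 := by simpa [hs, ht] using e.symm
    have ht' : t' ≠ 0 := h'.resolve_left (not_not.2 hs')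
    exact ⟨t' / t, div_ne_zero ht' ht, by simp [hs, hs'], by field_simp⟩
  · have hs' : s' ≠ 0 := by
      intro h0
      have ht' : t' ≠ 0 := h'.resolve_left (not_not.2 h0)
      simp [h0, hs, ht'] at e
    refine ⟨s' / s, div_ne_zero hs' hs, by field_simp, ?_⟩
    field_simp
    linear_combination e

theorem cubicVector_ne_zero {s t : K} (h : s ≠ 0 ∨ t ≠ 0) :
    (![s ^ 3, s ^ 2 * t, s * t ^ 2, t ^ 3] : Fin 4 → K) ≠ 0 := by
  intro h0
  have h1 := congrFun h0 0
  have h2 := congrFun h0 3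
  simp at h1 h2
  exact h.elim (fun h => h h1) (fun h => h h2)

theorem mulVec_eq_four (M : Matrix (Fin 4) (Fin 4) K) (u : Fin 4 → K) :
    M.mulVec u = u 0 • M.col 0 + u 1 • M.col 1 + u 2 • M.col 2 + u 3 • M.col 3 := by
  funext i
  simp [Matrix.mulVec, dotProduct, Fin.sum_univ_four, mul_comm]

/-- A twisted cubic meets a plane in at most three points. -/
theorem IsTwistedCubic.encard_inter_conic_le {T : Set (P3 K)} (hT : IsTwistedCubic T)
    {A : Matrix (Fin 4) (Fin 3) K} {y : Fin 4 → K} (hy : planeForm A y ≠ 0) :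
    (T ∩ conic A).encard ≤ 3 := by
  by_contra! hlt
  obtain ⟨M, hM, rfl⟩ := hT
  obtain ⟨S, hS, hS4⟩ := Set.exists_subset_encard_eq (Order.add_one_le_of_lt hlt)
  have h4 : Nat.card S = 4 := by
    have : S.ncard = 4 := by
      rw [Set.ncard, hS4]
      rfl
    exact this
  have : Finite S := Nat.finite_of_card_ne_zero (by rw [h4]; decide)
  let e := (Finite.equivFinOfCardEq h4).symm
  choose s t hst hrep using fun i => (hS (e i).2).1
  have hplane : ∀ i, planeForm A (M.mulVec ![s i ^ 3, s i ^ 2 * t i, s i * t i ^ 2, t i ^ 3]) = 0 :=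
    fun i => by
      obtain ⟨s', t', _, hr⟩ := (hS (e i).2).2
      obtain ⟨a, _, ha⟩ := exists_smul_ne_zero_of_represents hr (hrep i)
      rw [ha, planeForm_smul, planeForm_mulVec, mul_zero]
  -- Pulled back to the cubic, the plane form is a binary cubic with four zeros. It therefore
  -- vanishes on all columns of `M`, hence at `y`.
  have hz := cubic_eq_zero (planeForm A (M.col 0)) (planeForm A (M.col 1))
    (planeForm A (M.col 2)) (planeForm A (M.col 3)) s t (fun i j hij he => hij ?_) (fun i => by
      rw [← hplane i, mulVec_eq_four]
      simp only [planeForm_add, planeForm_smul, Matrix.cons_val_zero, Matrix.cons_val_one,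
        Matrix.cons_val]
      ring)
  · obtain ⟨X, rfl⟩ := exists_mulVec_eq hM y
    apply hy
    rw [mulVec_eq_four]
    simp [planeForm_add, planeForm_smul, hz]
  · obtain ⟨a, ha, h1, h2⟩ := exists_smul_of_mul_eq (hst i) (hst j) he
    apply e.injective
    apply Subtype.ext
    refine ((hrep i).smul (pow_ne_zero 3 ha)).unique ?_
    have := hrep j
    rw [h1, h2] at this
    rw [← Matrix.mulVec_smul]
    convert this using 2
    funext k
    fin_cases k <;> simp <;> ring

end CubicCurves

/-! ### Points of the quadric and the cubic surface in special position -/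

section Cremona

variable {K : Type*} [Field K]

/-- In the face X₀ = 0 the cubic reduces to X₁X₂X₃ = 0. On each edge the quadric then leaves only
the vertices. -/
theorem first_coordinate_ne_zero {a01 a02 a03 a12 a13 a23 b0 b1 b2 b3 X0 X1 X2 X3 : K}
    (h12 : a12 ≠ 0) (h13 : a13 ≠ 0) (h23 : a23 ≠ 0) (hb0 : b0 ≠ 0)
    (hQ : a01 * X0 * X1 + a02 * X0 * X2 + a03 * X0 * X3 + a12 * X1 * X2 + a13 * X1 * X3 +
      a23 * X2 * X3 = 0)
    (hS : b0 * (X1 * X2 * X3) + b1 * (X0 * X2 * X3) + b2 * (X0 * X1 * X3) + b3 * (X0 * X1 * X2) = 0)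
    (h1 : ¬ (X0 = 0 ∧ X2 = 0 ∧ X3 = 0)) (h2 : ¬ (X0 = 0 ∧ X1 = 0 ∧ X3 = 0))
    (h3 : ¬ (X0 = 0 ∧ X1 = 0 ∧ X2 = 0)) : X0 ≠ 0 := by
  rintro rfl
  have hS' : X1 * X2 * X3 = 0 := by
    have : b0 * (X1 * X2 * X3) = 0 := by linear_combination hS
    exact (mul_eq_zero.1 this).resolve_left hb0
  rcases mul_eq_zero.1 hS' with h | h
  · rcases mul_eq_zero.1 h with rfl | rfl
    · have : X2 * X3 = 0 := (mul_eq_zero.1 (by linear_combination hQ)).resolve_left h23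
      rcases mul_eq_zero.1 this with rfl | rfl <;> simp_all
    · have : X1 * X3 = 0 := (mul_eq_zero.1 (by linear_combination hQ)).resolve_left h13
      rcases mul_eq_zero.1 this with rfl | rfl <;> simp_all
  · subst h
    have : X1 * X2 = 0 := (mul_eq_zero.1 (by linear_combination hQ)).resolve_left h12
    rcases mul_eq_zero.1 this with rfl | rfl <;> simp_all

/-- The plane X₀ = X₁ passes through two vertices and (1:1:1:1). There a combination of quadric and
cubic factors as X₀ a₀₁ (X₂ - X₀)(X₃ - X₀), and on each of the two resulting lines the quadric
leaves only (1:1:1:1) among points with X₀ ≠ 0. -/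
theorem first_coordinates_ne {a01 a02 a03 a12 a13 a23 b0 b1 b2 b3 X0 X1 X2 X3 : K}
    (h01 : a01 ≠ 0) (hb2 : b2 ≠ 0) (hb3 : b3 ≠ 0)
    (e0 : b0 = a01 + a02 + a03) (e1 : b1 = a01 + a12 + a13) (e2 : b2 = a02 + a12 + a23)
    (e3 : b3 = a03 + a13 + a23) (hsum : a01 + a02 + a03 + a12 + a13 + a23 = 0)
    (hQ : a01 * X0 * X1 + a02 * X0 * X2 + a03 * X0 * X3 + a12 * X1 * X2 + a13 * X1 * X3 +
      a23 * X2 * X3 = 0)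
    (hS : b0 * (X1 * X2 * X3) + b1 * (X0 * X2 * X3) + b2 * (X0 * X1 * X3) + b3 * (X0 * X1 * X2) = 0)
    (h0 : X0 ≠ 0) (hne : ¬ (X1 = X0 ∧ X2 = X0 ∧ X3 = X0)) : X0 ≠ X1 := by
  rintro rfl
  have key : X0 * a01 * ((X2 - X0) * (X3 - X0)) = 0 := by
    rw [e0, e1, e2, e3] at hS
    linear_combination X0 * hQ + hS + (-X0 ^ 2 * X2 - X0 ^ 2 * X3 - X0 * X2 * X3) * hsum
  have key2 := (mul_eq_zero.1 key).resolve_left (mul_ne_zero h0 h01)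
  rcases mul_eq_zero.1 key2 with h | h
  · obtain rfl : X2 = X0 := sub_eq_zero.1 h
    have : (b3 * X2) * (X3 - X2) = 0 := by
      linear_combination hQ - X2 ^ 2 * hsum + X2 * (X3 - X2) * e3
    exact hne ⟨rfl, rfl, sub_eq_zero.1 ((mul_eq_zero.1 this).resolve_left (mul_ne_zero hb3 h0))⟩
  · obtain rfl : X3 = X0 := sub_eq_zero.1 h
    have : (b2 * X3) * (X2 - X3) = 0 := by
      linear_combination hQ - X3 ^ 2 * hsum + X3 * (X2 - X3) * e2
    exact hne ⟨rfl, sub_eq_zero.1 ((mul_eq_zero.1 this).resolve_left (mul_ne_zero hb2 h0)), rfl⟩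

/-- Collects the nondegeneracy needed for the curve of `cremonaMatrix` to be a twisted cubic. The
hypotheses are symmetric in the indices, so each case is one of the two preceding lemmas with
permuted indices. -/
theorem coordinates_ne {a01 a02 a03 a12 a13 a23 b0 b1 b2 b3 X0 X1 X2 X3 : K}
    (h01 : a01 ≠ 0) (h02 : a02 ≠ 0) (h03 : a03 ≠ 0) (h12 : a12 ≠ 0) (h13 : a13 ≠ 0) (h23 : a23 ≠ 0)
    (hb0 : b0 ≠ 0) (hb1 : b1 ≠ 0) (hb2 : b2 ≠ 0) (hb3 : b3 ≠ 0)
    (e0 : b0 = a01 + a02 + a03) (e1 : b1 = a01 + a12 + a13) (e2 : b2 = a02 + a12 + a23)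
    (e3 : b3 = a03 + a13 + a23) (hsum : a01 + a02 + a03 + a12 + a13 + a23 = 0)
    (hQ : a01 * X0 * X1 + a02 * X0 * X2 + a03 * X0 * X3 + a12 * X1 * X2 + a13 * X1 * X3 +
      a23 * X2 * X3 = 0)
    (hS : b0 * (X1 * X2 * X3) + b1 * (X0 * X2 * X3) + b2 * (X0 * X1 * X3) + b3 * (X0 * X1 * X2) = 0)
    (h0 : ¬ (X1 = 0 ∧ X2 = 0 ∧ X3 = 0)) (h1 : ¬ (X0 = 0 ∧ X2 = 0 ∧ X3 = 0))
    (h2 : ¬ (X0 = 0 ∧ X1 = 0 ∧ X3 = 0)) (h3 : ¬ (X0 = 0 ∧ X1 = 0 ∧ X2 = 0))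
    (hne : ¬ (X1 = X0 ∧ X2 = X0 ∧ X3 = X0)) :
    (X0 ≠ 0 ∧ X1 ≠ 0 ∧ X2 ≠ 0 ∧ X3 ≠ 0) ∧
      X0 ≠ X1 ∧ X0 ≠ X2 ∧ X0 ≠ X3 ∧ X1 ≠ X2 ∧ X1 ≠ X3 ∧ X2 ≠ X3 := by
  have n0 : X0 ≠ 0 := first_coordinate_ne_zero (a01 := a01) (a02 := a02) (a03 := a03) (a12 := a12) (a13 := a13) (a23 := a23)
    (b0 := b0) (X0 := X0) (b1 := b1) (X1 := X1) (b2 := b2) (X2 := X2) (b3 := b3) (X3 := X3)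
    h12 h13 h23 hb0 (by linear_combination hQ) (by linear_combination hS)
    (by grind) (by grind) (by grind)
  have n1 : X1 ≠ 0 := first_coordinate_ne_zero (a01 := a01) (a02 := a12) (a03 := a13) (a12 := a02) (a13 := a03) (a23 := a23)
    (b0 := b1) (X0 := X1) (b1 := b0) (X1 := X0) (b2 := b2) (X2 := X2) (b3 := b3) (X3 := X3)
    h02 h03 h23 hb1 (by linear_combination hQ) (by linear_combination hS)
    (by grind) (by grind) (by grind)
  have n2 : X2 ≠ 0 := first_coordinate_ne_zero (a01 := a02) (a02 := a12) (a03 := a23) (a12 := a01) (a13 := a03) (a23 := a13)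
    (b0 := b2) (X0 := X2) (b1 := b0) (X1 := X0) (b2 := b1) (X2 := X1) (b3 := b3) (X3 := X3)
    h01 h03 h13 hb2 (by linear_combination hQ) (by linear_combination hS)
    (by grind) (by grind) (by grind)
  have n3 : X3 ≠ 0 := first_coordinate_ne_zero (a01 := a03) (a02 := a13) (a03 := a23) (a12 := a01) (a13 := a02) (a23 := a12)
    (b0 := b3) (X0 := X3) (b1 := b0) (X1 := X0) (b2 := b1) (X2 := X1) (b3 := b2) (X3 := X2)
    h01 h02 h12 hb3 (by linear_combination hQ) (by linear_combination hS)
    (by grind) (by grind) (by grind)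
  refine ⟨⟨n0, n1, n2, n3⟩, ?_, ?_, ?_, ?_, ?_, ?_⟩
  · exact first_coordinates_ne (a01 := a01) (a02 := a02) (a03 := a03) (a12 := a12) (a13 := a13) (a23 := a23)
      (b0 := b0) (X0 := X0) (b1 := b1) (X1 := X1) (b2 := b2) (X2 := X2) (b3 := b3) (X3 := X3)
      h01 hb2 hb3 (by linear_combination e0) (by linear_combination e1) (by linear_combination e2) (by linear_combination e3)
      (by linear_combination hsum) (by linear_combination hQ) (by linear_combination hS) n0 (by grind)
  · exact first_coordinates_ne (a01 := a02) (a02 := a01) (a03 := a03) (a12 := a12) (a13 := a23) (a23 := a13)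
      (b0 := b0) (X0 := X0) (b1 := b2) (X1 := X2) (b2 := b1) (X2 := X1) (b3 := b3) (X3 := X3)
      h02 hb1 hb3 (by linear_combination e0) (by linear_combination e2) (by linear_combination e1) (by linear_combination e3)
      (by linear_combination hsum) (by linear_combination hQ) (by linear_combination hS) n0 (by grind)
  · exact first_coordinates_ne (a01 := a03) (a02 := a01) (a03 := a02) (a12 := a13) (a13 := a23) (a23 := a12)
      (b0 := b0) (X0 := X0) (b1 := b3) (X1 := X3) (b2 := b1) (X2 := X1) (b3 := b2) (X3 := X2)
      h03 hb1 hb2 (by linear_combination e0) (by linear_combination e3) (by linear_combination e1) (by linear_combination e2)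
      (by linear_combination hsum) (by linear_combination hQ) (by linear_combination hS) n0 (by grind)
  · exact first_coordinates_ne (a01 := a12) (a02 := a01) (a03 := a13) (a12 := a02) (a13 := a23) (a23 := a03)
      (b0 := b1) (X0 := X1) (b1 := b2) (X1 := X2) (b2 := b0) (X2 := X0) (b3 := b3) (X3 := X3)
      h12 hb0 hb3 (by linear_combination e1) (by linear_combination e2) (by linear_combination e0) (by linear_combination e3)
      (by linear_combination hsum) (by linear_combination hQ) (by linear_combination hS) n1 (by grind)
  · exact first_coordinates_ne (a01 := a13) (a02 := a01) (a03 := a12) (a12 := a03) (a13 := a23) (a23 := a02)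
      (b0 := b1) (X0 := X1) (b1 := b3) (X1 := X3) (b2 := b0) (X2 := X0) (b3 := b2) (X3 := X2)
      h13 hb0 hb2 (by linear_combination e1) (by linear_combination e3) (by linear_combination e0) (by linear_combination e2)
      (by linear_combination hsum) (by linear_combination hQ) (by linear_combination hS) n1 (by grind)
  · exact first_coordinates_ne (a01 := a23) (a02 := a02) (a03 := a12) (a12 := a03) (a13 := a13) (a23 := a01)
      (b0 := b2) (X0 := X2) (b1 := b3) (X1 := X3) (b2 := b0) (X2 := X0) (b3 := b1) (X3 := X1)
      h23 hb0 hb1 (by linear_combination e2) (by linear_combination e3) (by linear_combination e0) (by linear_combination e1)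
      (by linear_combination hsum) (by linear_combination hQ) (by linear_combination hS) n2 (by grind)

end Cremona

/-! ### The twisted cubic through the five points and a point of the cubic surface -/

section CubicThroughPoints

variable {K : Type*} [Field K]

/-- The coefficient matrix of the curve with coordinates `cₗ ∏_{j ≠ l} (s Xⱼ + t)`. -/
def cremonaMatrix (c X : Fin 4 → K) : Matrix (Fin 4) (Fin 4) K :=
  Matrix.of fun l => c l • ![X (l.succAbove 0) * X (l.succAbove 1) * X (l.succAbove 2),
    X (l.succAbove 0) * X (l.succAbove 1) + X (l.succAbove 0) * X (l.succAbove 2) +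
      X (l.succAbove 1) * X (l.succAbove 2),
    X (l.succAbove 0) + X (l.succAbove 1) + X (l.succAbove 2), 1]

theorem cremonaMatrix_mulVec (c X : Fin 4 → K) (s t : K) :
    (cremonaMatrix c X).mulVec ![s ^ 3, s ^ 2 * t, s * t ^ 2, t ^ 3] =
      ![c 0 * ((s * X 1 + t) * (s * X 2 + t) * (s * X 3 + t)),
        c 1 * ((s * X 0 + t) * (s * X 2 + t) * (s * X 3 + t)),
        c 2 * ((s * X 0 + t) * (s * X 1 + t) * (s * X 3 + t)),
        c 3 * ((s * X 0 + t) * (s * X 1 + t) * (s * X 2 + t))] := by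
  funext l
  fin_cases l <;>
    simp [cremonaMatrix, Matrix.mulVec, dotProduct, Fin.sum_univ_four, Fin.succAbove] <;> ring

theorem det_cremonaMatrix (c X : Fin 4 → K) :
    (cremonaMatrix c X).det = c 0 * c 1 * c 2 * c 3 * ((X 0 - X 1) * (X 0 - X 2) * (X 0 - X 3) *
      (X 1 - X 2) * (X 1 - X 3) * (X 2 - X 3)) := by
  simp [cremonaMatrix, Matrix.det_succ_row_zero, Fin.sum_univ_succ, Fin.succAbove]
  ring

/-- A zero coordinate would put the fifth point in a plane with three of the others. -/
theorem coordinates_ne_zero {A : Matrix (Fin 4) (Fin 3) K} {v : Fin 5 → Fin 4 → K}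
    (hgp : InGeneralPosition A v) {ω : Fin 4 → K} (hω : (pointMatrix v).mulVec ω = v 4)
    (l : Fin 4) : ω l ≠ 0 := by
  intro h0
  have hli := Fintype.linearIndependent_iff.1 (hgp.2.1 l.castSucc)
  let c : Fin 5 → K := Fin.snoc ω (-1)
  have hsum : ∑ i, c i • v i = 0 := by
    rw [pointMatrix_mulVec] at hω
    rw [Fin.sum_univ_castSucc, Fin.sum_univ_four]
    simp only [c, Fin.snoc_castSucc, Fin.snoc_last]
    change ω 0 • v 0 + ω 1 • v 1 + ω 2 • v 2 + ω 3 • v 3 + (-1 : K) • v 4 = 0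
    rw [hω]
    simp
  rw [Fin.sum_univ_succAbove _ l.castSucc] at hsum
  simp only [c, Fin.snoc_castSucc, h0, zero_smul, zero_add] at hsum
  obtain ⟨j, hj⟩ := Fin.exists_succAbove_eq (x := Fin.last 4) (y := l.castSucc)
    (Fin.castSucc_lt_last l).ne'
  have := hli (fun j => c (l.castSucc.succAbove j)) hsum j
  simp only [c, hj, Fin.snoc_last] at this
  exact neg_ne_zero.2 one_ne_zero this

/-- With x_l = ω_l X_l, the curve with coordinates ω_l X_l / (sX_l + t) is the Cremona image of the
line joining (1:1:1:1) to (1/X_l). It passes through `x` at [0:1], the fifth point at [1:0], and the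
l-th vertex where sX_l + t = 0. Hypothesis `hS` says that `x` is on the cubic surface, that is, that
the line lies in the tangent plane of the transformed quadric at (1:1:1:1). -/
theorem exists_twistedCubic_through {A : Matrix (Fin 4) (Fin 3) K} {v : Fin 5 → Fin 4 → K}
    (hgp : InGeneralPosition A v) {q : QuadraticForm K (Fin 4 → K)} {κ : K} (hκ0 : κ ≠ 0)
    (hκ : ∀ u : Fin 3 → K, q (A.mulVec u) = κ * (u 0 * u 2 - u 1 ^ 2)) (hv : ∀ i, q (v i) = 0)
    {ω x : Fin 4 → K} (hω : (pointMatrix v).mulVec ω = v 4) (hx : x ≠ 0)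
    (hplane : planeForm A ((pointMatrix v).mulVec x) = 0) (hq : q ((pointMatrix v).mulVec x) = 0)
    (hS : ∑ k : Fin 4, ω k ^ 2 * QuadraticMap.polar q (v k.castSucc) (v 4) *
      ∏ j, x (k.succAbove j) = 0) :
    ∃ M : Matrix (Fin 4) (Fin 4) K, M.det ≠ 0 ∧
      (∀ s t : K, q (M.mulVec ![s ^ 3, s ^ 2 * t, s * t ^ 2, t ^ 3]) = 0) ∧
      (∀ i, ∃ s t a : K, (s ≠ 0 ∨ t ≠ 0) ∧ a ≠ 0 ∧
        M.mulVec ![s ^ 3, s ^ 2 * t, s * t ^ 2, t ^ 3] = a • v i) ∧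
      ∃ s t a : K, (s ≠ 0 ∨ t ≠ 0) ∧ a ≠ 0 ∧
        M.mulVec ![s ^ 3, s ^ 2 * t, s * t ^ 2, t ^ 3] = a • (pointMatrix v).mulVec x := by
  have hω0 := coordinates_ne_zero hgp hω
  have hp := ((inGeneralPosition_iff A v).1 hgp).2.1
  have hV := det_pointMatrix_ne_zero hgp
  have hpol : ∀ {i j : Fin 5}, i ≠ j → QuadraticMap.polar q (v i) (v j) ≠ 0 :=
    fun h => polar_ne_zero_of_inGeneralPosition hgp hκ0 hκ hv h
  obtain ⟨X, rfl⟩ : ∃ X : Fin 4 → K, x = fun l => ω l * X l :=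
    ⟨fun l => x l / ω l, funext fun l => (mul_div_cancel₀ _ (hω0 l)).symm⟩
  have hV4 : ∀ y : Fin 4 → K, q ((pointMatrix v).mulVec y) =
      y 0 * y 1 * QuadraticMap.polar q (v 0) (v 1) + y 0 * y 2 * QuadraticMap.polar q (v 0) (v 2) +
      y 0 * y 3 * QuadraticMap.polar q (v 0) (v 3) + y 1 * y 2 * QuadraticMap.polar q (v 1) (v 2) +
      y 1 * y 3 * QuadraticMap.polar q (v 1) (v 3) + y 2 * y 3 * QuadraticMap.polar q (v 2) (v 3) :=
    fun y => by rw [pointMatrix_mulVec, quadraticForm_four q _ _ _ _ (hv 0) (hv 1) (hv 2) (hv 3)]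
  have hb : ∀ i : Fin 5, QuadraticMap.polar q (v i) (v 4) =
      ω 0 * QuadraticMap.polar q (v i) (v 0) + ω 1 * QuadraticMap.polar q (v i) (v 1) +
      ω 2 * QuadraticMap.polar q (v i) (v 2) + ω 3 * QuadraticMap.polar q (v i) (v 3) := fun i => by
    rw [← hω, polar_pointMatrix_mulVec, Fin.sum_univ_four]
    rfl
  have hself : ∀ i, QuadraticMap.polar q (v i) (v i) = 0 := fun i => by
    rw [QuadraticMap.polar_self, hv, smul_zero]
  have hsum := hv 4
  rw [← hω, hV4] at hsum
  rw [hV4] at hq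
  have hb0 := hb 0
  have hb1 := hb 1
  have hb2 := hb 2
  have hb3 := hb 3
  rw [hself, QuadraticMap.polar_comm _ (v 1) (v 0)] at hb1
  rw [hself] at hb0
  rw [hself, QuadraticMap.polar_comm _ (v 2) (v 0), QuadraticMap.polar_comm _ (v 2) (v 1)] at hb2
  rw [hself, QuadraticMap.polar_comm _ (v 3) (v 0), QuadraticMap.polar_comm _ (v 3) (v 1),
    QuadraticMap.polar_comm _ (v 3) (v 2)] at hb3
  have n01 := hpol (i := 0) (j := 1) (by decide)
  have n02 := hpol (i := 0) (j := 2) (by decide)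
  have n03 := hpol (i := 0) (j := 3) (by decide)
  have n12 := hpol (i := 1) (j := 2) (by decide)
  have n13 := hpol (i := 1) (j := 3) (by decide)
  have n23 := hpol (i := 2) (j := 3) (by decide)
  have n04 := hpol (i := 0) (j := 4) (by decide)
  have n14 := hpol (i := 1) (j := 4) (by decide)
  have n24 := hpol (i := 2) (j := 4) (by decide)
  have n34 := hpol (i := 3) (j := 4) (by decide)
  simp only [Fin.sum_univ_four, Fin.prod_univ_three] at hS
  change ω 0 ^ 2 * QuadraticMap.polar q (v 0) (v 4) * (ω 1 * X 1 * (ω 2 * X 2) * (ω 3 * X 3)) +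
    ω 1 ^ 2 * QuadraticMap.polar q (v 1) (v 4) * (ω 0 * X 0 * (ω 2 * X 2) * (ω 3 * X 3)) +
    ω 2 ^ 2 * QuadraticMap.polar q (v 2) (v 4) * (ω 0 * X 0 * (ω 1 * X 1) * (ω 3 * X 3)) +
    ω 3 ^ 2 * QuadraticMap.polar q (v 3) (v 4) * (ω 0 * X 0 * (ω 1 * X 1) * (ω 2 * X 2)) = 0 at hS
  generalize QuadraticMap.polar q (v 0) (v 1) = a01 at *
  generalize QuadraticMap.polar q (v 0) (v 2) = a02 at *
  generalize QuadraticMap.polar q (v 0) (v 3) = a03 at *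
  generalize QuadraticMap.polar q (v 1) (v 2) = a12 at *
  generalize QuadraticMap.polar q (v 1) (v 3) = a13 at *
  generalize QuadraticMap.polar q (v 2) (v 3) = a23 at *
  generalize QuadraticMap.polar q (v 0) (v 4) = b0 at *
  generalize QuadraticMap.polar q (v 1) (v 4) = b1 at *
  generalize QuadraticMap.polar q (v 2) (v 4) = b2 at *
  generalize QuadraticMap.polar q (v 3) (v 4) = b3 at *
  have hS' : ω 0 * b0 * (X 1 * X 2 * X 3) + ω 1 * b1 * (X 0 * X 2 * X 3) +
      ω 2 * b2 * (X 0 * X 1 * X 3) + ω 3 * b3 * (X 0 * X 1 * X 2) = 0 := by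
    have : (ω 0 * ω 1 * ω 2 * ω 3) * (ω 0 * b0 * (X 1 * X 2 * X 3) + ω 1 * b1 * (X 0 * X 2 * X 3) +
      ω 2 * b2 * (X 0 * X 1 * X 3) + ω 3 * b3 * (X 0 * X 1 * X 2)) = 0 := by
      linear_combination hS
    exact (mul_eq_zero.1 this).resolve_left
      (mul_ne_zero (mul_ne_zero (mul_ne_zero (hω0 0) (hω0 1)) (hω0 2)) (hω0 3))
  have hnotv : ∀ (i : Fin 5) (a : K), (pointMatrix v).mulVec (fun l => ω l * X l) ≠ a • v i := by
    intro i a h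
    rw [h, planeForm_smul] at hplane
    have ha : a = 0 := (mul_eq_zero.1 hplane).resolve_right (hp i)
    rw [ha, zero_smul] at h
    exact hx (Matrix.eq_zero_of_mulVec_eq_zero hV h)
  obtain ⟨⟨x0, x1, x2, x3⟩, d01, d02, d03, d12, d13, d23⟩ := coordinates_ne
    (a01 := a01 * ω 0 * ω 1) (a02 := a02 * ω 0 * ω 2) (a03 := a03 * ω 0 * ω 3)
    (a12 := a12 * ω 1 * ω 2) (a13 := a13 * ω 1 * ω 3) (a23 := a23 * ω 2 * ω 3)
    (b0 := ω 0 * b0) (b1 := ω 1 * b1) (b2 := ω 2 * b2) (b3 := ω 3 * b3)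
    (X0 := X 0) (X1 := X 1) (X2 := X 2) (X3 := X 3)
    (by simp [*]) (by simp [*]) (by simp [*]) (by simp [*]) (by simp [*]) (by simp [*])
    (mul_ne_zero (hω0 0) n04) (mul_ne_zero (hω0 1) n14) (mul_ne_zero (hω0 2) n24)
    (mul_ne_zero (hω0 3) n34)
    (by linear_combination ω 0 * hb0) (by linear_combination ω 1 * hb1)
    (by linear_combination ω 2 * hb2) (by linear_combination ω 3 * hb3)
    (by linear_combination hsum) (by linear_combination hq) hS'
    (by
      rintro ⟨h1, h2, h3⟩
      refine hnotv 0 (ω 0 * X 0) ?_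
      rw [pointMatrix_mulVec, h1, h2, h3]
      simp)
    (by
      rintro ⟨h1, h2, h3⟩
      refine hnotv 1 (ω 1 * X 1) ?_
      rw [pointMatrix_mulVec, h1, h2, h3]
      simp)
    (by
      rintro ⟨h1, h2, h3⟩
      refine hnotv 2 (ω 2 * X 2) ?_
      rw [pointMatrix_mulVec, h1, h2, h3]
      simp)
    (by
      rintro ⟨h1, h2, h3⟩
      refine hnotv 3 (ω 3 * X 3) ?_
      rw [pointMatrix_mulVec, h1, h2, h3]
      simp)
    (by
      rintro ⟨h1, h2, h3⟩
      refine hnotv 4 (X 0) ?_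
      rw [← hω, ← Matrix.mulVec_smul]
      congr 1
      funext l
      fin_cases l <;> simp [h1, h2, h3, mul_comm])
  refine ⟨pointMatrix v * cremonaMatrix (fun l => ω l * X l) X, ?_, fun s t => ?_, fun i => ?_, ?_⟩
  · rw [Matrix.det_mul, det_cremonaMatrix]
    simp [hV, hω0, x0, x1, x2, x3, sub_eq_zero, d01, d02, d03, d12, d13, d23]
  · rw [← Matrix.mulVec_mulVec, cremonaMatrix_mulVec, hV4]
    simp only [Matrix.cons_val_zero, Matrix.cons_val_one, Matrix.cons_val]
    have e0 : b0 * ω 0 = a01 * ω 0 * ω 1 + a02 * ω 0 * ω 2 + a03 * ω 0 * ω 3 := by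
      linear_combination ω 0 * hb0
    have e1 : b1 * ω 1 = a01 * ω 0 * ω 1 + a12 * ω 1 * ω 2 + a13 * ω 1 * ω 3 := by
      linear_combination ω 1 * hb1
    have e2 : b2 * ω 2 = a02 * ω 0 * ω 2 + a12 * ω 1 * ω 2 + a23 * ω 2 * ω 3 := by
      linear_combination ω 2 * hb2
    have e3 : b3 * ω 3 = a03 * ω 0 * ω 3 + a13 * ω 1 * ω 3 + a23 * ω 2 * ω 3 := by
      linear_combination ω 3 * hb3
    -- Along the curve the quadric is this product times a binary quadratic form. Its s² and t²
    -- coefficients vanish because the fifth point and `x` are on the quadric; its st coefficient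
    -- vanishes by the equation of the cubic surface.
    linear_combination ((s * X 0 + t) * (s * X 1 + t) * (s * X 2 + t) * (s * X 3 + t)) *
      (s ^ 2 * (X 0 * X 1 * X 2 * X 3) * hsum + t ^ 2 * hq +
      s * t * ((X 0 * X 1 * X 2 + X 0 * X 1 * X 3 + X 0 * X 2 * X 3 + X 1 * X 2 * X 3) * hsum
        + (X 1 * X 2 * X 3) * e0 + (X 0 * X 2 * X 3) * e1 + (X 0 * X 1 * X 3) * e2
        + (X 0 * X 1 * X 2) * e3 - hS'))
  · simp only [← Matrix.mulVec_mulVec, cremonaMatrix_mulVec]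
    fin_cases i
    · refine ⟨1, -X 0, ω 0 * X 0 * ((X 1 - X 0) * (X 2 - X 0) * (X 3 - X 0)),
        Or.inl one_ne_zero, mul_ne_zero (mul_ne_zero (hω0 0) x0) (mul_ne_zero (mul_ne_zero
          (sub_ne_zero.2 d01.symm) (sub_ne_zero.2 d02.symm)) (sub_ne_zero.2 d03.symm)), ?_⟩
      rw [pointMatrix_mulVec]
      simp [sub_eq_add_neg]
    · refine ⟨1, -X 1, ω 1 * X 1 * ((X 0 - X 1) * (X 2 - X 1) * (X 3 - X 1)),
        Or.inl one_ne_zero, mul_ne_zero (mul_ne_zero (hω0 1) x1) (mul_ne_zero (mul_ne_zero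
          (sub_ne_zero.2 d01) (sub_ne_zero.2 d12.symm)) (sub_ne_zero.2 d13.symm)), ?_⟩
      rw [pointMatrix_mulVec]
      simp [sub_eq_add_neg]
    · refine ⟨1, -X 2, ω 2 * X 2 * ((X 0 - X 2) * (X 1 - X 2) * (X 3 - X 2)),
        Or.inl one_ne_zero, mul_ne_zero (mul_ne_zero (hω0 2) x2) (mul_ne_zero (mul_ne_zero
          (sub_ne_zero.2 d02) (sub_ne_zero.2 d12)) (sub_ne_zero.2 d23.symm)), ?_⟩
      rw [pointMatrix_mulVec]
      simp [sub_eq_add_neg]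
    · refine ⟨1, -X 3, ω 3 * X 3 * ((X 0 - X 3) * (X 1 - X 3) * (X 2 - X 3)),
        Or.inl one_ne_zero, mul_ne_zero (mul_ne_zero (hω0 3) x3) (mul_ne_zero (mul_ne_zero
          (sub_ne_zero.2 d03) (sub_ne_zero.2 d13)) (sub_ne_zero.2 d23)), ?_⟩
      rw [pointMatrix_mulVec]
      simp [sub_eq_add_neg]
    · refine ⟨1, 0, X 0 * X 1 * X 2 * X 3, Or.inl one_ne_zero,
        mul_ne_zero (mul_ne_zero (mul_ne_zero x0 x1) x2) x3, ?_⟩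
      change _ = _ • v 4
      rw [← hω, ← Matrix.mulVec_smul]
      congr 1
      funext l
      fin_cases l <;> simp <;> ring
  · refine ⟨0, 1, 1, Or.inr one_ne_zero, one_ne_zero, ?_⟩
    rw [← Matrix.mulVec_mulVec, cremonaMatrix_mulVec, one_smul]
    congr 1
    funext l
    fin_cases l <;> simp

end CubicThroughPoints

/-! ### Parametrized curves on a quadric: factoring a 2 × 2 matrix of rank one -/

section Factorization

open Polynomial

variable {K : Type*} [Field K]

theorem exists_mulVec_two_eq_zero {m : ℕ} (hm : 3 ≤ m) (N : Matrix (Fin 4) (Fin m) K)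
    (i j : Fin 4) : ∃ u, u ≠ 0 ∧ N.mulVec u i = 0 ∧ N.mulVec u j = 0 := by
  let F : (Fin m → K) →ₗ[K] K × K :=
    ((LinearMap.proj i).comp N.mulVecLin).prod ((LinearMap.proj j).comp N.mulVecLin)
  have hF : LinearMap.ker F ≠ ⊥ := LinearMap.ker_ne_bot_of_finrank_lt (by
    rw [Module.finrank_prod, Module.finrank_self, Module.finrank_fin_fun]
    omega)
  obtain ⟨u, hu, hu0⟩ := Submodule.exists_mem_ne_zero_of_ne_bot hF
  have := LinearMap.mem_ker.1 hu
  exact ⟨u, hu0, congrArg Prod.fst this, congrArg Prod.snd this⟩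

/-- The polynomial with the coefficients of a row of a matrix. -/
noncomputable def rowPolynomial {m : ℕ} (N : Matrix (Fin 4) (Fin m) K) (i : Fin 4) : K[X] :=
  ∑ k : Fin m, C (N i k) * X ^ (k : ℕ)

theorem rowPolynomial_coeff {m : ℕ} (N : Matrix (Fin 4) (Fin m) K) (i : Fin 4) (k : Fin m) :
    (rowPolynomial N i).coeff k = N i k := by
  simp only [rowPolynomial, finsetSum_coeff, coeff_C_mul, coeff_X_pow]
  rw [Finset.sum_eq_single k]
  · simp
  · intro b _ hb
    simp [Ne.symm (Fin.val_ne_of_ne hb)]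
  · simp

theorem rowPolynomial_natDegree_le {n : ℕ} (N : Matrix (Fin 4) (Fin (n + 1)) K) (i : Fin 4) :
    (rowPolynomial N i).natDegree ≤ n := by
  refine natDegree_sum_le_of_forall_le _ _ fun k _ => ?_
  exact (natDegree_C_mul_X_pow_le _ _).trans (Nat.lt_succ_iff.1 k.2)

theorem mulVec_combination_eq_zero {m : ℕ} {N : Matrix (Fin 4) (Fin m) K} {i j : Fin 4} {a b : K}
    (h : C a * rowPolynomial N i + C b * rowPolynomial N j = 0) (u : Fin m → K) :
    a * N.mulVec u i + b * N.mulVec u j = 0 := by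
  have hk : ∀ k, a * N i k + b * N j k = 0 := fun k => by
    have := congrArg (fun p => p.coeff (k : ℕ)) h
    simpa [rowPolynomial_coeff] using this
  simp only [Matrix.mulVec, dotProduct, Finset.mul_sum, ← Finset.sum_add_distrib]
  refine Finset.sum_eq_zero fun k _ => ?_
  linear_combination u k * hk k

/-- Two rows of a `2 × 2` matrix of independent enough polynomials satisfy no linear relation. -/
theorem no_linear_relation {m : ℕ} (hm : 3 ≤ m) {N : Matrix (Fin 4) (Fin m) K}
    (hN : Function.Injective N.mulVec) {i j k l : Fin 4} {a b : K}
    (hijkl : ∀ X : Fin 4 → K, X i = 0 → X j = 0 → X k = 0 → X l = 0 → X = 0)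
    (h1 : C a * rowPolynomial N i + C b * rowPolynomial N j = 0)
    (h2 : C a * rowPolynomial N k + C b * rowPolynomial N l = 0) : a = 0 ∧ b = 0 := by
  have hinj : ∀ u, N.mulVec u = 0 → u = 0 := fun u hu => hN (hu.trans N.mulVec_zero.symm)
  constructor
  · by_contra ha
    -- Since `m ≥ 3`, a nonzero `u` is killed by the rows `j` and `l`. The relations then kill it by
    -- the rows `i` and `k` too, against injectivity.
    obtain ⟨u, hu, hj, hl⟩ := exists_mulVec_two_eq_zero hm N j l
    have e1 := mulVec_combination_eq_zero h1 u
    have e2 := mulVec_combination_eq_zero h2 u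
    rw [hj, mul_zero, add_zero] at e1
    rw [hl, mul_zero, add_zero] at e2
    exact hu (hinj u (hijkl _ ((mul_eq_zero.1 e1).resolve_left ha) hj
      ((mul_eq_zero.1 e2).resolve_left ha) hl))
  · by_contra hb
    obtain ⟨u, hu, hi, hk⟩ := exists_mulVec_two_eq_zero hm N i k
    have e1 := mulVec_combination_eq_zero h1 u
    have e2 := mulVec_combination_eq_zero h2 u
    rw [hi, mul_zero, zero_add] at e1
    rw [hk, mul_zero, zero_add] at e2
    exact hu (hinj u (hijkl _ hi ((mul_eq_zero.1 e1).resolve_left hb) hk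
      ((mul_eq_zero.1 e2).resolve_left hb)))

theorem eq_zero_of_four {X : Fin 4 → K} (h0 : X 0 = 0) (h1 : X 1 = 0) (h2 : X 2 = 0)
    (h3 : X 3 = 0) : X = 0 := by
  funext i
  fin_cases i
  exacts [h0, h1, h2, h3]

/-- A 2 × 2 matrix over K[X] with determinant zero is a column times a row, by divisibility in a
unique factorization domain. The two factors parametrize the projections of the curve to the two
copies of ℙ¹, and α, β are the degrees of these projections; neither is zero because the curve is
nondegenerate. -/
theorem exists_rowPolynomial_factorization {n : ℕ} (hn : 2 ≤ n)
    {N : Matrix (Fin 4) (Fin (n + 1)) K} (hN : Function.Injective N.mulVec)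
    (hdet : rowPolynomial N 0 * rowPolynomial N 3 = rowPolynomial N 1 * rowPolynomial N 2) :
    ∃ (a b : Fin 2 → K[X]) (α β : ℕ), α + β = n ∧ 1 ≤ α ∧ 1 ≤ β ∧
      (∀ i, (a i).natDegree ≤ α) ∧ (∀ j, (b j).natDegree ≤ β) ∧
      rowPolynomial N 0 = a 0 * b 0 ∧ rowPolynomial N 1 = a 0 * b 1 ∧
      rowPolynomial N 2 = a 1 * b 0 ∧ rowPolynomial N 3 = a 1 * b 1 ∧
      (∀ c d : K, C c * a 0 + C d * a 1 = 0 → c = 0 ∧ d = 0) ∧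
      (∀ c d : K, C c * b 0 + C d * b 1 = 0 → c = 0 ∧ d = 0) := by
  have hrow : ∀ c d : K, C c * rowPolynomial N 0 + C d * rowPolynomial N 2 = 0 →
      C c * rowPolynomial N 1 + C d * rowPolynomial N 3 = 0 → c = 0 ∧ d = 0 := fun c d h1 h2 =>
    no_linear_relation (by omega) hN (fun X h0 h2 h1 h3 => eq_zero_of_four h0 h1 h2 h3) h1 h2
  have hcol : ∀ c d : K, C c * rowPolynomial N 0 + C d * rowPolynomial N 1 = 0 →
      C c * rowPolynomial N 2 + C d * rowPolynomial N 3 = 0 → c = 0 ∧ d = 0 := fun c d h1 h2 =>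
    no_linear_relation (by omega) hN (fun X h0 h1 h2 h3 => eq_zero_of_four h0 h1 h2 h3) h1 h2
  have h00 : rowPolynomial N 0 ≠ 0 := by
    intro h0
    rw [h0, zero_mul, eq_comm] at hdet
    rcases mul_eq_zero.1 hdet with h | h
    · exact one_ne_zero (hrow 1 0 (by simp [h0]) (by simp [h])).1
    · exact one_ne_zero (hcol 1 0 (by simp [h0]) (by simp [h])).1
  obtain ⟨a0, b0, ⟨b1, hb1⟩, ⟨a1, ha1⟩, hab⟩ := exists_dvd_and_dvd_of_dvd_mul
    (Dvd.intro _ hdet)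
  have h33 : rowPolynomial N 3 = a1 * b1 := by
    apply mul_left_cancel₀ h00
    rw [hdet, hab, hb1, ha1]
    ring
  have h22 : rowPolynomial N 2 = a1 * b0 := by rw [ha1, mul_comm]
  have hA : ∀ c d : K, C c * a0 + C d * a1 = 0 → c = 0 ∧ d = 0 := fun c d h =>
    hrow c d (by rw [hab, h22]; linear_combination b0 * h)
      (by rw [hb1, h33]; linear_combination b1 * h)
  have hB : ∀ c d : K, C c * b0 + C d * b1 = 0 → c = 0 ∧ d = 0 := fun c d h =>
    hcol c d (by rw [hab, hb1]; linear_combination a0 * h)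
      (by rw [h22, h33]; linear_combination a1 * h)
  have ha0 : a0 ≠ 0 := fun h => one_ne_zero (hA 1 0 (by simp [h])).1
  have ha1' : a1 ≠ 0 := fun h => one_ne_zero (hA 0 1 (by simp [h])).2
  have hb0 : b0 ≠ 0 := fun h => one_ne_zero (hB 1 0 (by simp [h])).1
  have hb1' : b1 ≠ 0 := fun h => one_ne_zero (hB 0 1 (by simp [h])).2
  have hf : ∀ i j : Fin 2, ∃ k : Fin 4, rowPolynomial N k = ![a0, a1] i * ![b0, b1] j := by
    intro i j
    fin_cases i <;> fin_cases j
    exacts [⟨0, hab⟩, ⟨1, hb1⟩, ⟨2, h22⟩, ⟨3, h33⟩]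
  have hanz : ∀ i, ![a0, a1] i ≠ 0 := by
    intro i
    fin_cases i
    exacts [ha0, ha1']
  have hbnz : ∀ i, ![b0, b1] i ≠ 0 := by
    intro i
    fin_cases i
    exacts [hb0, hb1']
  have hdeg : ∀ i j : Fin 2, (![a0, a1] i).natDegree + (![b0, b1] j).natDegree ≤ n := by
    intro i j
    obtain ⟨k, hk⟩ := hf i j
    rw [← natDegree_mul (hanz i) (hbnz j), ← hk]
    exact rowPolynomial_natDegree_le N k
  -- The last column of `N` is nonzero, so some entry has full degree `n`; its two factors have the
  -- maximal degrees, which serve as α and β.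
  obtain ⟨i, j, hij⟩ : ∃ i j : Fin 2, (![a0, a1] i).natDegree + (![b0, b1] j).natDegree = n := by
    have hlast : N.mulVec (Pi.single (Fin.last n) 1) ≠ 0 := by
      intro h
      have := hN (h.trans N.mulVec_zero.symm)
      exact one_ne_zero (α := K) (by simpa using congrFun this (Fin.last n))
    obtain ⟨k, hk⟩ := Function.ne_iff.1 hlast
    have hk' : (rowPolynomial N k).coeff n ≠ 0 := by
      have := rowPolynomial_coeff N k (Fin.last n)
      rw [Fin.val_last] at this
      rw [this]
      simpa using hk
    have hn : n ≤ (rowPolynomial N k).natDegree := le_natDegree_of_ne_zero hk'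
    have : ∃ i j : Fin 2, rowPolynomial N k = ![a0, a1] i * ![b0, b1] j := by
      fin_cases k
      exacts [⟨0, 0, hab⟩, ⟨0, 1, hb1⟩, ⟨1, 0, h22⟩, ⟨1, 1, h33⟩]
    obtain ⟨i, j, e⟩ := this
    rw [e, natDegree_mul (hanz i) (hbnz j)] at hn
    exact ⟨i, j, le_antisymm (hdeg i j) hn⟩
  have hα : ∀ i', (![a0, a1] i').natDegree ≤ (![a0, a1] i).natDegree := fun i' => by
    have := hdeg i' j
    omega
  have hβ : ∀ j', (![b0, b1] j').natDegree ≤ (![b0, b1] j).natDegree := fun j' => by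
    have := hdeg i j'
    omega
  refine ⟨![a0, a1], ![b0, b1], _, _, hij, ?_, ?_, hα, hβ, hab, hb1, h22, h33, hA, hB⟩
  · by_contra h
    have hz : (![a0, a1] i).natDegree = 0 := by omega
    rw [hz] at hα
    have e0 := eq_C_of_natDegree_le_zero (hα 0)
    have e1 := eq_C_of_natDegree_le_zero (hα 1)
    simp only [Matrix.cons_val_zero, Matrix.cons_val_one] at e0 e1
    -- Two constants always satisfy this linear relation.
    have := hA (a1.coeff 0) (-a0.coeff 0) (by
      rw [C_neg]
      linear_combination C (a1.coeff 0) * e0 - C (a0.coeff 0) * e1)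
    rw [this.1, C_0] at e1
    exact ha1' e1
  · by_contra h
    have hz : (![b0, b1] j).natDegree = 0 := by omega
    rw [hz] at hβ
    have e0 := eq_C_of_natDegree_le_zero (hβ 0)
    have e1 := eq_C_of_natDegree_le_zero (hβ 1)
    simp only [Matrix.cons_val_zero, Matrix.cons_val_one] at e0 e1
    have := hB (b1.coeff 0) (-b0.coeff 0) (by
      rw [C_neg]
      linear_combination C (b1.coeff 0) * e0 - C (b0.coeff 0) * e1)
    rw [this.1, C_0] at e1
    exact hb1' e1

end Factorization

/-! ### Graphs of linear and quadratic maps between the factors -/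

section Graphs

variable {K : Type*} [Field K]

/-- A pair of binary quadratic forms with given coefficients. -/
def binaryQuadratics (c : Fin 2 → Fin 3 → K) (y : Fin 2 → K) : Fin 2 → K :=
  fun i => c i 0 * y 0 ^ 2 + c i 1 * (y 0 * y 1) + c i 2 * y 1 ^ 2

/-- A pair of binary linear forms with given coefficients. -/
def binaryLinears (c : Fin 2 → Fin 2 → K) (y : Fin 2 → K) : Fin 2 → K :=
  fun i => c i 0 * y 0 + c i 1 * y 1

/-- The curve is the graph of a quadratic map from the second factor of `ℙ¹ × ℙ¹` to the first. -/
def IsQuadraticGraph (g : Matrix (Fin 4) (Fin 4) K) (T : Set (P3 K)) : Prop :=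
  ∃ c : Fin 2 → Fin 3 → K, (∀ y, y ≠ 0 → binaryQuadratics c y ≠ 0) ∧
    T = {P | ∃ y, y ≠ 0 ∧ Represents (segreMap g (binaryQuadratics c y) y) P}

/-- The curve is the graph of an isomorphism from the second factor of `ℙ¹ × ℙ¹` to the first. -/
def IsLinearGraph (g : Matrix (Fin 4) (Fin 4) K) (T : Set (P3 K)) : Prop :=
  ∃ c : Fin 2 → Fin 2 → K, c 0 0 * c 1 1 - c 0 1 * c 1 0 ≠ 0 ∧
    T = {P | ∃ y, y ≠ 0 ∧ Represents (segreMap g (binaryLinears c y) y) P}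

theorem segreMap_smul_left (g : Matrix (Fin 4) (Fin 4) K) (a : K) (x y : Fin 2 → K) :
    segreMap g (a • x) y = a • segreMap g x y := by
  rw [segreMap, segreMap, ← Matrix.mulVec_smul]
  congr 1
  funext i
  fin_cases i <;> simp [mul_assoc]

theorem segreMap_smul_right (g : Matrix (Fin 4) (Fin 4) K) (a : K) (x y : Fin 2 → K) :
    segreMap g x (a • y) = a • segreMap g x y := by
  rw [segreMap, segreMap, ← Matrix.mulVec_smul]
  congr 1
  funext i
  fin_cases i <;> simp [mul_left_comm]

theorem segreMap_add_left (g : Matrix (Fin 4) (Fin 4) K) (x x' y : Fin 2 → K) :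
    segreMap g (x + x') y = segreMap g x y + segreMap g x' y := by
  rw [segreMap, segreMap, segreMap, ← Matrix.mulVec_add]
  congr 1
  funext i
  fin_cases i <;> simp [add_mul]

theorem left_ne_zero_of_segreMap {g : Matrix (Fin 4) (Fin 4) K} {x y : Fin 2 → K}
    (h : segreMap g x y ≠ 0) : x ≠ 0 := by
  rintro rfl
  apply h
  have := segreMap_smul_left g 0 0 y
  simpa using this

theorem right_ne_zero_of_segreMap {g : Matrix (Fin 4) (Fin 4) K} {x y : Fin 2 → K}
    (h : segreMap g x y ≠ 0) : y ≠ 0 := by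
  rintro rfl
  apply h
  have := segreMap_smul_right g 0 x 0
  simpa using this

theorem binaryQuadratics_smul (c : Fin 2 → Fin 3 → K) (a : K) (y : Fin 2 → K) :
    binaryQuadratics c (a • y) = a ^ 2 • binaryQuadratics c y := by
  funext i
  simp [binaryQuadratics]
  ring

theorem binaryLinears_smul (c : Fin 2 → Fin 2 → K) (a : K) (y : Fin 2 → K) :
    binaryLinears c (a • y) = a • binaryLinears c y := by
  funext i
  simp [binaryLinears]
  ring

theorem pair_ne_zero_iff {s t : K} : (![s, t] : Fin 2 → K) ≠ 0 ↔ s ≠ 0 ∨ t ≠ 0 := by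
  constructor
  · intro h
    by_contra! h0
    apply h
    funext i
    fin_cases i
    exacts [h0.1, h0.2]
  · rintro (h | h) h0
    exacts [h (congrFun h0 0), h (congrFun h0 1)]

theorem coord_ne_zero {y : Fin 2 → K} (h : y ≠ 0) : y 0 ≠ 0 ∨ y 1 ≠ 0 := by
  rw [← pair_ne_zero_iff]
  convert h using 1
  funext i
  fin_cases i <;> rfl

theorem exists_smul_of_cross_eq {x y : Fin 2 → K} (hx : x ≠ 0) (hy : y ≠ 0)
    (h : x 0 * y 1 = y 0 * x 1) : ∃ a : K, a ≠ 0 ∧ y = a • x := by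
  obtain ⟨a, ha, h0, h1⟩ := exists_smul_of_mul_eq (coord_ne_zero hx) (coord_ne_zero hy) h
  refine ⟨a, ha, ?_⟩
  funext i
  fin_cases i
  exacts [h0, h1]

theorem segreMap_injective {g : Matrix (Fin 4) (Fin 4) K} (hg : g.det ≠ 0) {x y x' y' : Fin 2 → K}
    (h : segreMap g x y = segreMap g x' y') (h0 : segreMap g x y ≠ 0) :
    ∃ a : K, a ≠ 0 ∧ y' = a • y ∧ x = a • x' := by
  have e := mulVec_injective_of_det hg h
  have e0 := congrFun e 0
  have e1 := congrFun e 1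
  have e2 := congrFun e 2
  have e3 := congrFun e 3
  simp only [Matrix.cons_val_zero, Matrix.cons_val_one, Matrix.cons_val] at e0 e1 e2 e3
  have hx := left_ne_zero_of_segreMap h0
  have hy := right_ne_zero_of_segreMap h0
  have h0' := h0
  rw [h] at h0'
  have hx' := left_ne_zero_of_segreMap h0'
  have hy' := right_ne_zero_of_segreMap h0'
  have hcross : y 0 * y' 1 = y' 0 * y 1 := by
    rcases coord_ne_zero hx with hx0 | hx1
    · apply mul_left_cancel₀ hx0
      linear_combination y' 1 * e0 - y' 0 * e1
    · apply mul_left_cancel₀ hx1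
      linear_combination y' 1 * e2 - y' 0 * e3
  obtain ⟨a, ha, rfl⟩ := exists_smul_of_cross_eq hy hy' hcross
  refine ⟨a, ha, rfl, ?_⟩
  simp only [Pi.smul_apply, smul_eq_mul] at e0 e1 e2 e3
  funext i
  rcases coord_ne_zero hy with hy0 | hy1
  · apply mul_right_cancel₀ hy0
    fin_cases i
    · exact e0.trans (mul_left_comm _ _ _ |>.trans (mul_assoc _ _ _).symm)
    · exact e2.trans (mul_left_comm _ _ _ |>.trans (mul_assoc _ _ _).symm)
  · apply mul_right_cancel₀ hy1
    fin_cases i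
    · exact e1.trans (mul_left_comm _ _ _ |>.trans (mul_assoc _ _ _).symm)
    · exact e3.trans (mul_left_comm _ _ _ |>.trans (mul_assoc _ _ _).symm)

/-- The composition of `g` with the exchange of the two factors of `ℙ¹ × ℙ¹`. -/
def swapFactors (g : Matrix (Fin 4) (Fin 4) K) : Matrix (Fin 4) (Fin 4) K :=
  g.submatrix id (Equiv.swap 1 2)

theorem det_swapFactors {g : Matrix (Fin 4) (Fin 4) K} (hg : g.det ≠ 0) :
    (swapFactors g).det ≠ 0 := by
  rw [swapFactors, Matrix.det_permute']
  simp [hg]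

theorem segreMap_swapFactors (g : Matrix (Fin 4) (Fin 4) K) (x y : Fin 2 → K) :
    segreMap (swapFactors g) x y = segreMap g y x := by
  have h0 : (Equiv.swap 1 2 : Equiv.Perm (Fin 4)) 0 = 0 := by decide
  have h1 : (Equiv.swap 1 2 : Equiv.Perm (Fin 4)) 1 = 2 := by decide
  have h2 : (Equiv.swap 1 2 : Equiv.Perm (Fin 4)) 2 = 1 := by decide
  have h3 : (Equiv.swap 1 2 : Equiv.Perm (Fin 4)) 3 = 3 := by decide
  funext i
  simp only [segreMap, swapFactors, Matrix.mulVec, dotProduct, Fin.sum_univ_four,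
    Matrix.submatrix_apply, id, h0, h1, h2, h3, Matrix.cons_val_zero, Matrix.cons_val_one,
    Matrix.cons_val]
  ring

/-- The linear component `b` is an automorphism of ℙ¹, so the curve can be reparametrized by its
second coordinate. Here `b'` is the adjugate of `b`, an inverse up to the scalar `D`, and `c` holds
the coefficients of `a` composed with `b'`. -/
theorem isQuadraticGraph_of_forms {g : Matrix (Fin 4) (Fin 4) K} {T : Set (P3 K)}
    (a : Fin 2 → Fin 3 → K) (b : Fin 2 → Fin 2 → K)
    (hb : b 0 0 * b 1 1 - b 0 1 * b 1 0 ≠ 0)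
    (hne : ∀ y, y ≠ 0 → segreMap g (binaryQuadratics a y) (binaryLinears b y) ≠ 0)
    (hT : T = {P | ∃ y, y ≠ 0 ∧
      Represents (segreMap g (binaryQuadratics a y) (binaryLinears b y)) P}) :
    IsQuadraticGraph g T := by
  set D := b 0 0 * b 1 1 - b 0 1 * b 1 0 with hD
  let b' : Fin 2 → Fin 2 → K := ![![b 1 1, -b 0 1], ![-b 1 0, b 0 0]]
  let c : Fin 2 → Fin 3 → K := fun i =>
    ![a i 0 * b 1 1 ^ 2 - a i 1 * (b 1 1 * b 1 0) + a i 2 * b 1 0 ^ 2,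
      -2 * a i 0 * (b 1 1 * b 0 1) + a i 1 * (b 1 1 * b 0 0 + b 0 1 * b 1 0) -
        2 * a i 2 * (b 1 0 * b 0 0),
      a i 0 * b 0 1 ^ 2 - a i 1 * (b 0 1 * b 0 0) + a i 2 * b 0 0 ^ 2]
  have hbb' : ∀ y, binaryLinears b (binaryLinears b' y) = D • y := fun y => by
    funext i
    fin_cases i <;> simp [binaryLinears, b', hD] <;> ring
  have hb'b : ∀ y, binaryLinears b' (binaryLinears b y) = D • y := fun y => by
    funext i
    fin_cases i <;> simp [binaryLinears, b', hD] <;> ring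
  have hc : ∀ y, binaryQuadratics c y = binaryQuadratics a (binaryLinears b' y) := fun y => by
    funext i
    simp [binaryQuadratics, binaryLinears, b', c]
    ring
  have hb'0 : ∀ y, y ≠ 0 → binaryLinears b' y ≠ 0 := fun y hy h0 => by
    have := hbb' y
    rw [h0] at this
    have h1 : binaryLinears b 0 = 0 := by
      funext i
      simp [binaryLinears]
    rw [h1] at this
    exact (smul_ne_zero hb hy) this.symm
  have hb0 : ∀ y, y ≠ 0 → binaryLinears b y ≠ 0 := fun y hy =>
    right_ne_zero_of_segreMap (hne y hy)
  refine ⟨c, fun y hy => ?_, ?_⟩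
  · rw [hc]
    exact left_ne_zero_of_segreMap (hne _ (hb'0 y hy))
  · rw [hT]
    ext P
    constructor
    · rintro ⟨y, hy, hr⟩
      refine ⟨binaryLinears b y, hb0 y hy, ?_⟩
      rw [hc, hb'b, binaryQuadratics_smul, segreMap_smul_left]
      exact hr.smul (pow_ne_zero 2 hb)
    · rintro ⟨y, hy, hr⟩
      refine ⟨binaryLinears b' y, hb'0 y hy, ?_⟩
      rw [hbb', ← hc, segreMap_smul_right]
      exact hr.smul hb

theorem isLinearGraph_of_forms {g : Matrix (Fin 4) (Fin 4) K} {T : Set (P3 K)}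
    (a b : Fin 2 → Fin 2 → K) (ha : a 0 0 * a 1 1 - a 0 1 * a 1 0 ≠ 0)
    (hb : b 0 0 * b 1 1 - b 0 1 * b 1 0 ≠ 0)
    (hT : T = {P | ∃ y, y ≠ 0 ∧
      Represents (segreMap g (binaryLinears a y) (binaryLinears b y)) P}) :
    IsLinearGraph g T := by
  set D := b 0 0 * b 1 1 - b 0 1 * b 1 0 with hD
  let b' : Fin 2 → Fin 2 → K := ![![b 1 1, -b 0 1], ![-b 1 0, b 0 0]]
  let c : Fin 2 → Fin 2 → K := fun i =>
    ![a i 0 * b 1 1 - a i 1 * b 1 0, -a i 0 * b 0 1 + a i 1 * b 0 0]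
  have hbb' : ∀ y, binaryLinears b (binaryLinears b' y) = D • y := fun y => by
    funext i
    fin_cases i <;> simp [binaryLinears, b', hD] <;> ring
  have hb'b : ∀ y, binaryLinears b' (binaryLinears b y) = D • y := fun y => by
    funext i
    fin_cases i <;> simp [binaryLinears, b', hD] <;> ring
  have hc : ∀ y, binaryLinears c y = binaryLinears a (binaryLinears b' y) := fun y => by
    funext i
    simp [binaryLinears, b', c]
    ring
  have h00 : ∀ d : Fin 2 → Fin 2 → K, binaryLinears d 0 = 0 := fun d => by
    funext i
    simp [binaryLinears]
  have hb'0 : ∀ y, y ≠ 0 → binaryLinears b' y ≠ 0 := fun y hy h0 => by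
    have := hbb' y
    rw [h0, h00] at this
    exact (smul_ne_zero hb hy) this.symm
  have hb0 : ∀ y, y ≠ 0 → binaryLinears b y ≠ 0 := fun y hy h0 => by
    have := hb'b y
    rw [h0, h00] at this
    exact (smul_ne_zero hb hy) this.symm
  refine ⟨c, ?_, ?_⟩
  · have : c 0 0 * c 1 1 - c 0 1 * c 1 0 = (a 0 0 * a 1 1 - a 0 1 * a 1 0) * D := by
      simp [c, hD]
      ring
    rw [this]
    exact mul_ne_zero ha hb
  · rw [hT]
    ext P
    constructor
    · rintro ⟨y, hy, hr⟩
      refine ⟨binaryLinears b y, hb0 y hy, ?_⟩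
      rw [hc, hb'b, binaryLinears_smul, segreMap_smul_left]
      exact hr.smul hb
    · rintro ⟨y, hy, hr⟩
      refine ⟨binaryLinears b' y, hb'0 y hy, ?_⟩
      rw [hbb', ← hc, segreMap_smul_right]
      exact hr.smul hb

end Graphs

/-! ### Twisted cubics on a smooth quadric -/

section Classification

open Polynomial

variable {K : Type*} [Field K]

theorem det_ne_zero_of_no_linear_relation {a : Fin 2 → K[X]} (ha : ∀ i, (a i).natDegree ≤ 1)
    (h : ∀ c d : K, C c * a 0 + C d * a 1 = 0 → c = 0 ∧ d = 0) :
    (a 0).coeff 0 * (a 1).coeff 1 - (a 0).coeff 1 * (a 1).coeff 0 ≠ 0 := by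
  intro h0
  have hrep : ∀ i, a i = C ((a i).coeff 1) * X + C ((a i).coeff 0) := fun i =>
    eq_X_add_C_of_natDegree_le_one (ha i)
  have e1 := h ((a 1).coeff 1) (-(a 0).coeff 1) (by
    rw [C_neg]
    have h0' := congrArg (C : K → K[X]) h0
    rw [C_sub, C_mul, C_mul, C_0] at h0'
    linear_combination C ((a 1).coeff 1) * hrep 0 - C ((a 0).coeff 1) * hrep 1 + h0')
  have e2 := h ((a 1).coeff 0) (-(a 0).coeff 0) (by
    rw [C_neg]
    have h0' := congrArg (C : K → K[X]) h0
    rw [C_sub, C_mul, C_mul, C_0] at h0'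
    linear_combination C ((a 1).coeff 0) * hrep 0 - C ((a 0).coeff 0) * hrep 1 - X * h0')
  have := hrep 0
  rw [neg_eq_zero.1 e1.2, neg_eq_zero.1 e2.2, C_0, zero_mul, zero_add] at this
  exact one_ne_zero (h 1 0 (by simp [this])).1

theorem rowPolynomial_mul_eq [Infinite K] {m : ℕ} {N : Matrix (Fin 4) (Fin m) K}
    (h : ∀ t : K, N.mulVec (fun k => t ^ (k : ℕ)) 0 * N.mulVec (fun k => t ^ (k : ℕ)) 3 -
      N.mulVec (fun k => t ^ (k : ℕ)) 1 * N.mulVec (fun k => t ^ (k : ℕ)) 2 = 0) :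
    rowPolynomial N 0 * rowPolynomial N 3 = rowPolynomial N 1 * rowPolynomial N 2 := by
  have he : ∀ i t, (rowPolynomial N i).eval t = N.mulVec (fun k => t ^ (k : ℕ)) i := fun i t => by
    simp [rowPolynomial, eval_finsetSum, Matrix.mulVec, dotProduct]
  apply Polynomial.funext
  intro t
  rw [eval_mul, eval_mul, he, he, he, he, ← sub_eq_zero]
  exact h t

theorem coeff_mul_of_natDegree_le {p q : K[X]} (hp : p.natDegree ≤ 2) (hq : q.natDegree ≤ 1) :
    (p * q).coeff 0 = p.coeff 0 * q.coeff 0 ∧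
    (p * q).coeff 1 = p.coeff 0 * q.coeff 1 + p.coeff 1 * q.coeff 0 ∧
    (p * q).coeff 2 = p.coeff 1 * q.coeff 1 + p.coeff 2 * q.coeff 0 ∧
    (p * q).coeff 3 = p.coeff 2 * q.coeff 1 := by
  have hp3 : p.coeff 3 = 0 := coeff_eq_zero_of_natDegree_lt (by omega)
  have hq2 : q.coeff 2 = 0 := coeff_eq_zero_of_natDegree_lt (by omega)
  have hq3 : q.coeff 3 = 0 := coeff_eq_zero_of_natDegree_lt (by omega)
  refine ⟨?_, ?_, ?_, ?_⟩ <;>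
    simp [coeff_mul, Finset.Nat.antidiagonal_succ, hp3, hq2, hq3]

/-- The projections to the two factors have positive degrees with sum 3, so one has degree 1 and the
other degree 2. Points with parameter [1:t] suffice to get the polynomial identity, since `K` is
infinite. -/
theorem IsTwistedCubic.isQuadraticGraph [Infinite K] {T : Set (P3 K)} (hT : IsTwistedCubic T)
    {g : Matrix (Fin 4) (Fin 4) K} (hg : g.det ≠ 0) (h : T ⊆ segreQuadric g) :
    IsQuadraticGraph g T ∨ IsQuadraticGraph (swapFactors g) T := by
  obtain ⟨M, hM, rfl⟩ := hT
  obtain ⟨N, rfl⟩ : ∃ N, M = g * N := ⟨g⁻¹ * M, by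
    rw [← mul_assoc, Matrix.mul_nonsing_inv _ hg.isUnit, one_mul]⟩
  have hN : N.det ≠ 0 := fun h0 => hM (by rw [Matrix.det_mul, h0, mul_zero])
  have hpow : ∀ t : K, (fun k : Fin 4 => t ^ (k : ℕ)) =
      ![1 ^ 3, 1 ^ 2 * t, 1 * t ^ 2, t ^ 3] := fun t => by
    funext k
    fin_cases k <;> simp
  have hdet := rowPolynomial_mul_eq (N := N) (fun t => by
    rw [hpow]
    have hne := mulVec_ne_zero hM (cubicVector_ne_zero (s := 1) (t := t) (Or.inl one_ne_zero))
    have hr := represents_mk hne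
    have hmem := h ⟨1, t, Or.inl one_ne_zero, hr⟩
    refine (represents_mulVec_mem_segreQuadric_iff hg ?_).1 hmem
    rw [Matrix.mulVec_mulVec]
    exact hr)
  obtain ⟨a, b, α, β, hαβ, hα, hβ, ha, hb, h0, h1, h2, h3, hA, hB⟩ :=
    exists_rowPolynomial_factorization (by norm_num) (mulVec_injective_of_det hN) hdet
  have hcoeff : ∀ (i : Fin 4) (k : Fin 4), N i k = (rowPolynomial N i).coeff k :=
    fun i k => (rowPolynomial_coeff N i k).symm
  have h4 : ∀ {y : Fin 2 → K}, y ≠ 0 →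
      (g * N).mulVec ![y 0 ^ 3, y 0 ^ 2 * y 1, y 0 * y 1 ^ 2, y 1 ^ 3] ≠ 0 := fun hy =>
    mulVec_ne_zero hM (cubicVector_ne_zero (coord_ne_zero hy))
  have hset : ∀ S : (Fin 2 → K) → Fin 4 → K,
      (∀ y, (g * N).mulVec ![y 0 ^ 3, y 0 ^ 2 * y 1, y 0 * y 1 ^ 2, y 1 ^ 3] = S y) →
      {P : P3 K | ∃ s t : K, (s ≠ 0 ∨ t ≠ 0) ∧
        Represents ((g * N).mulVec ![s ^ 3, s ^ 2 * t, s * t ^ 2, t ^ 3]) P} =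
      {P | ∃ y, y ≠ 0 ∧ Represents (S y) P} := fun S hS => by
    ext P
    constructor
    · rintro ⟨s, t, hst, hr⟩
      refine ⟨![s, t], pair_ne_zero_iff.2 hst, ?_⟩
      rw [← hS]
      exact hr
    · rintro ⟨y, hy, hr⟩
      refine ⟨y 0, y 1, coord_ne_zero hy, ?_⟩
      rw [hS]
      exact hr
  have hcases : (α = 2 ∧ β = 1) ∨ (α = 1 ∧ β = 2) := by omega
  rcases hcases with ⟨rfl, rfl⟩ | ⟨rfl, rfl⟩
  · left
    have key : ∀ y : Fin 2 → K, (g * N).mulVec ![y 0 ^ 3, y 0 ^ 2 * y 1, y 0 * y 1 ^ 2, y 1 ^ 3] =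
        segreMap g (binaryQuadratics (fun i k => (a i).coeff k) y)
          (binaryLinears (fun i k => (b i).coeff k) y) := fun y => by
      obtain ⟨p00, p01, p02, p03⟩ := coeff_mul_of_natDegree_le (ha 0) (hb 0)
      obtain ⟨p10, p11, p12, p13⟩ := coeff_mul_of_natDegree_le (ha 0) (hb 1)
      obtain ⟨p20, p21, p22, p23⟩ := coeff_mul_of_natDegree_le (ha 1) (hb 0)
      obtain ⟨p30, p31, p32, p33⟩ := coeff_mul_of_natDegree_le (ha 1) (hb 1)
      rw [← Matrix.mulVec_mulVec, segreMap]
      congr 1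
      funext i
      fin_cases i <;>
        simp [Matrix.mulVec, dotProduct, Fin.sum_univ_four, hcoeff, binaryQuadratics,
          binaryLinears, h0, h1, h2, h3, p00, p01, p02, p03, p10, p11, p12, p13, p20, p21, p22, p23, p30, p31, p32, p33] <;> ring
    refine isQuadraticGraph_of_forms _ _ (det_ne_zero_of_no_linear_relation hb hB)
      (fun y hy => ?_) (hset _ key)
    rw [← key]
    exact h4 hy
  · right
    have key : ∀ y : Fin 2 → K, (g * N).mulVec ![y 0 ^ 3, y 0 ^ 2 * y 1, y 0 * y 1 ^ 2, y 1 ^ 3] =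
        segreMap (swapFactors g) (binaryQuadratics (fun i k => (b i).coeff k) y)
          (binaryLinears (fun i k => (a i).coeff k) y) := fun y => by
      obtain ⟨p00, p01, p02, p03⟩ := coeff_mul_of_natDegree_le (hb 0) (ha 0)
      obtain ⟨p10, p11, p12, p13⟩ := coeff_mul_of_natDegree_le (hb 1) (ha 0)
      obtain ⟨p20, p21, p22, p23⟩ := coeff_mul_of_natDegree_le (hb 0) (ha 1)
      obtain ⟨p30, p31, p32, p33⟩ := coeff_mul_of_natDegree_le (hb 1) (ha 1)
      rw [← Matrix.mulVec_mulVec, segreMap_swapFactors, segreMap]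
      rw [mul_comm] at h0
      rw [mul_comm] at h1
      rw [mul_comm] at h2
      rw [mul_comm] at h3
      congr 1
      funext i
      fin_cases i <;>
        simp [Matrix.mulVec, dotProduct, Fin.sum_univ_four, hcoeff, binaryQuadratics,
          binaryLinears, h0, h1, h2, h3, p00, p01, p02, p03, p10, p11, p12, p13, p20, p21, p22, p23, p30, p31, p32, p33] <;> ring
    refine isQuadraticGraph_of_forms _ _ (det_ne_zero_of_no_linear_relation ha hA)
      (fun y hy => ?_) (hset _ key)
    rw [← key]
    exact h4 hy

end Classification

/-! ### Conics on a smooth quadric, and uniqueness of the cubics -/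

section ConicAndUniqueness

open Polynomial

variable {K : Type*} [Field K]

theorem coeff_mul_of_natDegree_le_one {p q : K[X]} (hp : p.natDegree ≤ 1) (hq : q.natDegree ≤ 1) :
    (p * q).coeff 0 = p.coeff 0 * q.coeff 0 ∧
    (p * q).coeff 1 = p.coeff 0 * q.coeff 1 + p.coeff 1 * q.coeff 0 ∧
    (p * q).coeff 2 = p.coeff 1 * q.coeff 1 := by
  have hp2 : p.coeff 2 = 0 := coeff_eq_zero_of_natDegree_lt (by omega)
  have hq2 : q.coeff 2 = 0 := coeff_eq_zero_of_natDegree_lt (by omega)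
  refine ⟨?_, ?_, ?_⟩ <;>
    simp [coeff_mul, Finset.Nat.antidiagonal_succ, hp2, hq2]

theorem conicVector_ne_zero {s t : K} (h : s ≠ 0 ∨ t ≠ 0) :
    (![s ^ 2, s * t, t ^ 2] : Fin 3 → K) ≠ 0 := by
  intro h0
  have h1 := congrFun h0 0
  have h2 := congrFun h0 2
  simp at h1 h2
  exact h.elim (fun h => h h1) (fun h => h h2)

/-- Both projections have positive degree and the degrees sum to 2. -/
theorem conic_isLinearGraph [Infinite K] {A : Matrix (Fin 4) (Fin 3) K}
    (hA : Function.Injective A.mulVec) {g : Matrix (Fin 4) (Fin 4) K} (hg : g.det ≠ 0)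
    (h : conic A ⊆ segreQuadric g) : IsLinearGraph g (conic A) := by
  obtain ⟨N, rfl⟩ : ∃ N, A = g * N := ⟨g⁻¹ * A, by
    rw [← Matrix.mul_assoc, Matrix.mul_nonsing_inv _ hg.isUnit, Matrix.one_mul]⟩
  have hN : Function.Injective N.mulVec := fun u u' huu' => hA (by
    rw [← Matrix.mulVec_mulVec, ← Matrix.mulVec_mulVec, huu'])
  have hpow : ∀ t : K, (fun k : Fin 3 => t ^ (k : ℕ)) = ![1 ^ 2, 1 * t, t ^ 2] := fun t => by
    funext k
    fin_cases k <;> simp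
  have hdet := rowPolynomial_mul_eq (N := N) (fun t => by
    rw [hpow]
    have hne : (g * N).mulVec ![1 ^ 2, 1 * t, t ^ 2] ≠ 0 := fun h0 =>
      conicVector_ne_zero (Or.inl one_ne_zero) (hA (h0.trans (Matrix.mulVec_zero _).symm))
    have hr := represents_mk hne
    have hmem := h ⟨1, t, Or.inl one_ne_zero, hr⟩
    refine (represents_mulVec_mem_segreQuadric_iff hg ?_).1 hmem
    rw [Matrix.mulVec_mulVec]
    exact hr)
  obtain ⟨a, b, α, β, hαβ, hα, hβ, ha, hb, h0, h1, h2, h3, hA', hB'⟩ :=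
    exists_rowPolynomial_factorization le_rfl hN hdet
  have hcoeff : ∀ (i : Fin 4) (k : Fin 3), N i k = (rowPolynomial N i).coeff k :=
    fun i k => (rowPolynomial_coeff N i k).symm
  obtain ⟨rfl, rfl⟩ : α = 1 ∧ β = 1 := by omega
  have key : ∀ y : Fin 2 → K, (g * N).mulVec ![y 0 ^ 2, y 0 * y 1, y 1 ^ 2] =
      segreMap g (binaryLinears (fun i k => (a i).coeff k) y)
        (binaryLinears (fun i k => (b i).coeff k) y) := fun y => by
    obtain ⟨p00, p01, p02⟩ := coeff_mul_of_natDegree_le_one (ha 0) (hb 0)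
    obtain ⟨p10, p11, p12⟩ := coeff_mul_of_natDegree_le_one (ha 0) (hb 1)
    obtain ⟨p20, p21, p22⟩ := coeff_mul_of_natDegree_le_one (ha 1) (hb 0)
    obtain ⟨p30, p31, p32⟩ := coeff_mul_of_natDegree_le_one (ha 1) (hb 1)
    rw [← Matrix.mulVec_mulVec, segreMap]
    congr 1
    funext i
    fin_cases i <;>
      simp [Matrix.mulVec, dotProduct, Fin.sum_univ_three, hcoeff, binaryLinears, h0, h1, h2, h3,
        p00, p01, p02, p10, p11, p12, p20, p21, p22, p30, p31, p32] <;> ring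
  refine isLinearGraph_of_forms (fun i k => (a i).coeff k) (fun i k => (b i).coeff k)
    (det_ne_zero_of_no_linear_relation ha hA')
    (det_ne_zero_of_no_linear_relation hb hB') ?_
  ext P
  constructor
  · rintro ⟨s, t, hst, hr⟩
    refine ⟨![s, t], pair_ne_zero_iff.2 hst, ?_⟩
    rw [← key]
    exact hr
  · rintro ⟨y, hy, hr⟩
    refine ⟨y 0, y 1, coord_ne_zero hy, ?_⟩
    rw [key]
    exact hr

/-- Two quadratic graphs through five points on distinct rulings coincide. -/
theorem IsQuadraticGraph.unique {g : Matrix (Fin 4) (Fin 4) K} (hg : g.det ≠ 0)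
    {v : Fin 5 → Fin 4 → K}
    (hv : ∀ i j, i ≠ j → ∀ x x' y, v i = segreMap g x y → v j ≠ segreMap g x' y)
    {T T' : Set (P3 K)} (hT : IsQuadraticGraph g T) (hT' : IsQuadraticGraph g T')
    (hTv : PassesThrough T v) (hTv' : PassesThrough T' v) : T = T' := by
  obtain ⟨c, hc, rfl⟩ := hT
  obtain ⟨c', hc', rfl⟩ := hT'
  have hpt : ∀ i, ∃ y x : Fin 2 → K, y ≠ 0 ∧ v i = segreMap g x y ∧
      binaryQuadratics c y 0 * binaryQuadratics c' y 1 =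
        binaryQuadratics c' y 0 * binaryQuadratics c y 1 := fun i => by
    obtain ⟨P, ⟨y, hy, hr⟩, hrep⟩ := hTv i
    obtain ⟨P', ⟨y', hy', hr'⟩, hrep'⟩ := hTv' i
    obtain ⟨a, ha, e⟩ := exists_smul_ne_zero_of_represents hr hrep
    obtain ⟨a', ha', e'⟩ := exists_smul_ne_zero_of_represents hr' hrep'
    rw [← segreMap_smul_left] at e e'
    obtain ⟨b, hb, rfl, hx⟩ := segreMap_injective hg (e.symm.trans e') (e ▸ hrep.ne_zero)
    rw [binaryQuadratics_smul] at hx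
    refine ⟨y, _, hy, e, ?_⟩
    have h0 := congrFun hx 0
    have h1 := congrFun hx 1
    simp only [Pi.smul_apply, smul_eq_mul] at h0 h1
    apply mul_left_cancel₀ ha
    linear_combination binaryQuadratics c' y 1 * h0 - binaryQuadratics c' y 0 * h1
  choose y x hy hvx hcross using hpt
  -- The two quadratic maps agree where the quartic q₀q₁' - q₀'q₁ vanishes. The five points give
  -- five zeros, distinct because the points have distinct second coordinates by `hv`.
  obtain ⟨k0, k1, k2, k3, k4⟩ := quartic_eq_zero
    (c 0 0 * c' 1 0 - c' 0 0 * c 1 0)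
    (c 0 0 * c' 1 1 + c 0 1 * c' 1 0 - c' 0 0 * c 1 1 - c' 0 1 * c 1 0)
    (c 0 0 * c' 1 2 + c 0 1 * c' 1 1 + c 0 2 * c' 1 0 -
      c' 0 0 * c 1 2 - c' 0 1 * c 1 1 - c' 0 2 * c 1 0)
    (c 0 1 * c' 1 2 + c 0 2 * c' 1 1 - c' 0 1 * c 1 2 - c' 0 2 * c 1 1)
    (c 0 2 * c' 1 2 - c' 0 2 * c 1 2) (fun i => y i 0) (fun i => y i 1)
    (fun i j hij he => by
      obtain ⟨a, ha, e⟩ := exists_smul_of_cross_eq (hy i) (hy j) he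
      refine hv i j hij (x i) (a • x j) (y i) (hvx i) ?_
      rw [hvx j, e, segreMap_smul_left, segreMap_smul_right])
    (fun i => by
      have := hcross i
      simp only [binaryQuadratics] at this
      linear_combination this)
  have hall : ∀ z, binaryQuadratics c z 0 * binaryQuadratics c' z 1 =
      binaryQuadratics c' z 0 * binaryQuadratics c z 1 := fun z => by
    simp only [binaryQuadratics]
    linear_combination z 0 ^ 4 * k0 + z 0 ^ 3 * z 1 * k1 + z 0 ^ 2 * z 1 ^ 2 * k2 +
      z 0 * z 1 ^ 3 * k3 + z 1 ^ 4 * k4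
  ext P
  constructor
  · rintro ⟨z, hz, hr⟩
    obtain ⟨a, ha, e⟩ := exists_smul_of_cross_eq (hc z hz) (hc' z hz) (hall z)
    refine ⟨z, hz, ?_⟩
    rw [e, segreMap_smul_left]
    exact hr.smul ha
  · rintro ⟨z, hz, hr⟩
    obtain ⟨a, ha, e⟩ := exists_smul_of_cross_eq (hc' z hz) (hc z hz) (hall z).symm
    refine ⟨z, hz, ?_⟩
    rw [e, segreMap_smul_left]
    exact hr.smul ha

/-- Points with a common second coordinate span a line of the quadric (or coincide), and there the
polar form vanishes. -/
theorem ne_segreMap_of_polar_ne_zero {g : Matrix (Fin 4) (Fin 4) K}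
    {q : QuadraticForm K (Fin 4 → K)} (hq : ∀ x y, q (segreMap g x y) = 0) {w w' : Fin 4 → K}
    (h : QuadraticMap.polar q w w' ≠ 0) (x x' y : Fin 2 → K) (hw : w = segreMap g x y) :
    w' ≠ segreMap g x' y := by
  rintro rfl
  subst hw
  apply h
  rw [QuadraticMap.polar, ← segreMap_add_left, hq, hq, hq]
  simp

end ConicAndUniqueness

/-! ### Irreducible bihomogeneous equations of the graphs -/

section Bidegree

open MvPolynomial

variable {K : Type*} [Field K] {σ : Type*}

/-- A linear form in two of the variables. -/
noncomputable def linearPoly (m : Fin 2 → K) (j : Fin 2 → σ) : MvPolynomial σ K :=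
  C (m 0) * X (j 0) + C (m 1) * X (j 1)

theorem eval_linearPoly (m : Fin 2 → K) (j : Fin 2 → σ) (z : σ → K) :
    eval z (linearPoly m j) = m 0 * z (j 0) + m 1 * z (j 1) := by
  simp [linearPoly]

theorem notMem_vars_C_mul_X [DecidableEq σ] (a : K) {i j : σ} (h : i ≠ j) :
    i ∉ (C a * X j : MvPolynomial σ K).vars := by
  intro hi
  have := vars_mul _ _ hi
  simp [h] at this

theorem notMem_vars_linearPoly [DecidableEq σ] (m : Fin 2 → K) {i : σ} {j : Fin 2 → σ}
    (h0 : i ≠ j 0) (h1 : i ≠ j 1) : i ∉ (linearPoly m j).vars := by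
  intro hi
  rcases Finset.mem_union.1 (vars_add_subset _ _ hi) with h | h
  · exact notMem_vars_C_mul_X _ h0 h
  · exact notMem_vars_C_mul_X _ h1 h

theorem notMem_vars_mul [DecidableEq σ] {p q : MvPolynomial σ K} {i : σ} (hp : i ∉ p.vars)
    (hq : i ∉ q.vars) : i ∉ (p * q).vars := fun h =>
  (Finset.mem_union.1 (vars_mul _ _ h)).elim hp hq

theorem irreducible_linearPoly {m : Fin 2 → K} (hm : m ≠ 0) {j : Fin 2 → σ} (hj : j 0 ≠ j 1) :
    Irreducible (linearPoly m j) := by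
  classical
  rcases coord_ne_zero hm with h | h
  · refine irreducible_mul_X_add _ _ _ (by simpa using h) (by simp) (notMem_vars_C_mul_X _ hj) ?_
    exact ((isUnit_iff_ne_zero.2 h).map C).isRelPrime_left
  · rw [linearPoly, add_comm]
    refine irreducible_mul_X_add _ _ _ (by simpa using h) (by simp)
      (notMem_vars_C_mul_X _ hj.symm) ?_
    exact ((isUnit_iff_ne_zero.2 h).map C).isRelPrime_left

theorem isRelPrime_linearPoly {m : Fin 2 → K} (hm : m ≠ 0) {j : Fin 2 → σ} (hj : j 0 ≠ j 1)
    {p : MvPolynomial σ K} {z : σ → K} (hz : eval z (linearPoly m j) = 0) (hp : eval z p ≠ 0) :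
    IsRelPrime (linearPoly m j) p := by
  rw [(irreducible_linearPoly hm hj).isRelPrime_iff_not_dvd]
  rintro ⟨r, rfl⟩
  apply hp
  rw [map_mul, hz, zero_mul]

/-- With linear factors at hand, coprimality of two binary quadratic forms can be tested at points.
-/
theorem exists_factor_binaryQuadratic [IsAlgClosed K] (c : Fin 3 → K) :
    ∃ m m' : Fin 2 → K, ∀ s t : K, c 0 * s ^ 2 + c 1 * (s * t) + c 2 * t ^ 2 =
      (m 0 * s + m 1 * t) * (m' 0 * s + m' 1 * t) := by
  by_cases h0 : c 0 = 0
  · refine ⟨![0, 1], ![c 1, c 2], fun s t => ?_⟩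
    simp [h0]
    ring
  · obtain ⟨r, hr⟩ : ∃ r, c 0 * r ^ 2 + c 1 * r + c 2 = 0 := by
      have hdeg : (Polynomial.C (c 0) * Polynomial.X ^ 2 + Polynomial.C (c 1) * Polynomial.X +
          Polynomial.C (c 2)).degree = 2 := Polynomial.degree_quadratic h0
      obtain ⟨r, hr⟩ := IsAlgClosed.exists_root _ (by rw [hdeg]; decide)
      exact ⟨r, by simpa [Polynomial.IsRoot] using hr⟩
    refine ⟨![1, -r], ![c 0, c 1 + c 0 * r], fun s t => ?_⟩
    simp
    linear_combination t ^ 2 * hr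

/-- The equation `x₀ q₁(y) - x₁ q₀(y)` of a graph, with `q₀` and `q₁` given by linear factors. -/
noncomputable def graphPoly (i j : Fin 2 → σ) (l l' m m' : Fin 2 → K) : MvPolynomial σ K :=
  linearPoly m j * linearPoly m' j * X (i 0) + -(X (i 1) * (linearPoly l j * linearPoly l' j))

/-- The polynomial has degree one in the variable `i 0`, so it is irreducible once its two
coefficients are coprime. The hypotheses say that neither `m` nor `m'` has a common zero with `l` or
`l'`. -/
theorem irreducible_graphPoly {i j : Fin 2 → σ} (hij : Function.Injective (Sum.elim i j))
    {l l' m m' : Fin 2 → K} (hm : m ≠ 0) (hm' : m' ≠ 0)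
    (h : (l 0 * m 1 - l 1 * m 0) * (l' 0 * m 1 - l' 1 * m 0) ≠ 0)
    (h' : (l 0 * m' 1 - l 1 * m' 0) * (l' 0 * m' 1 - l' 1 * m' 0) ≠ 0) :
    Irreducible (graphPoly i j l l' m m') := by
  classical
  have ne : ∀ a b, a ≠ b → Sum.elim i j a ≠ Sum.elim i j b := fun a b h e => h (hij e)
  have hj : j 0 ≠ j 1 := ne (Sum.inr 0) (Sum.inr 1) (by simp)
  have h00 : i 0 ≠ j 0 := ne (Sum.inl 0) (Sum.inr 0) (by simp)
  have h01 : i 0 ≠ j 1 := ne (Sum.inl 0) (Sum.inr 1) (by simp)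
  have h10 : i 1 ≠ j 0 := ne (Sum.inl 1) (Sum.inr 0) (by simp)
  have h11 : i 1 ≠ j 1 := ne (Sum.inl 1) (Sum.inr 1) (by simp)
  have hi : i 0 ≠ i 1 := ne (Sum.inl 0) (Sum.inl 1) (by simp)
  have hrel : ∀ n : Fin 2 → K, n ≠ 0 →
      (l 0 * n 1 - l 1 * n 0) * (l' 0 * n 1 - l' 1 * n 0) ≠ 0 →
      IsRelPrime (linearPoly n j) (-(X (i 1) * (linearPoly l j * linearPoly l' j))) := by
    intro n hn hln
    -- A zero of the linear form `n` at which the other coefficient does not vanish.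
    let z : σ → K := fun a => if a = j 0 then n 1 else if a = j 1 then -n 0 else 1
    have z0 : z (j 0) = n 1 := by simp [z]
    have z1 : z (j 1) = -n 0 := by simp [z, hj.symm]
    have zi : z (i 1) = 1 := by simp [z, h10, h11]
    refine isRelPrime_linearPoly hn hj (z := z) ?_ ?_
    · rw [eval_linearPoly, z0, z1]
      ring
    · rw [map_neg, map_mul, map_mul, eval_linearPoly, eval_linearPoly, eval_X, z0, z1, zi]
      refine neg_ne_zero.2 ?_
      convert hln using 1
      ring
  refine irreducible_mul_X_add _ _ _ (mul_ne_zero (irreducible_linearPoly hm hj).ne_zero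
    (irreducible_linearPoly hm' hj).ne_zero)
    (notMem_vars_mul (notMem_vars_linearPoly _ h00 h01) (notMem_vars_linearPoly _ h00 h01)) ?_
    ((hrel m hm h).mul_left (hrel m' hm' h'))
  rw [vars_neg]
  exact notMem_vars_mul (by simpa using hi)
    (notMem_vars_mul (notMem_vars_linearPoly _ h00 h01) (notMem_vars_linearPoly _ h00 h01))

theorem eval_graphPoly (i j : Fin 2 → σ) (l l' m m' : Fin 2 → K) (z : σ → K) :
    eval z (graphPoly i j l l' m m') =
      z (i 0) * ((m 0 * z (j 0) + m 1 * z (j 1)) * (m' 0 * z (j 0) + m' 1 * z (j 1))) -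
      z (i 1) * ((l 0 * z (j 0) + l 1 * z (j 1)) * (l' 0 * z (j 0) + l' 1 * z (j 1))) := by
  simp [graphPoly, eval_linearPoly]
  ring

theorem isWeightedHomogeneous_linearPoly (w : σ → ℕ) (m : Fin 2 → K) {j : Fin 2 → σ} {b : ℕ}
    (hw : ∀ k, w (j k) = b) : IsWeightedHomogeneous w (linearPoly m j) b := by
  have h : ∀ k, IsWeightedHomogeneous w (C (m k) * X (j k) : MvPolynomial σ K) b := fun k => by
    have := (isWeightedHomogeneous_X K w (j k)).C_mul (m k)
    rwa [hw] at this
  exact (h 0).add (h 1)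

theorem isWeightedHomogeneous_graphPoly (w : σ → ℕ) (l l' m m' : Fin 2 → K) {i j : Fin 2 → σ}
    {a b : ℕ} (ha : ∀ k, w (i k) = a) (hb : ∀ k, w (j k) = b) :
    IsWeightedHomogeneous w (graphPoly i j l l' m m') (a + 2 * b) := by
  have hX : ∀ k, IsWeightedHomogeneous w (X (i k) : MvPolynomial σ K) a := fun k => by
    have := isWeightedHomogeneous_X K w (i k)
    rwa [ha] at this
  have h1 := ((isWeightedHomogeneous_linearPoly w m hb).mul
    (isWeightedHomogeneous_linearPoly w m' hb)).mul (hX 0)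
  have h2 := ((hX 1).mul ((isWeightedHomogeneous_linearPoly w l hb).mul
    (isWeightedHomogeneous_linearPoly w l' hb))).neg
  rw [show b + b + a = a + 2 * b by ring] at h1
  rw [show a + (b + b) = a + 2 * b by ring] at h2
  exact h1.add h2

theorem IsLinearGraph.hasBidegree {g : Matrix (Fin 4) (Fin 4) K} {T : Set (P3 K)}
    (hT : IsLinearGraph g T) : HasBidegree g T 1 1 := by
  classical
  obtain ⟨c, hc, rfl⟩ := hT
  let j : Fin 2 → Fin 2 ⊕ Fin 2 := Sum.inr
  let G : MvPolynomial (Fin 2 ⊕ Fin 2) K :=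
    linearPoly (c 1) j * X (Sum.inl 0) + -(X (Sum.inl 1) * linearPoly (c 0) j)
  have hj : j 0 ≠ j 1 := by simp [j]
  have hc1 : c 1 ≠ 0 := by
    intro h
    simp [h] at hc
  have hG : ∀ x y, eval (Sum.elim x y) G =
      x 0 * (c 1 0 * y 0 + c 1 1 * y 1) - x 1 * (c 0 0 * y 0 + c 0 1 * y 1) := fun x y => by
    simp [G, eval_linearPoly, j]
    ring
  have hX : ∀ (w : Fin 2 ⊕ Fin 2 → ℕ) (a : ℕ) (k : Fin 2), w (Sum.inl k) = a →
      IsWeightedHomogeneous w (X (Sum.inl k) : MvPolynomial (Fin 2 ⊕ Fin 2) K) a := by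
    rintro w a k rfl
    exact isWeightedHomogeneous_X K w _
  have hGw : ∀ (w : Fin 2 ⊕ Fin 2 → ℕ) (a b : ℕ), (∀ k, w (Sum.inl k) = a) →
      (∀ k, w (Sum.inr k) = b) → IsWeightedHomogeneous w G (a + b) := fun w a b ha hb => by
    have h1 := (isWeightedHomogeneous_linearPoly (K := K) w (c 1) (j := j) hb).mul (hX w a 0 (ha 0))
    rw [add_comm] at h1
    exact h1.add
      ((hX w a 1 (ha 1)).mul (isWeightedHomogeneous_linearPoly w (c 0) (j := j) hb)).neg
  refine ⟨G, ?_, hGw _ 1 0 (fun _ => rfl) (fun _ => rfl), hGw _ 0 1 (fun _ => rfl) (fun _ => rfl),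
    ?_⟩
  · refine irreducible_mul_X_add _ _ _ (irreducible_linearPoly hc1 hj).ne_zero
      (notMem_vars_linearPoly _ (by simp [j]) (by simp [j])) ?_
      (isRelPrime_linearPoly hc1 hj (z := Sum.elim (fun _ => 1) ![c 1 1, -c 1 0]) ?_ ?_)
    · rw [vars_neg]
      exact notMem_vars_mul (by simp) (notMem_vars_linearPoly _ (by simp [j]) (by simp [j]))
    · rw [eval_linearPoly]
      simp [j]
      ring
    · rw [map_neg, map_mul, eval_linearPoly, neg_ne_zero]
      simp [j]
      intro h
      apply hc
      linear_combination h
  · ext P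
    constructor
    · rintro ⟨y, hy, hr⟩
      refine ⟨_, y, left_ne_zero_of_segreMap hr.ne_zero, hy, ?_, hr⟩
      rw [hG]
      simp only [binaryLinears]
      ring
    · rintro ⟨x, y, hx, hy, he, hr⟩
      rw [hG] at he
      have hl : binaryLinears c y ≠ 0 := by
        intro h0
        have h1 := congrFun h0 0
        have h2 := congrFun h0 1
        simp only [binaryLinears, Pi.zero_apply] at h1 h2
        apply hy
        have k0 : (c 0 0 * c 1 1 - c 0 1 * c 1 0) * y 0 = 0 := by
          linear_combination c 1 1 * h1 - c 0 1 * h2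
        have k1 : (c 0 0 * c 1 1 - c 0 1 * c 1 0) * y 1 = 0 := by
          linear_combination c 0 0 * h2 - c 1 0 * h1
        funext i
        fin_cases i
        exacts [(mul_eq_zero.1 k0).resolve_left hc, (mul_eq_zero.1 k1).resolve_left hc]
      obtain ⟨a, ha, e⟩ := exists_smul_of_cross_eq hx hl (by
        simp only [binaryLinears]
        linear_combination he)
      refine ⟨y, hy, ?_⟩
      rw [e, segreMap_smul_left]
      exact hr.smul ha

variable [IsAlgClosed K]

/-- The roles of the variables `i` and `j` are left free so that the same equation serves for both
bidegrees. Irreducibility comes from the two components of the graph having no common zero. -/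
theorem IsQuadraticGraph.exists_graphPoly {g : Matrix (Fin 4) (Fin 4) K} {T : Set (P3 K)}
    (hT : IsQuadraticGraph g T) {i j : Fin 2 → σ} (hij : Function.Injective (Sum.elim i j)) :
    ∃ l l' m m' : Fin 2 → K, Irreducible (graphPoly i j l l' m m') ∧
      T = {P | ∃ x y : Fin 2 → K, x ≠ 0 ∧ y ≠ 0 ∧
        x 0 * ((m 0 * y 0 + m 1 * y 1) * (m' 0 * y 0 + m' 1 * y 1)) -
        x 1 * ((l 0 * y 0 + l 1 * y 1) * (l' 0 * y 0 + l' 1 * y 1)) = 0 ∧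
        Represents (segreMap g x y) P} := by
  obtain ⟨c, hc, rfl⟩ := hT
  obtain ⟨l, l', hl⟩ := exists_factor_binaryQuadratic (c 0)
  obtain ⟨m, m', hm⟩ := exists_factor_binaryQuadratic (c 1)
  have hl' : ∀ y, binaryQuadratics c y 0 =
    (l 0 * y 0 + l 1 * y 1) * (l' 0 * y 0 + l' 1 * y 1) := fun y => hl _ _
  have hm' : ∀ y, binaryQuadratics c y 1 =
    (m 0 * y 0 + m 1 * y 1) * (m' 0 * y 0 + m' 1 * y 1) := fun y => hm _ _
  have hne : ∀ y : Fin 2 → K, y ≠ 0 → (l 0 * y 0 + l 1 * y 1) * (l' 0 * y 0 + l' 1 * y 1) = 0 →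
      (m 0 * y 0 + m 1 * y 1) * (m' 0 * y 0 + m' 1 * y 1) ≠ 0 := fun y hy h1 h2 => by
    apply hc y hy
    funext k
    fin_cases k
    · exact (hl' y).trans h1
    · exact (hm' y).trans h2
  -- At a zero of `l` the product of `m` and `m'` cannot vanish, so neither of them is the zero
  -- form.
  have hzero : ∃ y : Fin 2 → K, y ≠ 0 ∧ l 0 * y 0 + l 1 * y 1 = 0 := by
    by_cases h : l = 0
    · exact ⟨![1, 0], fun h0 => one_ne_zero (congrFun h0 0), by simp [h]⟩
    · refine ⟨![l 1, -l 0], pair_ne_zero_iff.2 ?_, by simp; ring⟩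
      have := coord_ne_zero h
      simpa [or_comm] using this
  obtain ⟨y, hy, hy0⟩ := hzero
  have hmm := hne y hy (by rw [hy0, zero_mul])
  have hm0 : m ≠ 0 := by
    rintro rfl
    simp at hmm
  have hm0' : m' ≠ 0 := by
    rintro rfl
    simp at hmm
  refine ⟨l, l', m, m', irreducible_graphPoly hij hm0 hm0' (fun h0 => ?_) (fun h0 => ?_), ?_⟩
  · refine hne ![m 1, -m 0] (pair_ne_zero_iff.2 ?_) ?_ ?_
    · have := coord_ne_zero hm0
      simpa [or_comm] using this
    · simp
      rw [← mul_eq_zero, ← h0]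
      ring
    · simp
      left
      ring
  · refine hne ![m' 1, -m' 0] (pair_ne_zero_iff.2 ?_) ?_ ?_
    · have := coord_ne_zero hm0'
      simpa [or_comm] using this
    · simp
      rw [← mul_eq_zero, ← h0]
      ring
    · simp
      right
      ring
  · ext P
    constructor
    · rintro ⟨y, hy, hr⟩
      refine ⟨_, y, hc y hy, hy, ?_, hr⟩
      rw [← hl', ← hm']
      ring
    · rintro ⟨x, y, hx, hy, he, hr⟩
      rw [← hl', ← hm'] at he
      obtain ⟨a, ha, e⟩ := exists_smul_of_cross_eq hx (hc y hy) (by linear_combination he)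
      refine ⟨y, hy, ?_⟩
      rw [e, segreMap_smul_left]
      exact hr.smul ha

theorem IsQuadraticGraph.hasBidegree {g : Matrix (Fin 4) (Fin 4) K} {T : Set (P3 K)}
    (hT : IsQuadraticGraph g T) : HasBidegree g T 1 2 := by
  obtain ⟨l, l', m, m', hirr, rfl⟩ := hT.exists_graphPoly (i := (Sum.inl : Fin 2 → Fin 2 ⊕ Fin 2))
    (j := (Sum.inr : Fin 2 → Fin 2 ⊕ Fin 2)) (by simpa using Function.injective_id)
  refine ⟨_, hirr, ?_, ?_, ?_⟩
  · exact isWeightedHomogeneous_graphPoly _ l l' m m' (a := 1) (b := 0) (fun _ => rfl) (fun _ => rfl)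
  · exact isWeightedHomogeneous_graphPoly _ l l' m m' (a := 0) (b := 1) (fun _ => rfl) (fun _ => rfl)
  · simp only [eval_graphPoly, Sum.elim_inl, Sum.elim_inr]

theorem IsQuadraticGraph.hasBidegree_swap {g : Matrix (Fin 4) (Fin 4) K} {T : Set (P3 K)}
    (hT : IsQuadraticGraph (swapFactors g) T) : HasBidegree g T 2 1 := by
  obtain ⟨l, l', m, m', hirr, rfl⟩ := hT.exists_graphPoly (i := (Sum.inr : Fin 2 → Fin 2 ⊕ Fin 2))
    (j := (Sum.inl : Fin 2 → Fin 2 ⊕ Fin 2)) Sum.swap_leftInverse.injective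
  refine ⟨_, hirr, ?_, ?_, ?_⟩
  · exact isWeightedHomogeneous_graphPoly _ l l' m m' (a := 0) (b := 1) (fun _ => rfl) (fun _ => rfl)
  · exact isWeightedHomogeneous_graphPoly _ l l' m m' (a := 1) (b := 0) (fun _ => rfl) (fun _ => rfl)
  · simp only [eval_graphPoly, Sum.elim_inl, Sum.elim_inr, segreMap_swapFactors]
    ext P
    constructor
    · rintro ⟨x, y, hx, hy, h⟩
      exact ⟨y, x, hy, hx, h⟩
    · rintro ⟨x, y, hx, hy, h⟩
      exact ⟨y, x, hy, hx, h⟩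

end Bidegree

/-! ### From a trisecant cubic to a quadric -/

section Trisecant

open MvPolynomial

variable {K : Type*} [Field K]

/-- The quadrics that contain the standard twisted cubic. -/
noncomputable def netQuadric (c : Fin 3 → K) : MvPolynomial (Fin 4) K :=
  C (c 0) * (X 0 * X 2 - X 1 ^ 2) + C (c 1) * (X 0 * X 3 - X 1 * X 2) +
    C (c 2) * (X 1 * X 3 - X 2 ^ 2)

theorem netQuadric_isHomogeneous (c : Fin 3 → K) : (netQuadric c).IsHomogeneous 2 := by
  have hX : ∀ i j : Fin 4, (X i * X j : MvPolynomial (Fin 4) K).IsHomogeneous 2 := fun i j =>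
    (isHomogeneous_X K i).mul (isHomogeneous_X K j)
  have hX2 : ∀ i : Fin 4, (X i ^ 2 : MvPolynomial (Fin 4) K).IsHomogeneous 2 := fun i =>
    isHomogeneous_X_pow i 2
  exact ((((hX _ _).sub (hX2 _)).C_mul _).add (((hX _ _).sub (hX _ _)).C_mul _)).add
    (((hX _ _).sub (hX2 _)).C_mul _)

theorem eval_netQuadric (c : Fin 3 → K) (x : Fin 4 → K) :
    eval x (netQuadric c) = c 0 * (x 0 * x 2 - x 1 ^ 2) + c 1 * (x 0 * x 3 - x 1 * x 2) +
      c 2 * (x 1 * x 3 - x 2 ^ 2) := by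
  simp [netQuadric]

/-- Provides a parameter [1:r] different from finitely many given points of ℙ¹. -/
theorem exists_ratio_notMem [Infinite K] {n : ℕ} (s t : Fin n → K) (hst : ∀ i, s i ≠ 0 ∨ t i ≠ 0) :
    ∃ r : K, ∀ i, s i * r ≠ t i := by
  classical
  obtain ⟨r, hr⟩ := Infinite.exists_notMem_finset (Finset.univ.image fun i => t i / s i)
  refine ⟨r, fun i h => ?_⟩
  by_cases hs : s i = 0
  · rw [hs, zero_mul] at h
    exact (hst i).elim (fun h' => h' hs) (fun h' => h' h.symm)
  · apply hr
    refine Finset.mem_image.2 ⟨i, Finset.mem_univ _, ?_⟩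
    rw [← h]
    field_simp

theorem not_cross_eq_of_conic_ne {A : Matrix (Fin 4) (Fin 3) K} {s t s' t' : K} {P P' : P3 K}
    (hst : s ≠ 0 ∨ t ≠ 0) (hst' : s' ≠ 0 ∨ t' ≠ 0)
    (h : Represents (A.mulVec ![s ^ 2, s * t, t ^ 2]) P)
    (h' : Represents (A.mulVec ![s' ^ 2, s' * t', t' ^ 2]) P') (hP : P ≠ P') :
    s * t' ≠ s' * t := by
  intro e
  obtain ⟨a, ha, rfl, rfl⟩ := exists_smul_of_mul_eq hst hst' e
  apply hP
  refine (h.smul (pow_ne_zero 2 ha)).unique ?_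
  rw [← Matrix.mulVec_smul]
  convert h' using 2
  funext i
  fin_cases i <;> simp <;> ring

/-- A twisted cubic that meets a conic in three points lies on a common quadric. -/
theorem IsTrisecantCubic.exists_quadric [Infinite K] {T : Set (P3 K)}
    {A : Matrix (Fin 4) (Fin 3) K} {v : Fin 5 → Fin 4 → K} (hT : IsTrisecantCubic T A v) :
    ∃ Q, IsQuadricThrough Q A v ∧ T ⊆ quadricLocus Q := by
  obtain ⟨⟨M, hM, rfl⟩, hv, h3⟩ := hT
  obtain ⟨P0, P1, P2, h01, h02, h12, hS⟩ := Set.ncard_eq_three.1 h3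
  have hmem : ∀ i, ![P0, P1, P2] i ∈ {P : P3 K | ∃ s t : K, (s ≠ 0 ∨ t ≠ 0) ∧
      Represents (M.mulVec ![s ^ 3, s ^ 2 * t, s * t ^ 2, t ^ 3]) P} ∩ conic A := by
    intro i
    rw [hS]
    fin_cases i <;> simp
  choose s t hst hrep using fun i => (hmem i).2
  obtain ⟨r, hr⟩ := exists_ratio_notMem s t hst
  -- Adding [1:r] to the list makes the second new parameter differ from the first.
  obtain ⟨r', hr'⟩ := exists_ratio_notMem ![s 0, s 1, s 2, 1] ![t 0, t 1, t 2, r] (by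
    intro i
    fin_cases i
    exacts [hst 0, hst 1, hst 2, Or.inl one_ne_zero])
  have k0 := hr' 0
  have k1 := hr' 1
  have k2 := hr' 2
  have k3 := hr' 3
  simp only [Matrix.cons_val_zero, Matrix.cons_val_one, Matrix.cons_val, one_mul] at k0 k1 k2 k3
  have c01 := not_cross_eq_of_conic_ne (hst 0) (hst 1) (hrep 0) (hrep 1) h01
  have c02 := not_cross_eq_of_conic_ne (hst 0) (hst 2) (hrep 0) (hrep 2) h02
  have c12 := not_cross_eq_of_conic_ne (hst 1) (hst 2) (hrep 1) (hrep 2) h12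
  -- Two more points of the conic, in coordinates where the cubic is standard. Vanishing there
  -- imposes two conditions on the three coefficients of the net; the last two rows only pad the
  -- matrix to the shape the lemma expects.
  let x : Fin 4 → Fin 4 → K := ![M⁻¹.mulVec (A.mulVec ![1, r, r ^ 2]),
    M⁻¹.mulVec (A.mulVec ![1, r', r' ^ 2]), 0, 0]
  obtain ⟨c, hc, hc0, hc1⟩ := exists_mulVec_two_eq_zero le_rfl (Matrix.of fun i =>
    ![x i 0 * x i 2 - x i 1 ^ 2, x i 0 * x i 3 - x i 1 * x i 2, x i 1 * x i 3 - x i 2 ^ 2]) 0 1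
  set Q := linearSubst M⁻¹ (netQuadric c) with hQdef
  have hQ2 : Q.IsHomogeneous 2 := linearSubst_isHomogeneous _ (netQuadric_isHomogeneous c)
  have hQe : ∀ w, eval w Q = eval (M⁻¹.mulVec w) (netQuadric c) := eval_linearSubst _ _
  have hQM : ∀ w, eval (M.mulVec w) Q = eval w (netQuadric c) := fun w => by
    rw [hQe, Matrix.mulVec_mulVec, Matrix.nonsing_inv_mul _ hM.isUnit, Matrix.one_mulVec]
  have hTQ : {P : P3 K | ∃ s t : K, (s ≠ 0 ∨ t ≠ 0) ∧
      Represents (M.mulVec ![s ^ 3, s ^ 2 * t, s * t ^ 2, t ^ 3]) P} ⊆ quadricLocus Q := by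
    rintro P ⟨s, t, _, hr⟩
    rw [mem_quadricLocus_iff hQ2 hr, hQM, eval_netQuadric]
    simp
    ring
  obtain ⟨q, hq⟩ := exists_quadraticForm_eval hQ2
  have hcon : ∀ i : Fin 3, q (A.mulVec ![s i ^ 2, s i * t i, t i ^ 2]) = 0 := fun i => by
    rw [hq]
    exact (mem_quadricLocus_iff hQ2 (hrep i)).1 (hTQ (hmem i).1)
  have hx : ∀ i, c 0 * (x i 0 * x i 2 - x i 1 ^ 2) + c 1 * (x i 0 * x i 3 - x i 1 * x i 2) +
      c 2 * (x i 1 * x i 3 - x i 2 ^ 2) = (Matrix.of fun i =>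
      ![x i 0 * x i 2 - x i 1 ^ 2, x i 0 * x i 3 - x i 1 * x i 2,
        x i 1 * x i 3 - x i 2 ^ 2]).mulVec c i := fun i => by
    simp [Matrix.mulVec, dotProduct, Fin.sum_univ_three]
    ring
  have hr0 : q (A.mulVec ![1, r, r ^ 2]) = 0 := by
    rw [hq, hQe, eval_netQuadric]
    exact (hx 0).trans hc0
  have hr1 : q (A.mulVec ![1, r', r' ^ 2]) = 0 := by
    rw [hq, hQe, eval_netQuadric]
    exact (hx 1).trans hc1
  -- Three points on the cubic and two chosen ones: five points of the conic on the quadric.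
  obtain ⟨κ, hκ⟩ := quadraticForm_mulVec_of_five (A := A) (q := q) ![s 0, s 1, s 2, 1, 1]
    ![t 0, t 1, t 2, r, r'] (by
      have a0 := hr 0
      have a1 := hr 1
      have a2 := hr 2
      intro i j hij
      fin_cases i <;> fin_cases j <;> first | exact absurd rfl hij | skip
      all_goals
        simp only [Fin.zero_eta, Fin.mk_one, Fin.reduceFinMk, Matrix.cons_val_zero,
          Matrix.cons_val_one, Matrix.cons_val, one_mul]
      exacts [c01, c02, a0, k0, c01.symm, c12, a1, k1, c02.symm, c12.symm, a2, k2, a0.symm,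
        a1.symm, a2.symm, k3, k0.symm, k1.symm, k2.symm, k3.symm])
    (by
      intro i
      fin_cases i
      · exact hcon 0
      · exact hcon 1
      · exact hcon 2
      · simpa using hr0
      · simpa using hr1)
  refine ⟨Q, ⟨fun h0 => ?_, hQ2, ?_, fun i => ?_⟩, hTQ⟩
  · have hz : ∀ w, eval w (netQuadric c) = 0 := fun w => by rw [← hQM, h0, map_zero]
    -- These three vectors isolate the coefficients of the net up to sign.
    have z1 := hz ![0, 1, 0, 0]
    have z2 := hz ![0, 0, 1, 0]
    have z3 := hz ![1, 0, 0, 1]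
    rw [eval_netQuadric] at z1 z2 z3
    simp at z1 z2 z3
    apply hc
    funext i
    fin_cases i
    exacts [z1, z3, z2]
  · rintro P ⟨s, t, hst, hrep⟩
    rw [mem_quadricLocus_iff hQ2 hrep, ← hq, hκ]
    simp
    right
    ring
  · obtain ⟨P, hP, hrep⟩ := hv i
    exact ⟨P, hTQ hP, hrep⟩

end Trisecant

/-! ### The sextic on the conic and the genericity polynomial -/

section Sextic

open Polynomial

variable {R : Type*} [CommRing R]

/-- A coordinate, with respect to the first four points, of the point with parameter `t` of the
conic, up to a common factor. -/
noncomputable def conicCoordinate (A : Matrix (Fin 4) (Fin 3) R) (v : Fin 5 → Fin 4 → R)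
    (l : Fin 4) : R[X] :=
  C ((pointMatrix v).cramer (A.col 0) l) + C ((pointMatrix v).cramer (A.col 1) l) * X +
    C ((pointMatrix v).cramer (A.col 2) l) * X ^ 2

/-- A coefficient of the cubic form that is singular at the first four points and cuts the quadric
in the two twisted cubics through the five points. -/
noncomputable def cubicCoefficient (A : Matrix (Fin 4) (Fin 3) R) (v : Fin 5 → Fin 4 → R)
    (k : Fin 4) : R :=
  (pointMatrix v).cramer (v 4) k ^ 2 * secantForm A (v k.castSucc) (v 4) *
    ∏ j : Fin 3, planeForm A (v (k.succAbove j).castSucc)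

/-- The restriction to the conic of the cubic form that cuts the quadric in the two twisted cubics
through the five points. -/
noncomputable def conicSextic (A : Matrix (Fin 4) (Fin 3) R) (v : Fin 5 → Fin 4 → R) : R[X] :=
  ∑ k : Fin 4, C (cubicCoefficient A v k) * ∏ j : Fin 3, conicCoordinate A v (k.succAbove j)

/-- If it is nonzero, the quadric through the configuration is smooth and the two twisted cubics
meet the conic in six distinct points. -/
noncomputable def genericity (A : Matrix (Fin 4) (Fin 3) R) (v : Fin 5 → Fin 4 → R) : R :=
  (secantMatrix A v).det * (conicSextic A v).coeff 6 *
    resultant (conicSextic A v) (derivative (conicSextic A v)) 6 5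

theorem conicCoordinate_natDegree_le (A : Matrix (Fin 4) (Fin 3) R) (v : Fin 5 → Fin 4 → R)
    (l : Fin 4) : (conicCoordinate A v l).natDegree ≤ 2 := by
  unfold conicCoordinate
  compute_degree

theorem conicSextic_natDegree_le (A : Matrix (Fin 4) (Fin 3) R) (v : Fin 5 → Fin 4 → R) :
    (conicSextic A v).natDegree ≤ 6 := by
  refine natDegree_sum_le_of_forall_le _ _ fun k _ => ?_
  refine (natDegree_C_mul_le _ _).trans ((natDegree_prod_le _ _).trans ?_)
  rw [Fin.sum_univ_three]
  have := conicCoordinate_natDegree_le A v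
  linarith [this (k.succAbove 0), this (k.succAbove 1), this (k.succAbove 2)]

/-! ### Compatibility with ring homomorphisms -/

section Naturality

variable {S : Type*} [CommRing S] (φ : R →+* S)

theorem cramer_map (V : Matrix (Fin 4) (Fin 4) R) (w : Fin 4 → R) (l : Fin 4) :
    (V.map φ).cramer (fun i => φ (w i)) l = φ (V.cramer w l) := by
  rw [Matrix.cramer_apply, Matrix.cramer_apply, RingHom.map_det, RingHom.mapMatrix_apply,
    Matrix.map_updateCol]
  rfl

theorem augment_map (A : Matrix (Fin 4) (Fin 3) R) (y : Fin 4 → R) :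
    augment (A.map φ) (fun i => φ (y i)) = (augment A y).map φ := by
  ext i j
  fin_cases j <;> rfl

theorem planeForm_map (A : Matrix (Fin 4) (Fin 3) R) (y : Fin 4 → R) :
    planeForm (A.map φ) (fun i => φ (y i)) = φ (planeForm A y) := by
  rw [planeForm, planeForm, augment_map, RingHom.map_det, RingHom.mapMatrix_apply]

theorem secantForm_map (A : Matrix (Fin 4) (Fin 3) R) (x y : Fin 4 → R) :
    secantForm (A.map φ) (fun i => φ (x i)) (fun i => φ (y i)) = φ (secantForm A x y) := by
  simp only [secantForm, conicForm, augment_map, cramer_map, map_sub, map_mul, map_pow]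

theorem conicSextic_map (A : Matrix (Fin 4) (Fin 3) R) (v : Fin 5 → Fin 4 → R) :
    conicSextic (A.map φ) (fun i j => φ (v i j)) = (conicSextic A v).map φ := by
  have hV : pointMatrix (fun i j => φ (v i j)) = (pointMatrix v).map φ := by
    ext i j
    rfl
  have hcol : ∀ j, (A.map φ).col j = fun i => φ (A.col j i) := fun j => rfl
  simp only [conicSextic, cubicCoefficient, conicCoordinate, hV, hcol, cramer_map, planeForm_map,
    secantForm_map, Polynomial.map_sum, Polynomial.map_mul, Polynomial.map_prod,
    Polynomial.map_add, Polynomial.map_C, Polynomial.map_pow, Polynomial.map_X, map_mul, map_pow,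
    map_prod]

/-- Allows `genericity` of the generic configuration to be specialized. The formal degrees 6 and 5
in the resultant matter here: actual degrees may drop under φ. -/
theorem genericity_map (A : Matrix (Fin 4) (Fin 3) R) (v : Fin 5 → Fin 4 → R) :
    genericity (A.map φ) (fun i j => φ (v i j)) = φ (genericity A v) := by
  have h : secantMatrix (A.map φ) (fun i j => φ (v i j)) = (secantMatrix A v).map φ := by
    ext i j
    exact secantForm_map φ A _ _
  rw [genericity, genericity, h, conicSextic_map, derivative_map, resultant_map_map, coeff_map,
    map_mul, map_mul, RingHom.map_det, RingHom.mapMatrix_apply]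

end Naturality

variable {K : Type*} [Field K]

theorem cramer_mulVec (V : Matrix (Fin 4) (Fin 4) K) (x : Fin 4 → K) :
    V.cramer (V.mulVec x) = V.det • x := by
  rw [Matrix.cramer_eq_adjugate_mulVec, Matrix.mulVec_mulVec, Matrix.adjugate_mul,
    Matrix.smul_mulVec, Matrix.one_mulVec]

/-- The sextic is built from Cramer determinants and secant forms, so that it does not mention the
quadric. On a quadric, `secantForm_mul` identifies it, up to a nonzero factor in general position,
with the cubic surface of `exists_twistedCubic_through`. -/
theorem conicSextic_eval {A : Matrix (Fin 4) (Fin 3) K} {v : Fin 5 → Fin 4 → K}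
    {q : QuadraticForm K (Fin 4 → K)} {κ : K}
    (hκ : ∀ u : Fin 3 → K, q (A.mulVec u) = κ * (u 0 * u 2 - u 1 ^ 2)) (hv : ∀ i, q (v i) = 0)
    {ω x : Fin 4 → K} (hω : (pointMatrix v).mulVec ω = v 4) {t : K}
    (hx : (pointMatrix v).mulVec x = A.mulVec ![1, t, t ^ 2]) :
    κ * (conicSextic A v).eval t =
      -((pointMatrix v).det ^ 5 * (∏ l : Fin 4, planeForm A (v l.castSucc)) * planeForm A (v 4)) *
        ∑ k : Fin 4, ω k ^ 2 * QuadraticMap.polar q (v k.castSucc) (v 4) *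
          ∏ j, x (k.succAbove j) := by
  have hcoord : ∀ l, (conicCoordinate A v l).eval t = (pointMatrix v).det * x l := fun l => by
    have h1 := congrFun (cramer_mulVec (pointMatrix v) x) l
    rw [hx, mulVec_eq_three] at h1
    simp only [map_add, map_smul, Pi.add_apply, Pi.smul_apply, smul_eq_mul, Matrix.cons_val_zero,
      Matrix.cons_val_one, Matrix.cons_val] at h1
    rw [← h1]
    simp [conicCoordinate]
    ring
  have hω' : ∀ k, (pointMatrix v).cramer (v 4) k = (pointMatrix v).det * ω k := fun k => by
    rw [← hω, cramer_mulVec]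
    rfl
  rw [conicSextic, eval_finsetSum, Finset.mul_sum, Finset.mul_sum]
  refine Finset.sum_congr rfl fun k _ => ?_
  have hs := secantForm_mul hκ (hv k.castSucc) (hv 4)
  rw [eval_mul, eval_C, eval_prod, cubicCoefficient, hω', Fin.prod_univ_succAbove _ k]
  simp only [hcoord, Finset.prod_mul_distrib, Finset.prod_const, Finset.card_univ,
    Fintype.card_fin]
  linear_combination ((pointMatrix v).det * ω k) ^ 2 *
    (∏ j : Fin 3, planeForm A (v (k.succAbove j).castSucc)) * ((pointMatrix v).det ^ 3 *
    ∏ j, x (k.succAbove j)) * hs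

theorem card_roots_conicSextic [IsAlgClosed K] {A : Matrix (Fin 4) (Fin 3) K}
    {v : Fin 5 → Fin 4 → K} (h : genericity A v ≠ 0) :
    ∃ r : Fin 6 → K, Function.Injective r ∧ ∀ i, (conicSextic A v).eval (r i) = 0 := by
  classical
  have hres := right_ne_zero_of_mul h
  have h6 := right_ne_zero_of_mul (left_ne_zero_of_mul h)
  set f := conicSextic A v with hf
  have hdeg : f.natDegree = 6 :=
    le_antisymm (conicSextic_natDegree_le A v) (le_natDegree_of_ne_zero h6)
  -- The resultant is a combination of `f` and its derivative; being a nonzero constant, it is a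
  -- unit.
  have hsep : f.Separable := by
    obtain ⟨p, s, _, _, e⟩ := exists_mul_add_mul_eq_C_resultant f (derivative f)
      (m := 6) (n := 5) hdeg.le ((natDegree_derivative_le f).trans (by rw [hdeg])) (by simp)
    refine ⟨C (f.resultant (derivative f) 6 5)⁻¹ * p, C (f.resultant (derivative f) 6 5)⁻¹ * s, ?_⟩
    have : C (f.resultant (derivative f) 6 5)⁻¹ * C (f.resultant (derivative f) 6 5) = (1 : K[X]) := by
      rw [← C_mul, inv_mul_cancel₀ hres, C_1]
    rw [← this, ← e]
    ring
  have hcard : f.roots.toFinset.card = 6 := by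
    rw [Multiset.toFinset_card_of_nodup (nodup_roots hsep),
      ← (IsAlgClosed.splits f).natDegree_eq_card_roots, hdeg]
  let e := f.roots.toFinset.equivFinOfCardEq hcard
  refine ⟨fun i => e.symm i, fun i j hij => e.symm.injective (Subtype.ext hij), fun i => ?_⟩
  have := (e.symm i).2
  rw [Multiset.mem_toFinset] at this
  exact isRoot_of_mem_roots this

end Sextic

/-- If six points lie on sets of two kinds, with at most one set of each kind and at most three of
the points on each set, then there are two sets, with three points each. -/
theorem exists_pair_of_six_points {X : Type*} {C : Set X} {P : Fin 6 → X}
    (hP : Function.Injective P) {T : Fin 6 → Set X} (hPT : ∀ i, P i ∈ T i ∩ C)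
    (hT : ∀ i, (T i ∩ C).encard ≤ 3) {p₁ p₂ : Set X → Prop} (hp : ∀ i, p₁ (T i) ∨ p₂ (T i))
    (h₁ : ∀ i j, p₁ (T i) → p₁ (T j) → T i = T j) (h₂ : ∀ i j, p₂ (T i) → p₂ (T j) → T i = T j) :
    ∃ i j, p₁ (T i) ∧ p₂ (T j) ∧ T i ≠ T j ∧ (T i ∩ C).ncard = 3 ∧ (T j ∩ C).ncard = 3 := by
  have hrange : (Set.range P).ncard = 6 := by
    rw [← Nat.card_coe_set_eq, Nat.card_range_of_injective hP, Nat.card_fin]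
  have hfin : ∀ i, (T i ∩ C).Finite := fun i =>
    Set.finite_of_encard_le_coe (k := 3) (hT i)
  have hcard : ∀ i, (T i ∩ C).ncard ≤ 3 := fun i => by
    have := hT i
    rw [← (hfin i).cast_ncard_eq] at this
    exact_mod_cast this
  -- A single set would contain all six points, but it has room for three.
  have hone : ∀ i, ¬ ∀ j, T j = T i := fun i h => by
    have := Set.ncard_le_ncard (t := T i ∩ C)
      (Set.range_subset_iff.2 fun j => h j ▸ hPT j) (hfin i)
    have := hcard i
    omega
  obtain ⟨i, hi⟩ : ∃ i, p₁ (T i) := by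
    by_contra! h
    have h' : ∀ i, p₂ (T i) := fun i => (hp i).resolve_left (h i)
    exact hone 0 fun j => h₂ _ _ (h' _) (h' _)
  obtain ⟨j, hj⟩ : ∃ j, p₂ (T j) := by
    by_contra! h
    have h' : ∀ i, p₁ (T i) := fun i => (hp i).resolve_right (h i)
    exact hone 0 fun j => h₁ _ _ (h' _) (h' _)
  have hcover : ∀ k, T k = T i ∨ T k = T j := fun k =>
    (hp k).imp (fun h => h₁ _ _ h hi) fun h => h₂ _ _ h hj
  have hle := Set.ncard_le_ncard (t := (T i ∩ C) ∪ (T j ∩ C))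
    (Set.range_subset_iff.2 fun k => (hcover k).imp (fun h => h ▸ hPT k) fun h => h ▸ hPT k)
    ((hfin i).union (hfin j))
  have hun := Set.ncard_union_le (T i ∩ C) (T j ∩ C)
  have hci := hcard i
  have hcj := hcard j
  refine ⟨i, j, hi, hj, fun h => hone i fun k => (hcover k).elim id fun h' => h'.trans h.symm, ?_, ?_⟩
  all_goals omega

/-! ### The two trisecant cubics of a generic configuration -/

section Configuration

variable {K : Type*} [Field K] {A : Matrix (Fin 4) (Fin 3) K} {v : Fin 5 → Fin 4 → K}

theorem quadricLocus_eq_segreQuadric {Q : MvPolynomial (Fin 4) K} (hQ : Q.IsHomogeneous 2)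
    {g : Matrix (Fin 4) (Fin 4) K} (hg : g.det ≠ 0) {κ : K} (hκ : κ ≠ 0)
    (h : ∀ X, MvPolynomial.eval (g.mulVec X) Q = κ * (X 0 * X 3 - X 1 * X 2)) :
    quadricLocus Q = segreQuadric g := by
  ext P
  obtain ⟨w, hw⟩ := exists_represents P
  obtain ⟨X, rfl⟩ := exists_mulVec_eq hg w
  rw [mem_quadricLocus_iff hQ hw, represents_mulVec_mem_segreQuadric_iff hg hw, h,
    mul_eq_zero, or_iff_right hκ]

theorem eval_segreMap_eq_zero {Q : MvPolynomial (Fin 4) K} (hQ : Q.IsHomogeneous 2)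
    {g : Matrix (Fin 4) (Fin 4) K} (h : quadricLocus Q = segreQuadric g)
    (x y : Fin 2 → K) : MvPolynomial.eval (segreMap g x y) Q = 0 := by
  by_cases h0 : segreMap g x y = 0
  · obtain ⟨q, hq⟩ := exists_quadraticForm_eval hQ
    rw [h0, ← hq, QuadraticMap.map_zero]
  · have hr := represents_mk h0
    rw [← mem_quadricLocus_iff hQ hr, h]
    exact ⟨x, y, left_ne_zero_of_segreMap h0, right_ne_zero_of_segreMap h0, hr⟩

theorem exists_quadricLocus_eq_segreQuadric [IsAlgClosed K] (hgp : InGeneralPosition A v)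
    (h : (secantMatrix A v).det ≠ 0) {Q : MvPolynomial (Fin 4) K} (hQ : IsQuadricThrough Q A v) :
    ∃ g : Matrix (Fin 4) (Fin 4) K, g.det ≠ 0 ∧ quadricLocus Q = segreQuadric g := by
  obtain ⟨q, κ, hq, hκ0, hκ, hv⟩ := hQ.exists_quadraticForm hgp
  obtain ⟨g, hg, hgq⟩ := exists_segre_coordinates
    (((inGeneralPosition_iff A v).1 hgp).2.1 0) hκ0 hκ
    ((det_secantMatrix_ne_zero_iff hgp hκ0 hκ hv).1 h)
  exact ⟨g, hg, quadricLocus_eq_segreQuadric hQ.2.1 hg hκ0 fun X => by rw [← hq, hgq]⟩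

/-- A root of the sextic gives a point of the conic on a twisted cubic through the five points. -/
theorem exists_isTwistedCubic_of_root (hgp : InGeneralPosition A v)
    {Q : MvPolynomial (Fin 4) K} (hQ2 : Q.IsHomogeneous 2)
    {q : QuadraticForm K (Fin 4 → K)} {κ : K} (hqQ : ∀ w, q w = MvPolynomial.eval w Q)
    (hκ0 : κ ≠ 0) (hκ : ∀ u : Fin 3 → K, q (A.mulVec u) = κ * (u 0 * u 2 - u 1 ^ 2))
    (hv : ∀ i, q (v i) = 0) {t : K} (ht : (conicSextic A v).eval t = 0) :
    ∃ T P, IsTwistedCubic T ∧ PassesThrough T v ∧ T ⊆ quadricLocus Q ∧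
      Represents (A.mulVec ![1, t, t ^ 2]) P ∧ P ∈ T ∩ conic A := by
  have hV := det_pointMatrix_ne_zero hgp
  have hp := ((inGeneralPosition_iff A v).1 hgp).2.1
  obtain ⟨ω, hω⟩ := exists_pointMatrix_mulVec hV (v 4)
  obtain ⟨x, hx⟩ := exists_pointMatrix_mulVec hV (A.mulVec ![1, t, t ^ 2])
  have hne : A.mulVec ![1, t, t ^ 2] ≠ 0 := fun h => by
    have := congrFun (hgp.1 (h.trans A.mulVec_zero.symm)) 0
    simp at this
  have hx0 : x ≠ 0 := by
    rintro rfl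
    exact hne (by rw [← hx, Matrix.mulVec_zero])
  have hS := conicSextic_eval hκ hv hω hx
  rw [ht, mul_zero, eq_comm, mul_eq_zero] at hS
  have hS' := hS.resolve_left (neg_ne_zero.2 (mul_ne_zero (mul_ne_zero (pow_ne_zero 5 hV)
    (Finset.prod_ne_zero_iff.2 fun l _ => hp _)) (hp 4)))
  obtain ⟨M, hM, hMq, hMv, s, t', a, hst, ha, hM'⟩ := exists_twistedCubic_through hgp hκ0 hκ hv hω
    hx0 (by rw [hx, planeForm_mulVec]) (by rw [hx, hκ]; simp) hS'
  have hr := represents_mk hne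
  have hv0 : ∀ i, v i ≠ 0 := fun i h0 => hgp.2.2.1 i 0 (by rw [h0, Matrix.mulVec_zero])
  refine ⟨_, _, ⟨M, hM, rfl⟩, fun i => ?_, ?_, hr, ⟨s, t', hst, ?_⟩, ?_⟩
  · obtain ⟨s, t, a, hst, ha, e⟩ := hMv i
    refine ⟨_, ⟨s, t, hst, ?_⟩, represents_mk (hv0 i)⟩
    rw [e]
    exact (represents_mk _).smul ha
  · rintro P ⟨s, t, hst, hP⟩
    rw [mem_quadricLocus_iff hQ2 hP, ← hqQ, hMq]
  · rw [hM', hx]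
    exact hr.smul ha
  · exact mem_conic_of_represents (by simp) hr

theorem represents_conic_injective (hA : Function.Injective A.mulVec) {t t' : K} {P : P3 K}
    (h : Represents (A.mulVec ![1, t, t ^ 2]) P) (h' : Represents (A.mulVec ![1, t', t' ^ 2]) P) :
    t = t' := by
  obtain ⟨a, ha, e⟩ := exists_smul_ne_zero_of_represents h h'
  rw [← Matrix.mulVec_smul] at e
  have e' := hA e
  have h0 := congrFun e' 0
  have h1 := congrFun e' 1
  simp at h0 h1
  rw [h1, ← h0, one_mul]

/-- Each root of the sextic gives a point of the conic on a cubic through the five points. There is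
at most one such cubic of each type and at most three conic points on each, so six points force both
types to occur with three points each. -/
theorem exists_trisecant_pair [IsAlgClosed K] (hgp : InGeneralPosition A v)
    (hF : genericity A v ≠ 0) {Q : MvPolynomial (Fin 4) K} (hQ : IsQuadricThrough Q A v)
    {g : Matrix (Fin 4) (Fin 4) K} (hg : g.det ≠ 0) (hQg : quadricLocus Q = segreQuadric g) :
    ∃ T₁ T₂ : Set (P3 K), T₁ ≠ T₂ ∧ IsQuadraticGraph g T₁ ∧ IsQuadraticGraph (swapFactors g) T₂ ∧
      {T | IsTrisecantCubic T A v} = {T₁, T₂} := by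
  obtain ⟨q, κ, hq, hκ0, hκ, hv⟩ := hQ.exists_quadraticForm hgp
  obtain ⟨r, hr, hroot⟩ := card_roots_conicSextic hF
  have hy := ((inGeneralPosition_iff A v).1 hgp).2.1 0
  choose T P hT hTv hTQ hP hPT using fun i =>
    exists_isTwistedCubic_of_root hgp hQ.2.1 hq hκ0 hκ hv (hroot i)
  have hqs : ∀ x y, q (segreMap g x y) = 0 := fun x y => by
    rw [hq, eval_segreMap_eq_zero hQ.2.1 hQg]
  have hpolar : ∀ {i j : Fin 5}, i ≠ j → QuadraticMap.polar q (v i) (v j) ≠ 0 :=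
    fun h => polar_ne_zero_of_inGeneralPosition hgp hκ0 hκ hv h
  have hu₁ : ∀ {T T' : Set (P3 K)}, IsQuadraticGraph g T → IsQuadraticGraph g T' →
      PassesThrough T v → PassesThrough T' v → T = T' :=
    IsQuadraticGraph.unique hg fun i j hij x x' y h =>
      ne_segreMap_of_polar_ne_zero hqs (hpolar hij) x x' y h
  have hu₂ : ∀ {T T' : Set (P3 K)}, IsQuadraticGraph (swapFactors g) T →
      IsQuadraticGraph (swapFactors g) T' → PassesThrough T v → PassesThrough T' v → T = T' :=
    IsQuadraticGraph.unique (det_swapFactors hg) fun i j hij x x' y h =>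
      ne_segreMap_of_polar_ne_zero (fun x y => by rw [segreMap_swapFactors, hqs]) (hpolar hij)
        x x' y h
  have htype : ∀ {T : Set (P3 K)}, IsTwistedCubic T → T ⊆ quadricLocus Q →
      IsQuadraticGraph g T ∨ IsQuadraticGraph (swapFactors g) T := fun hT h =>
    hT.isQuadraticGraph hg (hQg ▸ h)
  obtain ⟨i, j, hi, hj, hij, hi3, hj3⟩ := exists_pair_of_six_points (P := P)
    (fun i j hij => hr (represents_conic_injective hgp.1 (hP i) (hij ▸ hP j))) hPT
    (fun i => (hT i).encard_inter_conic_le hy) (fun i => htype (hT i) (hTQ i))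
    (fun i j hi hj => hu₁ hi hj (hTv i) (hTv j)) (fun i j hi hj => hu₂ hi hj (hTv i) (hTv j))
  refine ⟨T i, T j, hij, hi, hj, Set.ext fun S => ⟨fun hS => ?_, ?_⟩⟩
  -- Any trisecant cubic lies on some quadric through the configuration, which is `Q` by uniqueness;
  -- so it has one of the two types.
  · obtain ⟨Q', hQ', hSQ'⟩ := IsTrisecantCubic.exists_quadric hS
    rw [IsQuadricThrough.quadricLocus_eq hgp hQ' hQ] at hSQ'
    exact (htype hS.1 hSQ').imp (fun h => hu₁ h hi hS.2.1 (hTv i))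
      fun h => hu₂ h hj hS.2.1 (hTv j)
  · rintro (rfl | rfl)
    · exact ⟨hT i, hTv i, hi3⟩
    · exact ⟨hT j, hTv j, hj3⟩

theorem trisecant_cubics_of_genericity_ne_zero [IsAlgClosed K] (hgp : InGeneralPosition A v)
    (hF : genericity A v ≠ 0) :
    ((∃ Q, IsQuadricThrough Q A v) ↔ ∃ T, IsTrisecantCubic T A v) ∧
      ∀ Q, IsQuadricThrough Q A v →
        (∃ g : Matrix (Fin 4) (Fin 4) K, g.det ≠ 0 ∧ quadricLocus Q = segreQuadric g) ∧
        ∀ g : Matrix (Fin 4) (Fin 4) K, g.det ≠ 0 → quadricLocus Q = segreQuadric g →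
          HasBidegree g (conic A) 1 1 ∧
          ∃ T₁ T₂ : Set (P3 K), T₁ ≠ T₂ ∧
            HasBidegree g T₁ 1 2 ∧ HasBidegree g T₂ 2 1 ∧
            {T | IsTrisecantCubic T A v} = {T₁, T₂} := by
  have hdet := left_ne_zero_of_mul (left_ne_zero_of_mul hF)
  refine ⟨⟨?_, ?_⟩, fun Q hQ => ⟨exists_quadricLocus_eq_segreQuadric hgp hdet hQ,
    fun g hg hQg => ⟨?_, ?_⟩⟩⟩
  · rintro ⟨Q, hQ⟩
    obtain ⟨g, hg, hQg⟩ := exists_quadricLocus_eq_segreQuadric hgp hdet hQ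
    obtain ⟨T₁, T₂, _, _, _, h⟩ := exists_trisecant_pair hgp hF hQ hg hQg
    exact ⟨T₁, h.superset (Set.mem_insert _ _)⟩
  · rintro ⟨T, hT⟩
    exact hT.exists_quadric.imp fun Q h => h.1
  · exact (conic_isLinearGraph hgp.1 hg (hQg ▸ hQ.2.2.1)).hasBidegree
  · obtain ⟨T₁, T₂, hne, h₁, h₂, h⟩ := exists_trisecant_pair hgp hF hQ hg hQg
    exact ⟨T₁, T₂, hne, h₁.hasBidegree, h₂.hasBidegree_swap, h⟩

end Configuration

/-! ### Configurations on quadrics as a rational family -/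

section Parametrization

variable {R : Type*} [CommRing R]

/-- Up to a factor and a change of coordinates, the equation of a quadric that contains a given
conic: the plane of the conic is `x₃ = 0`. -/
def quadricForm (e y : Fin 4 → R) : R :=
  y 0 * y 2 - y 1 ^ 2 + y 3 * (e 0 * y 0 + e 1 * y 1 + e 2 * y 2 + e 3 * y 3)

/-- The polar form of `quadricForm e` at the point `[s : t]` of the conic. -/
def conicPolar (e : Fin 4 → R) (s t : R) (y : Fin 4 → R) : R :=
  s ^ 2 * y 2 + t ^ 2 * y 0 - 2 * (s * t) * y 1 +
    y 3 * (e 0 * s ^ 2 + e 1 * (s * t) + e 2 * t ^ 2)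

/-- The second intersection point of the quadric with the line that joins `y` to the point `[s : t]`
of the conic. -/
def quadricPoint (e : Fin 4 → R) (s t : R) (y : Fin 4 → R) : Fin 4 → R :=
  quadricForm e y • ![s ^ 2, s * t, t ^ 2, 0] - conicPolar e s t y • y

theorem quadricForm_quadricPoint (e : Fin 4 → R) (s t : R) (y : Fin 4 → R) :
    quadricForm e (quadricPoint e s t y) = 0 := by
  simp [quadricForm, quadricPoint, conicPolar]
  ring

theorem quadricForm_smul (e : Fin 4 → R) (a : R) (y : Fin 4 → R) :
    quadricForm e (a • y) = a ^ 2 * quadricForm e y := by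
  simp [quadricForm]
  ring

theorem conicPolar_smul (e : Fin 4 → R) (s t a : R) (y : Fin 4 → R) :
    conicPolar e s t (a • y) = a * conicPolar e s t y := by
  simp [conicPolar]
  ring

/-- For `y` on the quadric the projection returns a multiple of `y`; rescaling the input corrects
the factor. The vector itself must be recovered, not just the point, because the polynomials tested
on configurations need not be homogeneous. -/
theorem quadricPoint_smul {e : Fin 4 → R} {s t a : R} {y : Fin 4 → R} (h : quadricForm e y = 0)
    (ha : a ^ 2 * conicPolar e s t y = -1) : quadricPoint e s t (a • y) = y := by
  rw [quadricPoint, quadricForm_smul, h, conicPolar_smul, smul_smul, mul_zero, zero_smul, zero_sub,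
    ← neg_smul, show -(a * conicPolar e s t y * a) = 1 by linear_combination -ha, one_smul]

theorem quadricPoint_map {S : Type*} [CommRing S] (φ : R →+* S) (e : Fin 4 → R) (s t : R)
    (y : Fin 4 → R) (i : Fin 4) :
    quadricPoint (fun j => φ (e j)) (φ s) (φ t) (fun j => φ (y j)) i =
      φ (quadricPoint e s t y i) := by
  fin_cases i <;> simp [quadricPoint, quadricForm, conicPolar, map_ofNat]

/-- The conic of the configuration with the given parameters. -/
def parametrizedConic (B : Matrix (Fin 4) (Fin 4) R) : Matrix (Fin 4) (Fin 3) R :=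
  B.submatrix id Fin.castSucc

/-- The points of the configuration with the given parameters. -/
def parametrizedPoints (B : Matrix (Fin 4) (Fin 4) R) (e : Fin 4 → R) (s t : Fin 5 → R)
    (y : Fin 5 → Fin 4 → R) (i : Fin 5) : Fin 4 → R :=
  B.mulVec (quadricPoint e (s i) (t i) (y i))

theorem parametrizedConic_mulVec (B : Matrix (Fin 4) (Fin 4) R) (u : Fin 3 → R) :
    (parametrizedConic B).mulVec u = B.mulVec ![u 0, u 1, u 2, 0] := by
  funext i
  simp [parametrizedConic, Matrix.mulVec, dotProduct, Fin.sum_univ_four, Fin.sum_univ_three]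

theorem parametrizedPoints_map {S : Type*} [CommRing S] (φ : R →+* S)
    (B : Matrix (Fin 4) (Fin 4) R) (e : Fin 4 → R) (s t : Fin 5 → R) (y : Fin 5 → Fin 4 → R) :
    parametrizedPoints (B.map φ) (fun j => φ (e j)) (fun j => φ (s j)) (fun j => φ (t j))
      (fun i j => φ (y i j)) = fun i j => φ (parametrizedPoints B e s t y i j) := by
  funext i j
  simp [parametrizedPoints, Matrix.mulVec, dotProduct, quadricPoint_map]

/-- It is nonzero if the conic is smooth and the points are in general position. -/
def positionForm (A : Matrix (Fin 4) (Fin 3) R) (v : Fin 5 → Fin 4 → R) : R :=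
  (∏ k : Fin 5, (Matrix.of fun j : Fin 4 => v (k.succAbove j)).det) *
    (∏ i, planeForm A (v i)) * ∏ i, ∏ j ∈ Finset.univ.erase i, secantForm A (v i) (v j)

theorem positionForm_map {S : Type*} [CommRing S] (φ : R →+* S) (A : Matrix (Fin 4) (Fin 3) R)
    (v : Fin 5 → Fin 4 → R) :
    positionForm (A.map φ) (fun i j => φ (v i j)) = φ (positionForm A v) := by
  have : ∀ k : Fin 5, (Matrix.of fun (j : Fin 4) i => φ (v (k.succAbove j) i)).det =
      φ (Matrix.of fun j : Fin 4 => v (k.succAbove j)).det := fun k => by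
    rw [RingHom.map_det]
    rfl
  simp only [positionForm, map_mul, map_prod, planeForm_map, secantForm_map, this]

variable {K : Type*} [Field K]

theorem positionForm_ne_zero_iff (A : Matrix (Fin 4) (Fin 3) K) (v : Fin 5 → Fin 4 → K) :
    positionForm A v ≠ 0 ↔ InGeneralPosition A v := by
  simp only [inGeneralPosition_iff, positionForm, mul_ne_zero_iff, Finset.prod_ne_zero_iff,
    Finset.mem_univ, forall_true_left, Finset.mem_erase, and_true, and_assoc]
  exact and_congr_right fun _ => and_congr_right fun _ =>
    ⟨fun h i j hij => h i j hij.symm, fun h i j hij => h i j hij.symm⟩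

open MvPolynomial in
theorem exists_isQuadricThrough_parametrized {B : Matrix (Fin 4) (Fin 4) K} (hB : B.det ≠ 0)
    {e : Fin 4 → K} {s t : Fin 5 → K} {y : Fin 5 → Fin 4 → K}
    (h : InGeneralPosition (parametrizedConic B) (parametrizedPoints B e s t y)) :
    ∃ Q, IsQuadricThrough Q (parametrizedConic B) (parametrizedPoints B e s t y) := by
  let Q₀ : MvPolynomial (Fin 4) K := X 0 * X 2 - X 1 ^ 2 +
    X 3 * (C (e 0) * X 0 + C (e 1) * X 1 + C (e 2) * X 2 + C (e 3) * X 3)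
  have hX : ∀ i : Fin 4, (X i : MvPolynomial (Fin 4) K).IsHomogeneous 1 := isHomogeneous_X K
  have hQ₀ : Q₀.IsHomogeneous 2 :=
    (((hX 0).mul (hX 2)).sub (isHomogeneous_X_pow 1 2)).add ((hX 3).mul
      (((((hX 0).C_mul _).add ((hX 1).C_mul _)).add ((hX 2).C_mul _)).add ((hX 3).C_mul _)))
  have hQ2 := linearSubst_isHomogeneous B⁻¹ hQ₀
  have heval : ∀ x, eval (B.mulVec x) (linearSubst B⁻¹ Q₀) = quadricForm e x := fun x => by
    rw [eval_linearSubst, Matrix.mulVec_mulVec, Matrix.nonsing_inv_mul _ hB.isUnit,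
      Matrix.one_mulVec]
    simp [Q₀, quadricForm]
  refine ⟨linearSubst B⁻¹ Q₀, fun h0 => ?_, hQ2, ?_, fun i => ?_⟩
  · have := heval ![1, 0, 1, 0]
    rw [h0] at this
    simp [quadricForm] at this
  · rintro P ⟨s, t, -, hP⟩
    rw [mem_quadricLocus_iff hQ2 hP, parametrizedConic_mulVec, heval]
    simp [quadricForm]
    ring
  · have h0 : parametrizedPoints B e s t y i ≠ 0 := fun h0 =>
      h.2.2.1 i 0 (by rw [h0, Matrix.mulVec_zero])
    refine ⟨_, ?_, represents_mk h0⟩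
    rw [mem_quadricLocus_iff hQ2 (represents_mk h0), parametrizedPoints, heval,
      quadricForm_quadricPoint]

/-- Otherwise the polar form with `v i` would vanish at three conic points that span the plane. But
at the point where the line through `v i` and another `v j` meets the plane, it is a nonzero
multiple of the polar value of the pair. -/
theorem exists_polar_conic_ne_zero {A : Matrix (Fin 4) (Fin 3) K} {v : Fin 5 → Fin 4 → K}
    (hgp : InGeneralPosition A v) {q : QuadraticForm K (Fin 4 → K)} {κ : K} (hκ0 : κ ≠ 0)
    (hκ : ∀ u : Fin 3 → K, q (A.mulVec u) = κ * (u 0 * u 2 - u 1 ^ 2)) (hv : ∀ i, q (v i) = 0)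
    (i : Fin 5) : ∃ s t : K, QuadraticMap.polar q (A.mulVec ![s ^ 2, s * t, t ^ 2]) (v i) ≠ 0 := by
  obtain ⟨j, hij⟩ := exists_ne i
  have hp := ((inGeneralPosition_iff A v).1 hgp).2.1
  have hmul : ∀ u : Fin 3 → K, QuadraticMap.polar q (A.mulVec u) (v i) =
      u 0 * QuadraticMap.polar q (A.col 0) (v i) + u 1 * QuadraticMap.polar q (A.col 1) (v i) +
        u 2 * QuadraticMap.polar q (A.col 2) (v i) := fun u => by
    rw [mulVec_eq_three]
    simp only [QuadraticMap.polar_add_left, QuadraticMap.polar_smul_left, smul_eq_mul]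
  by_contra! h
  have h0 := h 1 0
  have h1 := h 0 1
  have h2 := h 1 1
  rw [hmul] at h0 h1 h2
  simp at h0 h1
  simp [h0, h1] at h2
  have hA : ∀ u, QuadraticMap.polar q (A.mulVec u) (v i) = 0 := fun u => by
    rw [hmul, h0, h1, h2]
    simp
  have hw := hA ![(augment A (v i)).cramer (v j) 0, (augment A (v i)).cramer (v j) 1,
    (augment A (v i)).cramer (v j) 2]
  rw [mulVec_cramer_augment, sub_eq_add_neg, ← neg_smul, QuadraticMap.polar_add_left,
    QuadraticMap.polar_smul_left, QuadraticMap.polar_smul_left, QuadraticMap.polar_self, hv,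
    smul_zero, smul_zero, add_zero, smul_eq_mul] at hw
  exact mul_ne_zero (hp i) (polar_ne_zero_of_inGeneralPosition hgp hκ0 hκ hv hij) hw

/-- The columns of `A` and the first point form the basis `B`, in which the quadric is κ times
`quadricForm e`. The last entry of `e` is zero because the first point is on the quadric. -/
theorem QuadricConfig.exists_parameters [IsAlgClosed K] {A : Matrix (Fin 4) (Fin 3) K}
    {v : Fin 5 → Fin 4 → K} (h : QuadricConfig A v) :
    ∃ (B : Matrix (Fin 4) (Fin 4) K) (e : Fin 4 → K) (s t : Fin 5 → K) (y : Fin 5 → Fin 4 → K),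
      B.det ≠ 0 ∧ A = parametrizedConic B ∧ v = parametrizedPoints B e s t y := by
  obtain ⟨hgp, Q, hQ⟩ := h
  obtain ⟨q, κ, -, hκ0, hκ, hv⟩ := hQ.exists_quadraticForm hgp
  have hB : (augment A (v 0)).det ≠ 0 := ((inGeneralPosition_iff A v).1 hgp).2.1 0
  set B := augment A (v 0) with hBdef
  let e : Fin 4 → K := ![QuadraticMap.polar q (A.col 0) (v 0) / κ,
    QuadraticMap.polar q (A.col 1) (v 0) / κ, QuadraticMap.polar q (A.col 2) (v 0) / κ, 0]
  have hBA : ∀ z, B.mulVec z = A.mulVec ![z 0, z 1, z 2] + z 3 • v 0 := augment_mulVec A (v 0)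
  have hpol : ∀ (u : Fin 3 → K) (a : K), QuadraticMap.polar q (A.mulVec u) (a • v 0) =
      κ * (a * (e 0 * u 0 + e 1 * u 1 + e 2 * u 2)) := fun u a => by
    rw [mulVec_eq_three]
    simp only [QuadraticMap.polar_add_left, QuadraticMap.polar_smul_left, smul_eq_mul,
      QuadraticMap.polar_smul_right, e, Matrix.cons_val_zero, Matrix.cons_val_one, Matrix.cons_val]
    field_simp
  have hqB : ∀ z, q (B.mulVec z) = κ * quadricForm e z := fun z => by
    rw [hBA, QuadraticMap.map_add q, hκ, QuadraticMap.map_smul, hv, hpol]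
    simp [quadricForm, e]
    ring
  have hpB : ∀ (s t : K) z, QuadraticMap.polar q (A.mulVec ![s ^ 2, s * t, t ^ 2]) (B.mulVec z) =
      κ * conicPolar e s t z := fun s t z => by
    rw [hBA, QuadraticMap.polar_add_right, hpol, QuadraticMap.polar, ← Matrix.mulVec_add, hκ, hκ, hκ]
    simp [conicPolar]
    ring
  have key : ∀ i, ∃ s t : K, ∃ y, B.mulVec (quadricPoint e s t y) = v i := fun i => by
    obtain ⟨s, t, hst⟩ := exists_polar_conic_ne_zero hgp hκ0 hκ hv i
    obtain ⟨z, hz⟩ := exists_mulVec_eq hB (v i)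
    rw [← hz, hpB] at hst
    have hp := right_ne_zero_of_mul hst
    have hz0 : quadricForm e z = 0 := by
      have := hqB z
      rw [hz, hv, eq_comm] at this
      exact (mul_eq_zero.1 this).resolve_left hκ0
    -- The scaling required by `quadricPoint_smul`.
    obtain ⟨a, ha⟩ := IsAlgClosed.exists_pow_nat_eq (-(conicPolar e s t z)⁻¹) two_pos
    refine ⟨s, t, a • z, ?_⟩
    rw [quadricPoint_smul hz0, hz]
    rw [ha, neg_mul, inv_mul_cancel₀ hp]
  choose s t y hy using key
  refine ⟨B, e, s, t, y, hB, ?_, funext fun i => (hy i).symm⟩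
  ext i j
  fin_cases j <;> rfl

open Polynomial

/-- The line that joins two values. -/
noncomputable def linePoly (a b : K) : K[X] := C a + X * C (b - a)

theorem linePoly_eval_zero (a b : K) : (linePoly a b).eval 0 = a := by simp [linePoly]

theorem linePoly_eval_one (a b : K) : (linePoly a b).eval 1 = b := by simp [linePoly]

theorem evalConfig_map (F : MvPolynomial ((Fin 4 × Fin 3) ⊕ (Fin 5 × Fin 4)) K)
    (A : Matrix (Fin 4) (Fin 3) K[X]) (v : Fin 5 → Fin 4 → K[X]) (τ : K) :
    evalConfig F (A.map (evalRingHom τ)) (fun i j => evalRingHom τ (v i j)) =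
      evalRingHom τ (MvPolynomial.aeval
        (Sum.elim (fun e => A e.1 e.2) (fun e => v e.1 e.2)) F) := by
  rw [evalConfig, MvPolynomial.map_aeval, MvPolynomial.eval,
    show (evalRingHom τ).comp (algebraMap K K[X]) = RingHom.id K from RingHom.ext fun a => by simp]
  congr 2
  funext i
  cases i <;> rfl

/-- The configurations on a quadric form an irreducible family. -/
theorem QuadricConfig.exists_evalConfig_ne_zero [IsAlgClosed K]
    {A A₁ : Matrix (Fin 4) (Fin 3) K} {v v₁ : Fin 5 → Fin 4 → K} (h : QuadricConfig A v)
    (h₁ : QuadricConfig A₁ v₁) {G F : MvPolynomial ((Fin 4 × Fin 3) ⊕ (Fin 5 × Fin 4)) K}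
    (hG : evalConfig G A v ≠ 0) (hF : evalConfig F A₁ v₁ ≠ 0) :
    ∃ A' v', QuadricConfig A' v' ∧ evalConfig G A' v' ≠ 0 ∧ evalConfig F A' v' ≠ 0 := by
  have hgp := (positionForm_ne_zero_iff A v).2 h.1
  obtain ⟨B, e, s, t, y, hB, hA, hv⟩ := h.exists_parameters
  obtain ⟨B₁, e₁, s₁, t₁, y₁, hB₁, hA₁, hv₁⟩ := h₁.exists_parameters
  -- Parameters interpolated linearly: the first configuration at τ = 0, the second at τ = 1.
  let B' : Matrix (Fin 4) (Fin 4) K[X] := Matrix.of fun i j => linePoly (B i j) (B₁ i j)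
  let e' := fun j => linePoly (e j) (e₁ j)
  let s' := fun j => linePoly (s j) (s₁ j)
  let t' := fun j => linePoly (t j) (t₁ j)
  let y' := fun i j => linePoly (y i j) (y₁ i j)
  let A' := parametrizedConic B'
  let v' := parametrizedPoints B' e' s' t' y'
  have hA' : ∀ τ, A'.map (evalRingHom τ) = parametrizedConic (B'.map (evalRingHom τ)) := fun τ => rfl
  have hv' : ∀ τ, (fun i j => evalRingHom τ (v' i j)) = _ := fun τ =>
    (parametrizedPoints_map (evalRingHom τ) B' e' s' t' y').symm
  have hB0 : B'.map (evalRingHom 0) = B := by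
    ext i j
    exact linePoly_eval_zero _ _
  have hB1 : B'.map (evalRingHom 1) = B₁ := by
    ext i j
    exact linePoly_eval_one _ _
  have hA0 : A'.map (evalRingHom 0) = A := by rw [hA', hB0, hA]
  have hA1 : A'.map (evalRingHom 1) = A₁ := by rw [hA', hB1, hA₁]
  have hv0 : (fun i j => evalRingHom 0 (v' i j)) = v := by
    rw [hv', hB0, hv]
    simp only [coe_evalRingHom, e', s', t', y', linePoly_eval_zero]
  have hv1 : (fun i j => evalRingHom 1 (v' i j)) = v₁ := by
    rw [hv', hB1, hv₁]
    simp only [coe_evalRingHom, e', s', t', y', linePoly_eval_one]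
  have ne : ∀ {f : K[X]} (τ : K), evalRingHom τ f ≠ 0 → f ≠ 0 := fun τ hf h0 =>
    hf (by rw [h0, map_zero])
  have n1 : B'.det ≠ 0 := ne 0 (by
    rw [RingHom.map_det, RingHom.mapMatrix_apply, hB0]
    exact hB)
  have n2 : positionForm A' v' ≠ 0 := ne 0 (by
    rw [← positionForm_map, hA0, hv0]
    exact hgp)
  have n3 := ne 0 (f := MvPolynomial.aeval (Sum.elim (fun e => A' e.1 e.2)
    (fun e => v' e.1 e.2)) G) (by
      rw [← evalConfig_map, hA0, hv0]
      exact hG)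
  have n4 := ne 1 (f := MvPolynomial.aeval (Sum.elim (fun e => A' e.1 e.2)
    (fun e => v' e.1 e.2)) F) (by
      rw [← evalConfig_map, hA1, hv1]
      exact hF)
  -- Each factor is a nonzero polynomial in τ, being nonzero at 0 or at 1, and `K` is infinite.
  obtain ⟨τ, hτ⟩ : ∃ τ, (B'.det * positionForm A' v' * _).eval τ ≠ 0 := by
    by_contra! h0
    exact mul_ne_zero (mul_ne_zero n1 n2) (mul_ne_zero n3 n4)
      (Polynomial.funext fun τ => (h0 τ).trans eval_zero.symm)
  rw [← coe_evalRingHom, map_mul, map_mul, map_mul, ← evalConfig_map, ← evalConfig_map,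
    ← positionForm_map, RingHom.map_det, RingHom.mapMatrix_apply] at hτ
  have m1 := left_ne_zero_of_mul (left_ne_zero_of_mul hτ)
  have m2 := (positionForm_ne_zero_iff _ _).1 (right_ne_zero_of_mul (left_ne_zero_of_mul hτ))
  refine ⟨_, _, ⟨m2, ?_⟩, left_ne_zero_of_mul (right_ne_zero_of_mul hτ),
    right_ne_zero_of_mul (right_ne_zero_of_mul hτ)⟩
  rw [hA', hv'] at m2 ⊢
  exact exists_isQuadricThrough_parametrized m1 m2

end Parametrization

/-! ### An explicit configuration in every characteristic -/

section Example

variable {K : Type*} [Field K]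

/-- The parameters of a configuration: five points on the standard twisted cubic, a plane section
of the quadric `X₀ X₃ = X₁ X₂`, and the nondegeneracy conditions. The product of the two cubics
in `u` is, up to a factor, the sextic of the configuration. -/
structure ExampleParameters (a b c : K) : Prop where
  c_ne : c ≠ 0
  a_ne : a ≠ 0
  b_ne : b ≠ 0
  a_ne_one : a ≠ 1
  b_ne_one : b ≠ 1
  a_ne_b : a ≠ b
  one_add_mul : (1 + a) * (1 + b) = 1
  a_add_b : a + b ≠ 0
  cubic_a : a ^ 3 - a - c ≠ 0
  cubic_b : b ^ 3 - b - c ≠ 0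
  separable_left : ∀ u, u ^ 3 - u - c = 0 → 3 * u ^ 2 - 1 ≠ 0
  separable_right : ∀ u, u ^ 3 + (c * (1 + a + b) - 1) * u ^ 2 - 2 * c * u - c ^ 2 = 0 →
    3 * u ^ 2 + 2 * (c * (1 + a + b) - 1) * u - 2 * c ≠ 0
  coprime : ∀ u, u ^ 3 - u - c = 0 →
    u ^ 3 + (c * (1 + a + b) - 1) * u ^ 2 - 2 * c * u - c ^ 2 ≠ 0

open Polynomial in
theorem finite_roots_depressed_cubic (p q : K) : {u : K | u ^ 3 + p * u + q = 0}.Finite := by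
  have hne : (X ^ 3 + C p * X + C q : K[X]) ≠ 0 := by
    intro h
    have := congrArg (fun f => coeff f 3) h
    simp at this
  classical
  refine (X ^ 3 + C p * X + C q : K[X]).roots.toFinset.finite_toSet.subset fun u hu => ?_
  simpa [hne] using hu

/-- Once `c` is fixed, all remaining conditions exclude finitely many values of n = 1 + a + b. The
second cubic factor is linear in n, so each potential bad root `u` belongs to one n, namely ψ(u). -/
theorem exists_exampleParameters [IsAlgClosed K] : ∃ a b c : K, ExampleParameters a b c := by
  -- Up to sign, 27c² - 4 is the discriminant of u³ - u - c. The value c = 1 gives 23, so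
  -- characteristic 23 needs another choice.
  obtain ⟨c, hc, hc'⟩ : ∃ c : K, c ≠ 0 ∧ 27 * c ^ 2 - 4 ≠ 0 := by
    by_cases h : (23 : K) = 0
    · refine ⟨2, fun h2 => one_ne_zero (α := K) ?_, fun h4 => one_ne_zero (α := K) ?_⟩
      · linear_combination h - 11 * h2
      · linear_combination (-9) * h + 2 * h4
    · exact ⟨1, one_ne_zero, fun h' => h (by linear_combination h')⟩
  let ψ : K → K := fun u => (-u ^ 3 + u ^ 2 + 2 * c * u + c ^ 2) / (c * u ^ 2)
  -- Since (1 + a)(1 + b) = 1, n is χ(a) and χ(b); excluding χ at the roots of u³ - u - c keeps the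
  -- points off the plane. The values 1, 3/2, -3 correspond to a + b = 0, to a or b equal to 1, and
  -- to a = b.
  let χ : K → K := fun u => (u ^ 2 + u + 1) / (u + 1)
  have hfin : (ψ '' {u : K | u ^ 3 + (-1) * u + (-c) = 0} ∪
      ψ '' {u : K | u ^ 3 + 2 * c * u + 2 * c ^ 2 = 0} ∪
      χ '' {u : K | u ^ 3 + (-1) * u + (-c) = 0} ∪ {1, 3 / 2, -3}).Finite :=
    ((((finite_roots_depressed_cubic _ _).image _).union
      ((finite_roots_depressed_cubic _ _).image _)).union
      ((finite_roots_depressed_cubic _ _).image _)).union (Set.toFinite _)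
  obtain ⟨n, hn⟩ := hfin.exists_notMem
  simp only [Set.mem_union, not_or, Set.mem_insert_iff, Set.mem_singleton_iff] at hn
  obtain ⟨⟨⟨h1, h2⟩, h3⟩, hn1, hn2, hn3⟩ := hn
  -- The two roots have sum n - 1 and product 1 - n, hence (1 + a)(1 + b) = 1.
  obtain ⟨a, ha⟩ : ∃ a : K, a ^ 2 - (n - 1) * a + (1 - n) = 0 := by
    obtain ⟨a, ha⟩ := IsAlgClosed.exists_root
      (Polynomial.C 1 * Polynomial.X ^ 2 + Polynomial.C (-(n - 1)) * Polynomial.X +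
        Polynomial.C (1 - n)) (by
        rw [Polynomial.degree_quadratic one_ne_zero]
        decide)
    refine ⟨a, ?_⟩
    simp only [Polynomial.IsRoot, Polynomial.eval_add, Polynomial.eval_mul, Polynomial.eval_C,
      Polynomial.eval_pow, Polynomial.eval_X] at ha
    linear_combination ha
  obtain ⟨b, hb⟩ : ∃ b, n = 1 + a + b := ⟨n - 1 - a, by ring⟩
  have hab : a * b + a + b = 0 := by
    rw [hb] at ha
    linear_combination -ha
  have hm : (1 + a) * (1 + b) = 1 := by linear_combination hab
  have ha1 : 1 + a ≠ 0 := left_ne_zero_of_mul_eq_one hm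
  have hb1 : 1 + b ≠ 0 := right_ne_zero_of_mul_eq_one hm
  have hsum : a + b ≠ 0 := fun h => hn1 (by rw [hb]; linear_combination h)
  have hprod : a * b ≠ 0 := fun h => hsum (by linear_combination hab - h)
  -- In characteristic 2 the quotient 3/2 is 0 by convention, but there 3 - 2n = 1 anyway.
  have h32 : 3 - 2 * n ≠ 0 := fun h => by
    have h20 : (2 : K) ≠ 0 := fun h20 => one_ne_zero (α := K) (by linear_combination h + (n - 1) * h20)
    exact hn2 (by field_simp; linear_combination -h)
  have hψ : ∀ u : K, u ≠ 0 → u ^ 3 + (c * (1 + a + b) - 1) * u ^ 2 - 2 * c * u - c ^ 2 = 0 →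
      ψ u = n := fun u hu h => by
    simp only [ψ, hb]
    field_simp
    linear_combination -h
  have hχ : ∀ {x : K}, 1 + x ≠ 0 → n * (1 + x) = x ^ 2 + x + 1 → x ^ 3 - x - c ≠ 0 :=
    fun {x} hx hnx h => h3 ⟨x, show x ^ 3 + -1 * x + -c = 0 by linear_combination h, by
      rw [add_comm] at hx
      simp only [χ]
      field_simp
      linear_combination -hnx⟩
  refine ⟨a, b, c, hc, left_ne_zero_of_mul hprod, right_ne_zero_of_mul hprod, ?_, ?_, ?_, hm, hsum,
    hχ ha1 ?_, hχ hb1 ?_, ?_, ?_, ?_⟩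
  · rintro rfl
    exact h32 (by rw [hb]; linear_combination -hab)
  · rintro rfl
    exact h32 (by rw [hb]; linear_combination -hab)
  · rintro rfl
    have : (n - 1) * (n + 3) = 0 := by rw [hb]; linear_combination 4 * hab
    rcases mul_eq_zero.1 this with h | h
    · exact hn1 (by linear_combination h)
    · exact hn3 (by linear_combination h)
  · rw [hb]
    linear_combination hab
  · rw [hb]
    linear_combination hab
  · intro u h h'
    have e : 2 * u + 3 * c = 0 := by linear_combination u * h' - 3 * h
    apply mul_ne_zero hc hc'
    linear_combination (-8) * h + (4 * u ^ 2 - 6 * c * u + 9 * c ^ 2 - 4) * e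
  · intro u h h'
    have hu : u ≠ 0 := by
      rintro rfl
      apply pow_ne_zero 2 hc
      linear_combination -h
    -- Eliminating n between the cubic and its derivative bounds the possible double roots
    -- independently of n.
    exact h2 ⟨u, show u ^ 3 + 2 * c * u + 2 * c ^ 2 = 0 by linear_combination u * h' - 2 * h, hψ u hu h⟩
  · intro u h h'
    have hu : u ≠ 0 := by
      rintro rfl
      apply hc
      linear_combination -h
    exact h1 ⟨u, show u ^ 3 + -1 * u + -c = 0 by linear_combination h, hψ u hu h'⟩

/-- The conic in which the plane `X₀ = X₂ + c X₃` cuts the quadric `X₀ X₃ = X₁ X₂`. -/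
def exampleConic (c : K) : Matrix (Fin 4) (Fin 3) K :=
  !![0, c, 1; c, 1, 0; 0, 0, 1; 0, 1, 0]

/-- Five points on the standard twisted cubic. -/
def examplePoints (a b : K) : Fin 5 → Fin 4 → K :=
  ![![0, 0, 0, 1], ![1, 1, 1, 1], ![a ^ 3, a ^ 2, a, 1], ![b ^ 3, b ^ 2, b, 1], ![1, 0, 0, 0]]

theorem exampleConic_mulVec (c : K) (u : Fin 3 → K) :
    (exampleConic c).mulVec u = ![c * u 1 + u 2, c * u 0 + u 1, u 2, u 1] := by
  funext i
  fin_cases i <;> simp [exampleConic, Matrix.mulVec, dotProduct, Fin.sum_univ_three]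

theorem planeForm_exampleConic (c : K) (y : Fin 4 → K) :
    planeForm (exampleConic c) y = c * (y 0 - y 2 - c * y 3) := by
  simp [planeForm, augment, exampleConic, Matrix.det_succ_row_zero, Fin.sum_univ_succ,
    Fin.succAbove]
  ring

theorem det_examplePoints (a b : K) (k : Fin 5) :
    (Matrix.of fun j : Fin 4 => examplePoints a b (k.succAbove j)).det =
      ![(b - a) * (1 - a) * (1 - b), a * b * (b - a), b * (b - 1), a * (a - 1),
        a * b * (b - a) * (1 - a) * (1 - b)] k := by
  fin_cases k <;>
    simp [examplePoints, Matrix.det_succ_row_zero, Fin.sum_univ_succ, Fin.succAbove] <;> ring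

open MvPolynomial in
/-- The equation `X₀ X₃ = X₁ X₂`. -/
noncomputable def segrePoly (K : Type*) [Field K] : MvPolynomial (Fin 4) K := X 0 * X 3 - X 1 * X 2

theorem eval_segrePoly (x : Fin 4 → K) :
    MvPolynomial.eval x (segrePoly K) = x 0 * x 3 - x 1 * x 2 := by
  simp [segrePoly]

theorem segrePoly_isHomogeneous : (segrePoly K).IsHomogeneous 2 :=
  ((MvPolynomial.isHomogeneous_X K 0).mul (MvPolynomial.isHomogeneous_X K 3)).sub
    ((MvPolynomial.isHomogeneous_X K 1).mul (MvPolynomial.isHomogeneous_X K 2))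

theorem exists_segreForm : ∃ q : QuadraticForm K (Fin 4 → K),
    (∀ x, q x = x 0 * x 3 - x 1 * x 2) ∧
    ∀ x z, QuadraticMap.polar q x z = x 0 * z 3 + x 3 * z 0 - x 1 * z 2 - x 2 * z 1 := by
  obtain ⟨q, hq⟩ := exists_quadraticForm_eval (segrePoly_isHomogeneous (K := K))
  have h : ∀ x, q x = x 0 * x 3 - x 1 * x 2 := fun x => by rw [hq, eval_segrePoly]
  refine ⟨q, h, fun x z => ?_⟩
  rw [QuadraticMap.polar, h, h, h]
  simp only [Pi.add_apply]
  ring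

theorem segreForm_exampleConic {q : QuadraticForm K (Fin 4 → K)}
    (hq : ∀ x, q x = x 0 * x 3 - x 1 * x 2) (c : K) (u : Fin 3 → K) :
    q ((exampleConic c).mulVec u) = -c * (u 0 * u 2 - u 1 ^ 2) := by
  rw [hq, exampleConic_mulVec]
  simp
  ring

theorem segreForm_examplePoints {q : QuadraticForm K (Fin 4 → K)}
    (hq : ∀ x, q x = x 0 * x 3 - x 1 * x 2) (a b : K) (i : Fin 5) :
    q (examplePoints a b i) = 0 := by
  rw [hq]
  fin_cases i <;> simp [examplePoints] <;> ring

namespace ExampleParameters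

variable {a b c : K}

theorem planeForm_ne_zero (h : ExampleParameters a b c) (i : Fin 5) :
    planeForm (exampleConic c) (examplePoints a b i) ≠ 0 := by
  rw [planeForm_exampleConic]
  refine mul_ne_zero h.c_ne ?_
  fin_cases i
  · simpa [examplePoints] using h.c_ne
  · simpa [examplePoints] using h.c_ne
  · simpa [examplePoints] using h.cubic_a
  · simpa [examplePoints] using h.cubic_b
  · simp [examplePoints]

/-- For parameters θ, φ on the standard cubic the polar value is (θ - φ)²(θ + φ); with the point at
infinity it is 1. -/
theorem polar_ne_zero (h : ExampleParameters a b c) {i j : Fin 5} (hij : i ≠ j) :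
    examplePoints a b i 0 * examplePoints a b j 3 + examplePoints a b i 3 * examplePoints a b j 0 -
      examplePoints a b i 1 * examplePoints a b j 2 -
      examplePoints a b i 2 * examplePoints a b j 1 ≠ 0 := by
  have ha := pow_ne_zero 3 h.a_ne
  have hb := pow_ne_zero 3 h.b_ne
  have h1a := mul_ne_zero (pow_ne_zero 2 (sub_ne_zero.2 h.a_ne_one))
    (left_ne_zero_of_mul_eq_one h.one_add_mul)
  have h1b := mul_ne_zero (pow_ne_zero 2 (sub_ne_zero.2 h.b_ne_one))
    (right_ne_zero_of_mul_eq_one h.one_add_mul)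
  have hab := mul_ne_zero (pow_ne_zero 2 (sub_ne_zero.2 h.a_ne_b)) h.a_add_b
  fin_cases i <;> fin_cases j <;> first
    | exact absurd rfl hij
    | (refine ne_of_eq_of_ne ?_ one_ne_zero; simp [examplePoints]; done)
    | (refine ne_of_eq_of_ne ?_ ha; simp [examplePoints]; done)
    | (refine ne_of_eq_of_ne ?_ hb; simp [examplePoints]; done)
    | (refine ne_of_eq_of_ne ?_ h1a; simp [examplePoints]; ring1)
    | (refine ne_of_eq_of_ne ?_ h1b; simp [examplePoints]; ring1)
    | (refine ne_of_eq_of_ne ?_ hab; simp [examplePoints]; ring1)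

theorem inGeneralPosition (h : ExampleParameters a b c) :
    InGeneralPosition (exampleConic c) (examplePoints a b) := by
  obtain ⟨q, hq, hpol⟩ := exists_segreForm (K := K)
  refine (inGeneralPosition_iff _ _).2 ⟨fun k => ?_, h.planeForm_ne_zero, fun i j hij hs => ?_⟩
  · have ha := sub_ne_zero.2 h.a_ne_one.symm
    have hb := sub_ne_zero.2 h.b_ne_one.symm
    have hba := sub_ne_zero.2 h.a_ne_b.symm
    rw [det_examplePoints]
    have ha' := sub_ne_zero.2 h.a_ne_one
    have hb' := sub_ne_zero.2 h.b_ne_one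
    fin_cases k <;> simp [h.a_ne, h.b_ne, ha, hb, ha', hb', hba]
  · have := secantForm_mul (segreForm_exampleConic hq c) (segreForm_examplePoints hq a b i)
      (segreForm_examplePoints hq a b j)
    rw [hs, mul_zero, eq_comm, neg_eq_zero, hpol] at this
    exact mul_ne_zero (mul_ne_zero (h.planeForm_ne_zero i) (h.planeForm_ne_zero j))
      (h.polar_ne_zero hij) this

theorem quadricConfig (h : ExampleParameters a b c) :
    QuadricConfig (exampleConic c) (examplePoints a b) := by
  obtain ⟨q, hq, -⟩ := exists_segreForm (K := K)
  have heval : ∀ x, MvPolynomial.eval x (segrePoly K) = q x := fun x => by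
    rw [eval_segrePoly, hq]
  refine ⟨h.inGeneralPosition, segrePoly K, fun h0 => ?_, segrePoly_isHomogeneous, ?_, fun i => ?_⟩
  · have := eval_segrePoly (K := K) ![1, 0, 0, 1]
    rw [h0] at this
    simp at this
  · rintro P ⟨s, t, -, hP⟩
    rw [mem_quadricLocus_iff segrePoly_isHomogeneous hP, heval, segreForm_exampleConic hq]
    simp only [Matrix.cons_val_zero, Matrix.cons_val_one, Matrix.cons_val]
    ring
  · have h0 : examplePoints a b i ≠ 0 := fun h0 =>
      h.inGeneralPosition.2.2.1 i 0 (by rw [h0, Matrix.mulVec_zero])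
    refine ⟨_, ?_, represents_mk h0⟩
    rw [mem_quadricLocus_iff segrePoly_isHomogeneous (represents_mk h0), heval,
      segreForm_examplePoints hq]

/-- The coordinates of a vector with respect to the first four points. -/
def coordinates (a b : K) (p : Fin 4 → K) : Fin 4 → K :=
  ![(p 0 - (1 + a + b) * p 1 + (a + b + a * b) * p 2 - a * b * p 3) / (-(a * b)),
    (p 0 - (a + b) * p 1 + a * b * p 2) / ((1 - a) * (1 - b)),
    (p 0 - (1 + b) * p 1 + b * p 2) / (a * (a - 1) * (a - b)),
    (p 0 - (1 + a) * p 1 + a * p 2) / (b * (b - 1) * (b - a))]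

theorem pointMatrix_mulVec_coordinates (h : ExampleParameters a b c) (p : Fin 4 → K) :
    (pointMatrix (examplePoints a b)).mulVec (coordinates a b p) = p := by
  have ha := h.a_ne
  have hb := h.b_ne
  have ha1 := sub_ne_zero.2 h.a_ne_one
  have hb1 := sub_ne_zero.2 h.b_ne_one
  have ha2 := sub_ne_zero.2 h.a_ne_one.symm
  have hb2 := sub_ne_zero.2 h.b_ne_one.symm
  have hab := sub_ne_zero.2 h.a_ne_b
  have hba := sub_ne_zero.2 h.a_ne_b.symm
  have e1 : (1 : K) - a = -(a - 1) := by ring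
  have e2 : (1 : K) - b = -(b - 1) := by ring
  have e3 : b - a = -(a - b) := by ring
  rw [pointMatrix_mulVec]
  funext i
  fin_cases i
  all_goals
    simp only [coordinates, examplePoints, Pi.add_apply, Pi.smul_apply, smul_eq_mul, Fin.zero_eta,
      Fin.mk_one, Fin.reduceFinMk, Matrix.cons_val_zero, Matrix.cons_val_one, Matrix.cons_val, e1,
      e2, e3]
    field_simp
    ring

theorem sum_sq_mul_prod_succAbove (w x : Fin 4 → K) :
    ∑ k : Fin 4, w k ^ 2 * ∏ j, x (k.succAbove j) = w 0 ^ 2 * (x 1 * x 2 * x 3) +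
      w 1 ^ 2 * (x 0 * x 2 * x 3) + w 2 ^ 2 * (x 0 * x 1 * x 3) + w 3 ^ 2 * (x 0 * x 1 * x 2) := by
  simp [Fin.sum_univ_four, Fin.prod_univ_three, Fin.succAbove]

/-- One cubic factor gives the points where the conic meets the standard twisted cubic, which is one
of the two cubics through the points. The complementary factor belongs to the other one. -/
theorem sum_coordinates (h : ExampleParameters a b c) :
    ∃ δ : K, δ ≠ 0 ∧ ∀ u : K, ∑ k : Fin 4, coordinates a b ![1, 0, 0, 0] k ^ 2 *
      ∏ j, coordinates a b ![c * u + u ^ 2, c + u, u ^ 2, u] (k.succAbove j) =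
      δ * ((u ^ 3 - u - c) *
        (u ^ 3 + (c * (1 + a + b) - 1) * u ^ 2 - 2 * c * u - c ^ 2)) := by
  have ha := h.a_ne
  have hb := h.b_ne
  have ha1 := sub_ne_zero.2 h.a_ne_one
  have hb1 := sub_ne_zero.2 h.b_ne_one
  have hab := sub_ne_zero.2 h.a_ne_b
  have e1 : (1 : K) - a = -(a - 1) := by ring
  have e2 : (1 : K) - b = -(b - 1) := by ring
  have e3 : b - a = -(a - b) := by ring
  refine ⟨-(a ^ 2 * b ^ 2 * (a - 1) ^ 2 * (b - 1) ^ 2 * (a - b) ^ 2)⁻¹, ?_, fun u => ?_⟩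
  · simp [ha, hb, ha1, hb1, hab]
  -- The second factor for arbitrary a, b; the normalization (1 + a)(1 + b) = 1 makes it monic.
  · have hD : u ^ 3 + (c * (1 + a + b) - 1) * u ^ 2 - 2 * c * u - c ^ 2 =
        (1 + a) * (1 + b) * u ^ 3 + (c * (1 + a + b) - (1 + a) * (1 + b)) * u ^ 2 -
          c * (1 + (1 + a) * (1 + b)) * u - c ^ 2 := by
      rw [h.one_add_mul]
      ring
    rw [hD, sum_sq_mul_prod_succAbove]
    simp only [coordinates, Matrix.cons_val_zero, Matrix.cons_val_one, Matrix.cons_val, e1, e2, e3,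
      mul_zero, sub_zero, add_zero]
    field_simp
    ring

end ExampleParameters

end Example

/-! ### Genericity of the explicit configuration -/

section ExampleGenericity

open Polynomial

variable {K : Type*} [Field K]

/-- The derivative may have degree less than 5 when the characteristic divides 6. The resultant with
formal degree 5 then acquires only, up to sign, a power of the leading coefficient of the sextic,
which is nonzero. -/
theorem genericity_ne_zero_of_isCoprime {A : Matrix (Fin 4) (Fin 3) K} {v : Fin 5 → Fin 4 → K}
    (hdet : (secantMatrix A v).det ≠ 0) (hcoeff : (conicSextic A v).coeff 6 ≠ 0)
    (hcop : IsCoprime (conicSextic A v) (derivative (conicSextic A v))) : genericity A v ≠ 0 := by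
  set f := conicSextic A v with hf
  have hdeg : f.natDegree = 6 :=
    le_antisymm (conicSextic_natDegree_le A v) (le_natDegree_of_ne_zero hcoeff)
  obtain ⟨k, hk⟩ : ∃ k, 5 = (derivative f).natDegree + k :=
    Nat.exists_eq_add_of_le ((natDegree_derivative_le f).trans (by rw [hdeg]))
  refine mul_ne_zero (mul_ne_zero hdet hcoeff) ?_
  rw [← hf, hk, resultant_add_right_deg _ _ _ _ _ le_rfl, ← hdeg]
  refine mul_ne_zero (pow_ne_zero _ ?_) (resultant_ne_zero _ _ hcop)
  rwa [hdeg]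

namespace ExampleParameters

variable {a b c : K}

theorem det_secantMatrix_ne_zero (h : ExampleParameters a b c) :
    (secantMatrix (exampleConic c) (examplePoints a b)).det ≠ 0 := by
  obtain ⟨q, hq, hpol⟩ := exists_segreForm (K := K)
  refine (det_secantMatrix_ne_zero_iff h.inGeneralPosition (neg_ne_zero.2 h.c_ne)
    (segreForm_exampleConic hq c) (segreForm_examplePoints hq a b)).2 fun n hn => ?_
  by_contra! h0
  apply hn
  have h1 := h0 ![1, 0, 0, 0]
  have h2 := h0 ![0, 1, 0, 0]
  have h3 := h0 ![0, 0, 1, 0]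
  have h4 := h0 ![0, 0, 0, 1]
  simp [hpol] at h1 h2 h3 h4
  funext i
  fin_cases i <;> assumption

theorem exists_conicSextic_eq [Infinite K] (h : ExampleParameters a b c) :
    ∃ δ : K, δ ≠ 0 ∧ conicSextic (exampleConic c) (examplePoints a b) =
      C δ * ((X ^ 3 - X - C c) *
        (X ^ 3 + C (c * (1 + a + b) - 1) * X ^ 2 - C (2 * c) * X - C (c ^ 2))) := by
  obtain ⟨q, hq, hpol⟩ := exists_segreForm (K := K)
  obtain ⟨δ, hδ, hsum⟩ := h.sum_coordinates
  have hc := neg_ne_zero.2 h.c_ne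
  have hV := det_pointMatrix_ne_zero h.inGeneralPosition
  have hp := h.planeForm_ne_zero
  set A := exampleConic c
  set v := examplePoints a b with hv
  let ε := -((pointMatrix v).det ^ 5 * (∏ l : Fin 4, planeForm A (v l.castSucc)) *
    planeForm A (v 4))
  have hε : ε ≠ 0 := neg_ne_zero.2 (mul_ne_zero (mul_ne_zero (pow_ne_zero 5 hV)
    (Finset.prod_ne_zero_iff.2 fun l _ => hp _)) (hp 4))
  refine ⟨(-c)⁻¹ * (ε * δ), mul_ne_zero (inv_ne_zero hc) (mul_ne_zero hε hδ),
    Polynomial.funext fun t => ?_⟩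
  have hω : (pointMatrix v).mulVec (coordinates a b ![1, 0, 0, 0]) = v 4 :=
    h.pointMatrix_mulVec_coordinates _
  have hx : (pointMatrix v).mulVec (coordinates a b ![c * t + t ^ 2, c + t, t ^ 2, t]) =
      A.mulVec ![1, t, t ^ 2] := by
    rw [h.pointMatrix_mulVec_coordinates, exampleConic_mulVec]
    simp
  -- The fifth point is (1, 0, 0, 0) and the others have last coordinate 1, so the weights in the
  -- cubic surface reduce to the squares ω_k².
  have hpol4 : ∀ k : Fin 4, QuadraticMap.polar q (v k.castSucc) (v 4) = 1 := fun k => by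
    rw [hpol]
    fin_cases k <;> simp [hv, examplePoints]
  have := conicSextic_eval (A := A) (v := v) (segreForm_exampleConic hq c) (segreForm_examplePoints hq a b) hω hx
  simp only [hpol4, mul_one, hsum] at this
  rw [← mul_right_inj' hc, this]
  simp only [eval_mul, eval_add, eval_sub, eval_pow, eval_X, eval_C]
  rw [mul_assoc (-c)⁻¹, mul_inv_cancel_left₀ hc, mul_assoc ε]

theorem genericity_ne_zero [IsAlgClosed K] (h : ExampleParameters a b c) :
    genericity (exampleConic c) (examplePoints a b) ≠ 0 := by
  obtain ⟨δ, hδ, hf⟩ := h.exists_conicSextic_eq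
  refine genericity_ne_zero_of_isCoprime h.det_secantMatrix_ne_zero ?_ ?_
  · have h1 : (X ^ 3 - X - C c : K[X]).natDegree = 3 := by compute_degree!
    have h2 : (X ^ 3 + C (c * (1 + a + b) - 1) * X ^ 2 - C (2 * c) * X - C (c ^ 2) :
      K[X]).natDegree = 3 := by compute_degree!
    have h1' : (X ^ 3 - X - C c : K[X]).coeff 3 = 1 := by compute_degree!
    have h2' : (X ^ 3 + C (c * (1 + a + b) - 1) * X ^ 2 - C (2 * c) * X - C (c ^ 2) :
      K[X]).coeff 3 = 1 := by compute_degree!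
    rw [hf, coeff_C_mul, coeff_mul_add_eq_of_natDegree_le (df := 3) (dg := 3) h1.le h2.le, h1', h2']
    simpa using hδ
  · rw [hf, isCoprime_iff_aeval_ne_zero_of_isAlgClosed K K]
    intro u
    have h1 := h.separable_left u
    have h2 := h.separable_right u
    have h3 := h.coprime u
    simp only [coe_aeval_eq_eval, derivative_mul, derivative_sub, derivative_add,
      derivative_X_pow, derivative_X, derivative_C, eval_mul, eval_add, eval_sub, eval_pow, eval_X,
      eval_C, eval_zero, eval_one]
    by_contra! hu
    obtain ⟨hu, hu'⟩ := hu
    replace hu := (mul_eq_zero.1 hu).resolve_left hδ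
    have hu'' : (3 * u ^ 2 - 1) *
        (u ^ 3 + (c * (1 + a + b) - 1) * u ^ 2 - 2 * c * u - c ^ 2) + (u ^ 3 - u - c) *
          (3 * u ^ 2 + 2 * (c * (1 + a + b) - 1) * u - 2 * c) = 0 := by
      push_cast at hu'
      apply mul_left_cancel₀ hδ
      linear_combination hu'
    rcases mul_eq_zero.1 hu with e | e
    · rw [e, zero_mul, add_zero] at hu''
      exact mul_ne_zero (h1 e) (h3 e) hu''
    · rw [e, mul_zero, zero_add] at hu''
      exact mul_ne_zero (fun e' => h3 e' e) (h2 e) hu''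

end ExampleParameters

end ExampleGenericity

/-- The genericity condition, as a polynomial in the coordinates of the configuration. -/
noncomputable def genericityPoly (K : Type*) [Field K] :
    MvPolynomial ((Fin 4 × Fin 3) ⊕ (Fin 5 × Fin 4)) K :=
  genericity (Matrix.of fun i j => MvPolynomial.X (Sum.inl (i, j)))
    fun i j => MvPolynomial.X (Sum.inr (i, j))

theorem evalConfig_genericityPoly {K : Type*} [Field K] (A : Matrix (Fin 4) (Fin 3) K)
    (v : Fin 5 → Fin 4 → K) : evalConfig (genericityPoly K) A v = genericity A v := by
  rw [evalConfig, genericityPoly, ← genericity_map]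
  congr 1
  · ext i j
    simp
  · funext i j
    simp

theorem proposition2p4 (K : Type*) [Field K] [IsAlgClosed K] :
    ∃ F : MvPolynomial ((Fin 4 × Fin 3) ⊕ (Fin 5 × Fin 4)) K,
      IsGenericityCondition F ∧
      ∀ (A : Matrix (Fin 4) (Fin 3) K) (v : Fin 5 → Fin 4 → K),
        InGeneralPosition A v → evalConfig F A v ≠ 0 →
        ((∃ Q, IsQuadricThrough Q A v) ↔ ∃ T, IsTrisecantCubic T A v) ∧
        ∀ Q, IsQuadricThrough Q A v →
          (∃ g : Matrix (Fin 4) (Fin 4) K, g.det ≠ 0 ∧ quadricLocus Q = segreQuadric g) ∧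
          ∀ g : Matrix (Fin 4) (Fin 4) K, g.det ≠ 0 → quadricLocus Q = segreQuadric g →
            HasBidegree g (conic A) 1 1 ∧
            ∃ T₁ T₂ : Set (P3 K), T₁ ≠ T₂ ∧
              HasBidegree g T₁ 1 2 ∧ HasBidegree g T₂ 2 1 ∧
              {T | IsTrisecantCubic T A v} = {T₁, T₂} := by
  obtain ⟨a, b, c, h⟩ := exists_exampleParameters (K := K)
  refine ⟨genericityPoly K, ⟨⟨_, _, h.quadricConfig⟩, fun A v hAv G hG =>
    hAv.exists_evalConfig_ne_zero h.quadricConfig hG ?_⟩, fun A v hgp hF =>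
    trisecant_cubics_of_genericity_ne_zero hgp ?_⟩
  · rw [evalConfig_genericityPoly]
    exact h.genericity_ne_zero
  · rwa [evalConfig_genericityPoly] at hF
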